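/- **Setting.** Let $p$ be a prime, $n\ge 0$, $d\ge n+1$. Let $x^{\mathbf b_1},\dots,x^{\mathbf b_N}$ be all monomials of degree $d$ in $x_0,\dots,x_n$, put $\mathbf a_k=(\mathbf b_k,1)\in\mathbb N^{n+2}$, $A=\{\mathbf a_k\}$, and order them so that $\mathbf b_1,\dots,\mathbf b_M$ are those with all coordinates positive. Let $L_{i,u}$ ($1\le i\le M$) be the set of $l\in\mathbb Z^N$ with $\sum_k l_k\mathbf a_k=u$, $l_i\le 0$ and $l_k\ge 0$ for $k\ne i$; put $L_i=L_{i,\mathbf 0}$. Let $\mathcal C\subseteq\mathbb R^N$ be the real cone generated by $\bigcup_{i\le M}L_i$, and $E=\mathcal C\cap\mathbb Z^N$. Let $\mathcal M$ be the group generated by $A$ and $\mathcal M_-=\mathcal M\cap(\mathbb Z_{<0})^{n+2}$. For $i,j\le M$ put $B_{ij}(\Lambda)=\Lambda_i^{-p}\Lambda_j\sum_\nu \Lambda^\nu/(\nu_1!\cdots\nu_N!)$, the sum over $\nu\in\mathbb N^N$ with $\sum_k\nu_k\mathbf a_k=p\mathbf a_i-\mathbf a_j$, and $D=\det B$. It has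 $p$-integral rational coefficients; $\bar D$ is its reduction mod $p$. **Rings.** Bounded Laurent series over $\mathbb C_p$ in $\Lambda_1,\dots,\Lambda_N$ carry the norm $|\sum c_l\Lambda^l|=\sup|c_l|$. $R_E$ is the ring of bounded series with exponents in $E$; $L_E\subset R_E$ is the subring of Laurent polynomials; $R'_E$ is the completion of $\{h/D^k: h\in L_E,k\ge 0\}\subset R_E$. $R$ is the completion of $R_E[\Lambda_1^{\pm1},\dots,\Lambda_N^{\pm1}]$ and $R'$ that of $R'_E[\Lambda_1^{\pm1},\dots,\Lambda_M^{\pm1},\Lambda_{M+1},\dots,\Lambda_N]$. $R_u$, $R'_u$ are the subspaces of series all of whose monomials $\Lambda^l$ have $\sum_k l_k\mathbf a_k=u$. Let $\mathcal D\subset\mathbb C_p^N$ be the set of $\lambda$ with $|\lambda_k|=1$ for $k\le M$, $|\lambda_k|\le 1$ for $k>M$, $|D(\lambda)|=1$. Elements of $R'$ are evaluated on $\mathcal D$ by $\xi(\lambda)=\lim h_k(\lambda)/D(\lambda)^k$ if $\xi=\lim h_k/D^k\in R'_E$, and in general by finite sums $\sum_m\Lambda^m\xi_m$ with $\xi_m\in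 R'_E$ and passage to the limit. **Series.** Let $\gamma_0\in\mathbb C_p$ be a zero of $\sum_{i\ge0}t^{p^i}/p^i$ with $\operatorname{ord}\gamma_0=1/(p-1)$, $\gamma_j=\sum_{i\le j}\gamma_0^{p^i}/p^i$, and $\hat\theta_1(t)=\prod_{j\ge1}\exp(\gamma_jt^{p^j})$. For $u\in\mathcal M_-$ put $$F^{(i)}_u(\Lambda)=\sum_{l\in L_{i,u}}\frac{(-1)^{-l_i-1}(-l_i-1)!}{\prod_{k\ne i}l_k!}\Lambda^l .$$ Let $\hat\theta_{1,v}(\Lambda)$ be the coefficient of $\gamma_0^{v_{n+1}}x^v$ in $\prod_k\hat\theta_1(\Lambda_kx^{\mathbf a_k})$, where $v\in\mathbb NA$, and put $G^{(i)}_u=\sum F^{(i)}_{u_1}\hat\theta_{1,u_2}$ over $u_1\in\mathcal M_-$, $u_2\in\mathbb NA$, $u_1+u_2=u$. Let $F(\Lambda,x)$, $G(\Lambda,x)$ be the column vectors with entries $\sum_{u\in\mathcal M_-}F^{(i)}_u\gamma_0^{u_{n+1}}x^u$, resp. $\sum_{u\in\mathcal M_-} G^{(i)}_u\gamma_0^{u_{n+1}}x^u$,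 $1\le i\le M$. Let $F(\Lambda)$, $G(\Lambda)$ be the $M\times M$ matrices with entries $F_{ij}=\Lambda_jF^{(i)}_{-\mathbf a_j}$, $G_{ij}=\Lambda_jG^{(i)}_{-\mathbf a_j}$; explicitly, $$F_{ij}(\Lambda)=\sum_{l\in L_i,\ l_j>0}\frac{(-1)^{-l_i-1}(-l_i-1)!}{(l_j-1)!\prod_{k\neq i,j}l_k!}\Lambda^l\ (i\ne j),\qquad F_{ii}(\Lambda)=\sum_{l\in L_i}\frac{(-1)^{-l_i}(-l_i)!}{\prod_{k\ne i}l_k!}\Lambda^l .$$ $S'$ is the space of series $\sum_{u\in\mathcal M_-}\xi_u(\Lambda)\gamma_0^{u_{n+1}}x^u$ with $\xi_u\in R'_u$ and $\{|\xi_u|\}_u$ bounded. **Proposition.** The series $G^{(i)}_u$ converge, $F^{(i)}_u,G^{(i)}_u\in R_u$ for $u\in\mathcal M_-$, the matrices $F(\Lambda)$, $G(\Lambda)$, $F(\Lambda^p)$, $G(\Lambda^p)$ are invertible over $R$, and $F(\Lambda)$, $F(\Lambda)^{-1}$ have entries in $R_E$. Put $$\mathcal F(\Lambda)=F(\Lambda^p)^{-1}F(\Lambda),\quad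 \mathcal G(\Lambda)=G(\Lambda^p)^{-1}G(\Lambda),\quad \mathcal H(\Lambda)=F(\Lambda)^{-1}G(\Lambda).$$ 1. The vectors $F(\Lambda)^{-1}F(\Lambda,x)$, $G(\Lambda)^{-1}F(\Lambda,x)$ and $F(\Lambda)^{-1}G(\Lambda,x)$ lie in $(S')^M$. 2. $\mathcal H(\Lambda)$ and $\mathcal H(\Lambda)^{-1}=G(\Lambda)^{-1}F(\Lambda)$ have entries in $R'_{\mathbf 0}$. 3. $\mathcal F(\Lambda)$ and $\mathcal G(\Lambda)$ have entries in $R'_{\mathbf 0}$ (so these entries have well-defined values at all points of $\mathcal D$), and $\mathcal F(\Lambda)=\mathcal H(\Lambda^p)\,\mathcal G(\Lambda)\,\mathcal H(\Lambda)^{-1}$. 4. Let $q=p^a$, fix an embedding of $\mathbb F_q$ in the residue field of $\mathbb C_p$, let $\lambda\in(\mathbb F_q^\times)^M\times\mathbb F_q^{N-M}$ with $\bar D(\lambda)\ne 0$, and let $\hat\lambda\in\mathbb C_p^N$ be its Teichmüller lifting ($\hat\lambda_k^q=\hat\lambda_k$ and $\hat\lambda_k$ reduces to $\lambda_k$). Then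 $\hat\lambda^{p^i}\in\mathcal D$ for $i=0,\dots,a-1$ and $$\det\bigl(I-t\mathcal F(\hat\lambda^{p^{a-1}})\mathcal F(\hat\lambda^{p^{a-2}})\cdots\mathcal F(\hat\lambda)\bigr)=\det\bigl(I-t\mathcal G(\hat\lambda^{p^{a-1}})\mathcal G(\hat\lambda^{p^{a-2}})\cdots\mathcal G(\hat\lambda)\bigr).$$ -/

import Mathlib

noncomputable section

namespace HasseWitt

/-! ### Monomials, exponent vectors, cones -/

/-- The exponents `b` of all monomials of degree `d` in `x_0, …, x_n`; this is the index set
of the variables `Λ_k`. -/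
abbrev Mon (n d : ℕ) : Type := {b : Fin (n + 1) → ℕ // ∑ i, b i = d}

instance Mon.fintype (n d : ℕ) : Fintype (Mon n d) :=
  Fintype.subtype (Finset.Nat.antidiagonalTuple (n + 1) d)
    (fun _ => Finset.Nat.mem_antidiagonalTuple)

/-- The index set `U`: monomials of degree `d` divisible by `x_0 ⋯ x_n`. -/
abbrev Inn (n d : ℕ) : Type := {k : Mon n d // ∀ i, 0 < k.1 i}

/-- The lattice `ℤ^{n+2}`, written as (first `n+1` coordinates, last coordinate). -/
abbrev Lat (n : ℕ) : Type := (Fin (n + 1) → ℤ) × ℤ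

/-- The augmented vector `a_k = (b_k, 1)`. -/
def avec {n d : ℕ} (k : Mon n d) : Lat n := (fun i => (k.1 i : ℤ), 1)

/-- Exponents `l ∈ ℤ^N` of monomials `Λ^l`. -/
abbrev Expo (n d : ℕ) : Type := Mon n d → ℤ

/-- The degree `∑ l_k a_k` of `Λ^l`. -/
def deg {n d : ℕ} (l : Expo n d) : Lat n := ∑ k, l k • avec k

/-- `L_{i,u}`: exponents of degree `u` with `l_i ≤ 0` and `l_k ≥ 0` for `k ≠ i`. -/
def LSetDeg {n d : ℕ} (i : Inn n d) (u : Lat n) : Set (Expo n d) :=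
  {l | deg l = u ∧ l i.1 ≤ 0 ∧ ∀ k, k ≠ i.1 → 0 ≤ l k}

/-- `L_i = L_{i,0}`. -/
def LSet {n d : ℕ} (i : Inn n d) : Set (Expo n d) := LSetDeg i 0

/-- The real cone generated by `⋃ L_i`. -/
def cone (n d : ℕ) : Set (Mon n d → ℝ) :=
  Submodule.span NNReal {x | ∃ i : Inn n d, ∃ l ∈ LSet i, x = fun k => (l k : ℝ)}

/-- `E`: the integral points of the cone. -/
def ESet (n d : ℕ) : Set (Expo n d) := {l | (fun k => (l k : ℝ)) ∈ cone n d}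

/-- The group `𝓜` generated by the `a_k`. -/
def MGroup (n d : ℕ) : AddSubgroup (Lat n) := AddSubgroup.closure (Set.range (avec (d := d)))

/-- The points of `𝓜` all of whose coordinates are negative. -/
def MMinus (n d : ℕ) : Set (Lat n) := {u | u ∈ MGroup n d ∧ (∀ i, u.1 i < 0) ∧ u.2 < 0}

/-- The monoid `ℕA` generated by the `a_k`. -/
def NA (n d : ℕ) : AddSubmonoid (Lat n) := AddSubmonoid.closure (Set.range (avec (d := d)))

/-! ### Laurent polynomials, the matrix `B(Λ)` and its determinant `D(Λ)` -/

/-- Laurent polynomials in the `Λ_k`. -/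
abbrev LPoly (K : Type*) [Field K] (n d : ℕ) : Type _ := AddMonoidAlgebra K (Expo n d)

/-- Value of a Laurent polynomial at a point. -/
def lpEval {K : Type*} [Field K] {n d : ℕ} (h : LPoly K n d) (lam : Mon n d → K) : K :=
  h.coeff.sum fun l c => c * ∏ k, lam k ^ l k

open Classical in
/-- `H_{ij}(Λ) = ∑ Λ^ν / ν!` over `ν ∈ ℕ^N` with `∑ ν_k a_k = p a_i - a_j`. Comparing last
coordinates, such a `ν` has `∑ ν_k = p - 1`, so every `ν_k` is `< p`. The coefficients are
`p`-integral rationals; they are taken here in any field in which `1, …, p-1` are invertible,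
so that over a field of characteristic `p` this is the reduction modulo `p` of `H`. -/
def Hmat (K : Type*) [Field K] (p n d : ℕ) : Matrix (Inn n d) (Inn n d) (LPoly K n d) :=
  Matrix.of fun i j =>
    ∑ ν ∈ (Fintype.piFinset fun _ : Mon n d => Finset.range p).filter
        (fun ν => ∑ k, ν k • avec k = p • avec i.1 - avec j.1),
      AddMonoidAlgebra.single (fun k => (ν k : ℤ)) (∏ k, (Nat.factorial (ν k) : K))⁻¹

/-- `B_{ij}(Λ) = Λ_i^{-p} Λ_j H_{ij}(Λ)`. -/
def Bmat (K : Type*) [Field K] (p n d : ℕ) : Matrix (Inn n d) (Inn n d) (LPoly K n d) :=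
  Matrix.of fun i j =>
    AddMonoidAlgebra.single (Pi.single j.1 1 - Pi.single i.1 (p : ℤ)) 1 * Hmat K p n d i j

/-- `D(Λ) = det B(Λ)`; over a field of characteristic `p` this is `D̄(Λ)`. -/
def Dpoly (K : Type*) [Field K] (p n d : ℕ) : LPoly K n d := (Bmat K p n d).det

/-! ### Laurent series over `ℂ_p` -/

/-- Formal Laurent series `∑ c_l Λ^l` over `ℂ_p`, given by their coefficients. -/
abbrev Ser (p : ℕ) [Fact p.Prime] (n d : ℕ) : Type := Expo n d → ℂ_[p]

section Series

variable {p : ℕ} [Fact p.Prime] {n d : ℕ}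

/-- The coefficients are bounded by `C`, i.e. `|ξ| ≤ C` for the sup norm. -/
def NormLE (ξ : Ser p n d) (C : ℝ) : Prop := ∀ l, ‖ξ l‖ ≤ C

/-- The space `𝔹` of Laurent series with bounded coefficients. -/
def BddSer (p : ℕ) [Fact p.Prime] (n d : ℕ) : Set (Ser p n d) := {ξ | ∃ C, NormLE ξ C}

/-- A Laurent polynomial as a Laurent series. -/
def ofPoly (h : LPoly ℂ_[p] n d) : Ser p n d := fun l => h.coeff l

/-- The product of Laurent series (on the ring `R` below the sums converge; on `R_E` they
are finite). -/
def serMul (ξ η : Ser p n d) : Ser p n d := fun l => ∑' m, ξ m * η (l - m)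

/-- The monomial multiple `Λ^m ξ(Λ)`. -/
def shift (m : Expo n d) (ξ : Ser p n d) : Ser p n d := fun l => ξ (l - m)

open Classical in
/-- `ξ(Λ^p)`. -/
def frob (ξ : Ser p n d) : Ser p n d :=
  fun l => if ∀ k, (p : ℤ) ∣ l k then ξ (fun k => l k / (p : ℤ)) else 0

/-- The completion, inside `𝔹` with the sup norm, of a set of series. -/
def normClosure (S : Set (Ser p n d)) : Set (Ser p n d) :=
  {ξ | ξ ∈ BddSer p n d ∧ ∀ ε > 0, ∃ η ∈ S, NormLE (ξ - η) ε}

/-- The ring `R_E`: bounded series with exponents in `E`. -/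
def RE (p : ℕ) [Fact p.Prime] (n d : ℕ) : Set (Ser p n d) :=
  {ξ | ξ ∈ BddSer p n d ∧ ∀ l, ξ l ≠ 0 → l ∈ ESet n d}

/-- `ξ = h / D^k` in `R_E`, with `h` a Laurent polynomial in `R_E`. -/
def IsFrac (ξ : Ser p n d) (h : LPoly ℂ_[p] n d) (k : ℕ) : Prop :=
  ξ ∈ RE p n d ∧ ofPoly h ∈ RE p n d ∧ serMul ξ (ofPoly (Dpoly ℂ_[p] p n d ^ k)) = ofPoly h

/-- `L_{E,D(Λ)}`. -/
def LED (p : ℕ) [Fact p.Prime] (n d : ℕ) : Set (Ser p n d) := {ξ | ∃ h k, IsFrac ξ h k}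

/-- `R'_E`, the completion of `L_{E,D(Λ)}`. -/
def RE' (p : ℕ) [Fact p.Prime] (n d : ℕ) : Set (Ser p n d) := normClosure (LED p n d)

/-- `R_E[Λ_k^{±1}]`. -/
def Rtilde (p : ℕ) [Fact p.Prime] (n d : ℕ) : Set (Ser p n d) :=
  {η | ∃ (s : Finset (Expo n d)) (ξ : Expo n d → Ser p n d),
    (∀ m ∈ s, ξ m ∈ RE p n d) ∧ η = ∑ m ∈ s, shift m (ξ m)}

/-- Exponents `m` with `m_k ≥ 0` for `k ∉ U`. -/
def NonnegOff (m : Expo n d) : Prop := ∀ k : Mon n d, (¬ ∀ i, 0 < k.1 i) → 0 ≤ m k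

/-- `η = ∑_{m ∈ s} Λ^m ξ_m` with `ξ_m ∈ R'_E` and `m_k ≥ 0` for `k ∉ U`. -/
def IsExpansion (η : Ser p n d) (s : Finset (Expo n d)) (ξ : Expo n d → Ser p n d) : Prop :=
  (∀ m ∈ s, NonnegOff m ∧ ξ m ∈ RE' p n d) ∧ η = ∑ m ∈ s, shift m (ξ m)

/-- `R'_E[Λ_k^{±1} (k ∈ U), Λ_k (k ∉ U)]`. -/
def Rtilde' (p : ℕ) [Fact p.Prime] (n d : ℕ) : Set (Ser p n d) :=
  {η | ∃ s ξ, IsExpansion η s ξ}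

/-- `R`, the completion of `R_E[Λ_k^{±1}]`. -/
def RR (p : ℕ) [Fact p.Prime] (n d : ℕ) : Set (Ser p n d) := normClosure (Rtilde p n d)

/-- `R'`, the completion of `R'_E[Λ_k^{±1} (k ∈ U), Λ_k (k ∉ U)]`. -/
def RR' (p : ℕ) [Fact p.Prime] (n d : ℕ) : Set (Ser p n d) := normClosure (Rtilde' p n d)

/-- `ξ` is homogeneous of degree `u`. -/
def HasDeg (ξ : Ser p n d) (u : Lat n) : Prop := ∀ l, ξ l ≠ 0 → deg l = u

/-- `R_u`. -/
def RRdeg (p : ℕ) [Fact p.Prime] (n d : ℕ) (u : Lat n) : Set (Ser p n d) :=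
  {ξ | ξ ∈ RR p n d ∧ HasDeg ξ u}

/-- `R'_u`. -/
def RRdeg' (p : ℕ) [Fact p.Prime] (n d : ℕ) (u : Lat n) : Set (Ser p n d) :=
  {ξ | ξ ∈ RR' p n d ∧ HasDeg ξ u}

/-! ### Elements of `R'` as functions on `𝓓` -/

/-- The domain `𝓓`. -/
def DD (p : ℕ) [Fact p.Prime] (n d : ℕ) : Set (Mon n d → ℂ_[p]) :=
  {lam | (∀ k : Inn n d, ‖lam k.1‖ = 1) ∧ (∀ k, ‖lam k‖ ≤ 1) ∧
    ‖lpEval (Dpoly ℂ_[p] p n d) lam‖ = 1}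

/-- `z` is the value at `λ` of `ξ ∈ R'_E`: the common limit of `h(λ)/D(λ)^k` as
`h/D^k` tends to `ξ`. -/
def IsValE (ξ : Ser p n d) (lam : Mon n d → ℂ_[p]) (z : ℂ_[p]) : Prop :=
  ∀ ε > 0, ∃ η h k, IsFrac η h k ∧ NormLE (ξ - η) ε ∧
    ‖z - lpEval h lam / lpEval (Dpoly ℂ_[p] p n d) lam ^ k‖ ≤ ε

/-- `z` is the value at `λ` of a finite sum `∑ Λ^m ξ_m` with `ξ_m ∈ R'_E`. -/
def IsValTilde (η : Ser p n d) (lam : Mon n d → ℂ_[p]) (z : ℂ_[p]) : Prop :=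
  ∃ s ξ, ∃ w : Expo n d → ℂ_[p], IsExpansion η s ξ ∧ (∀ m ∈ s, IsValE (ξ m) lam (w m)) ∧
    z = ∑ m ∈ s, (∏ k, lam k ^ m k) * w m

/-- `z` is the value at `λ` of `ξ ∈ R'`. -/
def IsVal (ξ : Ser p n d) (lam : Mon n d → ℂ_[p]) (z : ℂ_[p]) : Prop :=
  ∀ ε > 0, ∃ η w, IsValTilde η lam w ∧ NormLE (ξ - η) ε ∧ ‖z - w‖ ≤ ε

/-- The value `ξ(λ)` (an arbitrary number if there is none). -/
def value (ξ : Ser p n d) (lam : Mon n d → ℂ_[p]) : ℂ_[p] := Classical.epsilon (IsVal ξ lam)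

/-! ### Matrices of Laurent series, with the product `serMul` of entries -/

/-- Matrices of series, with rows and columns indexed by `U`. -/
abbrev SMat (p : ℕ) [Fact p.Prime] (n d : ℕ) : Type := Inn n d → Inn n d → Ser p n d

/-- Matrix product. -/
def mmul (X Y : SMat p n d) : SMat p n d := fun i j => ∑ k, serMul (X i k) (Y k j)

/-- Identity matrix. -/
def mone : SMat p n d := fun i j => if i = j then Pi.single 0 1 else 0

/-- `X(Λ^p)`. -/
def mfrob (X : SMat p n d) : SMat p n d := fun i j => frob (X i j)

/-- Product of a matrix and a column vector of families `(ξ_u)_u`. -/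
def mvec (X : SMat p n d) (ξ : Inn n d → Lat n → Ser p n d) : Inn n d → Lat n → Ser p n d :=
  fun i u => ∑ k, serMul (X i k) (ξ k u)

/-- `X` and `Y` are inverse matrices over the ring `R`. -/
def IsInverse (X Y : SMat p n d) : Prop :=
  (∀ i j, X i j ∈ RR p n d ∧ Y i j ∈ RR p n d) ∧ mmul X Y = mone ∧ mmul Y X = mone

/-- The inverse of a matrix over `R` (arbitrary if there is none). -/
def minv (X : SMat p n d) : SMat p n d := Classical.epsilon (IsInverse X)

/-- The value of a matrix over `R'` at a point. -/
def mvalue (X : SMat p n d) (lam : Mon n d → ℂ_[p]) : Matrix (Inn n d) (Inn n d) ℂ_[p] :=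
  Matrix.of fun i j => value (X i j) lam

/-! ### The hypergeometric matrix `F(Λ)` and the series `F^{(i)}(Λ, x)` -/

open Classical in
/-- The matrix `F(Λ)`. -/
def Fmat (p : ℕ) [Fact p.Prime] (n d : ℕ) : SMat p n d := fun i j l =>
  if i = j then
    if l ∈ LSet i then
      (-1) ^ (-(l i.1)).toNat * (Nat.factorial (-(l i.1)).toNat : ℂ_[p]) /
        ∏ k ∈ Finset.univ.erase i.1, (Nat.factorial (l k).toNat : ℂ_[p])
    else 0
  else
    if l ∈ LSet i ∧ 0 < l j.1 then
      (-1) ^ (-(l i.1) - 1).toNat * (Nat.factorial (-(l i.1) - 1).toNat : ℂ_[p]) /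
        ((Nat.factorial (l j.1 - 1).toNat : ℂ_[p]) *
          ∏ k ∈ (Finset.univ.erase i.1).erase j.1, (Nat.factorial (l k).toNat : ℂ_[p]))
    else 0

open Classical in
/-- `F^{(i)}_u(Λ)`, the coefficient of `γ_0^{u_{n+1}} x^u` in
`F^{(i)}(Λ, x) = δ_-(q(γ_0 Λ_i x^{a_i}) ∏_{k ≠ i} exp(γ_0 Λ_k x^{a_k}))`,
`q(t) = ∑_{m ≥ 0} (-1)^m m! t^{-m-1}`. It is used only for `u` in `MMinus n d`, where every
exponent in `L_{i,u}` has `l_i < 0`. -/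
def Fser (p : ℕ) [Fact p.Prime] {n d : ℕ} (i : Inn n d) (u : Lat n) : Ser p n d := fun l =>
  if l ∈ LSetDeg i u then
    (-1) ^ (-(l i.1) - 1).toNat * (Nat.factorial (-(l i.1) - 1).toNat : ℂ_[p]) /
      ∏ k ∈ Finset.univ.erase i.1, (Nat.factorial (l k).toNat : ℂ_[p])
  else 0

/-! ### The series `θ̂_1` and the matrix `G(Λ)` -/

/-- `γ_0` is a zero of `∑ t^{p^i}/p^i` with `ord γ_0 = 1/(p-1)`. -/
def IsGamma (γ : ℂ_[p]) : Prop :=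
  ‖γ‖ ^ (p - 1) = (p : ℝ)⁻¹ ∧ HasSum (fun i : ℕ => γ ^ p ^ i / (p : ℂ_[p]) ^ i) 0

/-- `γ_j = ∑_{i ≤ j} γ_0^{p^i}/p^i`. -/
def gam (γ : ℂ_[p]) (j : ℕ) : ℂ_[p] :=
  ∑ i ∈ Finset.range (j + 1), γ ^ p ^ i / (p : ℂ_[p]) ^ i

/-- `θ̂_1(t) = ∏_{j ≥ 1} exp(γ_j t^{p^j}) = exp(∑_{j ≥ 1} γ_j t^{p^j})`. The coefficient
of `t^m` in the exponent is `γ_j` if `m = p^j` with `j ≥ 1` (which forces `j ≤ m`). -/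
def thetaHat (γ : ℂ_[p]) : PowerSeries ℂ_[p] :=
  (PowerSeries.exp ℂ_[p]).subst
    (PowerSeries.mk fun m => ∑ j ∈ Finset.Icc 1 m, if m = p ^ j then gam γ j else 0)

/-- The numbers `θ̂_{1,m}`, defined by `θ̂_1(t) = ∑ θ̂_{1,m} (γ_0 t)^m / m!`. -/
def thetaNum (γ : ℂ_[p]) (m : ℕ) : ℂ_[p] :=
  (Nat.factorial m : ℂ_[p]) * PowerSeries.coeff m (thetaHat γ) / γ ^ m

open Classical in
/-- `θ̂_{1,u}(Λ)`, the coefficient of `γ_0^{u_{n+1}} x^u` in `∏_k θ̂_1(Λ_k x^{a_k})`. -/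
def thetaSer (γ : ℂ_[p]) (u : Lat n) : Ser p n d := fun l =>
  if (∀ k, 0 ≤ l k) ∧ deg l = u then
    ∏ k, thetaNum γ (l k).toNat / (Nat.factorial (l k).toNat : ℂ_[p])
  else 0

/-- Pairs `(u₁, u₂)` with `u₁ ∈ 𝓜_-`, `u₂ ∈ ℕA` and `u₁ + u₂ = u`. -/
abbrev Pairs (n d : ℕ) (u : Lat n) : Type :=
  {w : Lat n × Lat n // w.1 ∈ MMinus n d ∧ w.2 ∈ NA n d ∧ w.1 + w.2 = u}

/-- One summand `F^{(i)}_{u₁}(Λ) θ̂_{1,u₂}(Λ)` of `G^{(i)}_u(Λ)`. -/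
def Gterm (γ : ℂ_[p]) (i : Inn n d) (u : Lat n) (w : Pairs n d u) : Ser p n d :=
  serMul (Fser p i w.1.1) (thetaSer γ w.1.2)

/-- `G^{(i)}_u(Λ)`, the coefficient of `γ_0^{u_{n+1}} x^u` in
`G^{(i)}(Λ, x) = δ_-(F^{(i)}(Λ, x) ∏_k θ̂_1(Λ_k x^{a_k}))`. -/
def Gser (γ : ℂ_[p]) (i : Inn n d) (u : Lat n) : Ser p n d := fun l =>
  ∑' w : Pairs n d u, Gterm γ i u w l

/-- `G_{ij}(Λ) = Λ_j G^{(i)}_{-a_j}(Λ)`. -/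
def Gmat (n d : ℕ) (γ : ℂ_[p]) : SMat p n d := fun i j =>
  shift (Pi.single j.1 1) (Gser γ i (-avec j.1))

/-- The vector `(∑_{u ∈ 𝓜_-} ξ^{(i)}_u(Λ) γ_0^{u_{n+1}} x^u)_i` lies in `(S')^M`. -/
def InSprime (ξ : Inn n d → Lat n → Ser p n d) : Prop :=
  ∀ i, (∀ u ∈ MMinus n d, ξ i u ∈ RRdeg' p n d u) ∧
    ∃ C : ℝ, ∀ u ∈ MMinus n d, NormLE (ξ i u) C

/-! ### The matrices `𝓕`, `𝓖`, `𝓗` -/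

/-- `𝓕(Λ) = F(Λ^p)⁻¹ F(Λ)`. -/
def calF (p : ℕ) [Fact p.Prime] (n d : ℕ) : SMat p n d :=
  mmul (minv (mfrob (Fmat p n d))) (Fmat p n d)

/-- `𝓖(Λ) = G(Λ^p)⁻¹ G(Λ)`. -/
def calG (n d : ℕ) (γ : ℂ_[p]) : SMat p n d :=
  mmul (minv (mfrob (Gmat n d γ))) (Gmat n d γ)

/-- `𝓗(Λ) = F(Λ)⁻¹ G(Λ)`. -/
def calH (n d : ℕ) (γ : ℂ_[p]) : SMat p n d := mmul (minv (Fmat p n d)) (Gmat n d γ)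

/-! ### Teichmüller liftings -/

/-- `lamHat` is the Teichmüller lifting of `lam ∈ k^N`, `k` a finite field embedded by `ι` in the
residue field of `ℂ_p`: its entries satisfy `x^q = x`, `q = |k|`, and reduce to those of `lam`. -/
def IsTeich {k : Type*} [Field k] [Fintype k]
    (ι : k →+* IsLocalRing.ResidueField 𝓞_ℂ_[p]) (lam : Mon n d → k)
    (lamHat : Mon n d → 𝓞_ℂ_[p]) : Prop :=
  ∀ m, lamHat m ^ Fintype.card k = lamHat m ∧ IsLocalRing.residue 𝓞_ℂ_[p] (lamHat m) = ι (lam m)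

/-- `det(I - t X(λ^{p^{a-1}}) X(λ^{p^{a-2}}) ⋯ X(λ))`, a polynomial in `t`. -/
def frobDet (X : SMat p n d) (a : ℕ) (lam : Mon n d → ℂ_[p]) : Polynomial ℂ_[p] :=
  Matrix.det (1 - (Polynomial.X : Polynomial ℂ_[p]) •
    (((List.range a).map fun s => mvalue X (lam ^ p ^ (a - 1 - s))).prod).map Polynomial.C)

end Series

end HasseWitt

end

open HasseWitt

noncomputable section

set_option linter.unusedSectionVars false

namespace HasseWitt

open Filter Topology

/-! ### The convolution ring of tame series on a group with a pointed weight -/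

section Conv

variable {K : Type*} [NormedField K] [IsUltrametricDist K]
  {Γ : Type*} [AddCommGroup Γ]

/-- A superadditive weight for which all the intervals used in convolutions are finite. -/
class PointedWeight (φ : Γ → ℤ) : Prop where
  superadd : ∀ a b, φ a + φ b ≤ φ (a + b)
  finite : ∀ (c c' : ℤ) (l : Γ), {m | c ≤ φ m ∧ c' ≤ φ (l - m)}.Finite

/-- Bounded series whose coefficients of norm `> ε` have weight bounded below. -/
def Tame (φ : Γ → ℤ) (ξ : Γ → K) : Prop :=
  (∃ C : ℝ, ∀ l, ‖ξ l‖ ≤ C) ∧ ∀ ε > 0, ∃ c : ℤ, ∀ l, ε < ‖ξ l‖ → c ≤ φ l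

/-- Convolution of series. -/
def conv (ξ η : Γ → K) : Γ → K := fun l => ∑' m, ξ m * η (l - m)

theorem Tame.exists_pos_bound {φ : Γ → ℤ} {ξ : Γ → K} (h : Tame φ ξ) :
    ∃ C : ℝ, 0 < C ∧ ∀ l, ‖ξ l‖ ≤ C := by
  obtain ⟨C, hC⟩ := h.1
  exact ⟨max C 1, by positivity, fun l => (hC l).trans (le_max_left _ _)⟩

theorem Tame.add {φ : Γ → ℤ} {ξ η : Γ → K} (hξ : Tame φ ξ) (hη : Tame φ η) :
    Tame φ (ξ + η) := by
  obtain ⟨C, hC⟩ := hξ.1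
  obtain ⟨C', hC'⟩ := hη.1
  refine ⟨⟨max C C', fun l => (IsUltrametricDist.norm_add_le_max _ _).trans
    (max_le_max (hC l) (hC' l))⟩, fun ε hε => ?_⟩
  obtain ⟨c, hc⟩ := hξ.2 ε hε
  obtain ⟨c', hc'⟩ := hη.2 ε hε
  refine ⟨min c c', fun l hl => ?_⟩
  rcases lt_max_iff.1 (hl.trans_le (IsUltrametricDist.norm_add_le_max _ _)) with h | h
  · exact (min_le_left _ _).trans (hc l h)
  · exact (min_le_right _ _).trans (hc' l h)

variable (K) in
/-- The additive group of tame series. -/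
def tameSubgroup (φ : Γ → ℤ) : AddSubgroup (Γ → K) where
  carrier := {ξ | Tame φ ξ}
  zero_mem' := ⟨⟨0, fun l => by simp⟩, fun ε hε => ⟨0, fun l hl => by
    simp at hl; exact absurd hl (not_lt.2 hε.le)⟩⟩
  add_mem' := Tame.add
  neg_mem' := by
    rintro ξ ⟨⟨C, hC⟩, h⟩
    exact ⟨⟨C, fun l => by simpa using hC l⟩, fun ε hε => by simpa using h ε hε⟩

/-- If the support where the three norms exceed given bounds is finite, so is the set where the
product is large. -/
theorem finite_large_mul {ι : Type*} {f g : ι → K} {C D : ℝ} (hC : 0 < C) (hD : 0 < D)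
    (hf : ∀ i, ‖f i‖ ≤ C) (hg : ∀ i, ‖g i‖ ≤ D)
    (h : ∀ δ > 0, {i | δ < ‖f i‖ ∧ δ < ‖g i‖}.Finite) :
    Tendsto (fun i => f i * g i) cofinite (𝓝 0) := by
  rw [NormedAddGroup.tendsto_nhds_zero]
  intro ε hε
  have hδ : 0 < min (ε / (2 * D)) (ε / (2 * C)) := by positivity
  refine (h _ hδ).subset fun i hi => ?_
  simp only [Set.mem_compl_iff, Set.mem_ofPred_eq, not_lt, norm_mul] at hi
  constructor
  · refine (min_le_left _ _).trans_lt ?_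
    rw [div_lt_iff₀ (by positivity)]
    have := mul_le_mul_of_nonneg_left (hg i) (norm_nonneg (f i))
    nlinarith
  · refine (min_le_right _ _).trans_lt ?_
    rw [div_lt_iff₀ (by positivity)]
    have := mul_le_mul_of_nonneg_right (hf i) (norm_nonneg (g i))
    nlinarith

variable {φ : Γ → ℤ} [hφ : PointedWeight φ]

theorem Tame.tendsto_mul {ξ η : Γ → K} (hξ : Tame φ ξ) (hη : Tame φ η) (l : Γ) :
    Tendsto (fun m => ξ m * η (l - m)) cofinite (𝓝 0) := by
  obtain ⟨C, hC0, hC⟩ := hξ.exists_pos_bound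
  obtain ⟨D, hD0, hD⟩ := hη.exists_pos_bound
  refine finite_large_mul hC0 hD0 hC (fun m => hD _) fun δ hδ => ?_
  obtain ⟨c, hc⟩ := hξ.2 δ hδ
  obtain ⟨c', hc'⟩ := hη.2 δ hδ
  exact (hφ.finite c c' l).subset fun m hm => ⟨hc _ hm.1, hc' _ hm.2⟩

variable [CompleteSpace K]

theorem Tame.summable_mul {ξ η : Γ → K} (hξ : Tame φ ξ) (hη : Tame φ η) (l : Γ) :
    Summable fun m => ξ m * η (l - m) :=
  NonarchimedeanAddGroup.summable_of_tendsto_cofinite_zero (hξ.tendsto_mul hη l)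

theorem norm_conv_le {ξ η : Γ → K} {C D : ℝ} (hC : ∀ l, ‖ξ l‖ ≤ C) (hD : ∀ l, ‖η l‖ ≤ D)
    (l : Γ) : ‖conv ξ η l‖ ≤ C * D := by
  have hC0 : 0 ≤ C := (norm_nonneg _).trans (hC 0)
  have hD0 : 0 ≤ D := (norm_nonneg _).trans (hD 0)
  refine IsUltrametricDist.norm_tsum_le_of_forall_le_of_nonneg (by positivity) fun m => ?_
  rw [norm_mul]
  exact mul_le_mul (hC _) (hD _) (norm_nonneg _) hC0

theorem Tame.conv {ξ η : Γ → K} (hξ : Tame φ ξ) (hη : Tame φ η) : Tame φ (conv ξ η) := by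
  obtain ⟨C, hC0, hC⟩ := hξ.exists_pos_bound
  obtain ⟨D, hD0, hD⟩ := hη.exists_pos_bound
  refine ⟨⟨C * D, norm_conv_le hC hD⟩, fun ε hε => ?_⟩
  have hδ : 0 < ε / (2 * D) := by positivity
  have hδ' : 0 < ε / (2 * C) := by positivity
  obtain ⟨c, hc⟩ := hξ.2 _ hδ
  obtain ⟨c', hc'⟩ := hη.2 _ hδ'
  refine ⟨c + c', fun l hl => ?_⟩
  by_contra hlt
  refine absurd hl (not_lt.2 (IsUltrametricDist.norm_tsum_le_of_forall_le_of_nonneg hε.le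
    fun m => ?_))
  rw [norm_mul]
  by_cases h1 : ε / (2 * D) < ‖ξ m‖
  · have h2 : ¬ ε / (2 * C) < ‖η (l - m)‖ := fun h2 => hlt (by
      have := hφ.superadd m (l - m)
      rw [add_sub_cancel] at this
      linarith [hc _ h1, hc' _ h2])
    rw [not_lt, le_div_iff₀ (by positivity)] at h2
    have := mul_le_mul_of_nonneg_right (hC m) (norm_nonneg (η (l - m)))
    nlinarith
  · rw [not_lt, le_div_iff₀ (by positivity)] at h1
    have := mul_le_mul_of_nonneg_left (hD (l - m)) (norm_nonneg (ξ m))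
    nlinarith

theorem conv_comm (ξ η : Γ → K) : conv ξ η = HasseWitt.conv η ξ := by
  funext l
  unfold HasseWitt.conv
  rw [← (Equiv.subLeft l).tsum_eq]
  exact tsum_congr fun m => by simp [mul_comm]

theorem Tame.summable_triple {ξ η ζ : Γ → K} (hξ : Tame φ ξ) (hη : Tame φ η) (hζ : Tame φ ζ)
    (l : Γ) : Summable fun x : Γ × Γ => ξ x.2 * η (x.1 - x.2) * ζ (l - x.1) := by
  obtain ⟨C, hC0, hC⟩ := hξ.exists_pos_bound
  obtain ⟨D, hD0, hD⟩ := hη.exists_pos_bound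
  obtain ⟨B, hB0, hB⟩ := hζ.exists_pos_bound
  refine NonarchimedeanAddGroup.summable_of_tendsto_cofinite_zero
    (finite_large_mul (mul_pos hC0 hD0) hB0 (fun x => ?_) (fun x => hB _) fun δ hδ => ?_)
  · rw [norm_mul]
    exact mul_le_mul (hC _) (hD _) (norm_nonneg _) hC0.le
  obtain ⟨c₁, hc₁⟩ := hξ.2 (δ / (2 * D)) (by positivity)
  obtain ⟨c₂, hc₂⟩ := hη.2 (δ / (2 * C)) (by positivity)
  obtain ⟨c₃, hc₃⟩ := hζ.2 δ hδ
  have hf := (hφ.finite (c₁ + c₂) c₃ l).biUnion (t := fun m =>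
    (fun k => (m, k)) '' {k | c₁ ≤ φ k ∧ c₂ ≤ φ (m - k)})
    fun m _ => (hφ.finite c₁ c₂ m).image _
  refine hf.subset ?_
  rintro ⟨m, k⟩ ⟨h1, h2⟩
  simp only [norm_mul] at h1 h2
  have hk : δ / (2 * D) < ‖ξ k‖ := by
    rw [div_lt_iff₀ (by positivity)]
    have := mul_le_mul_of_nonneg_left (hD (m - k)) (norm_nonneg (ξ k))
    nlinarith
  have hm : δ / (2 * C) < ‖η (m - k)‖ := by
    rw [div_lt_iff₀ (by positivity)]
    have := mul_le_mul_of_nonneg_right (hC k) (norm_nonneg (η (m - k)))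
    nlinarith
  have hs := hφ.superadd k (m - k)
  rw [add_sub_cancel] at hs
  simp only [Set.mem_iUnion]
  exact ⟨m, ⟨by linarith [hc₁ _ hk, hc₂ _ hm], hc₃ _ h2⟩, k, ⟨hc₁ _ hk, hc₂ _ hm⟩, rfl⟩

theorem Tame.conv_assoc {ξ η ζ : Γ → K} (hξ : Tame φ ξ) (hη : Tame φ η) (hζ : Tame φ ζ) :
    HasseWitt.conv (HasseWitt.conv ξ η) ζ = HasseWitt.conv ξ (HasseWitt.conv η ζ) := by
  funext l
  have hs := hξ.summable_triple hη hζ l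
  have h1 : HasseWitt.conv (HasseWitt.conv ξ η) ζ l
      = ∑' m, ∑' k, ξ k * η (m - k) * ζ (l - m) :=
    tsum_congr fun m => by rw [HasseWitt.conv, tsum_mul_right]
  rw [h1, ← Summable.tsum_comm (f := fun m k => ξ k * η (m - k) * ζ (l - m)) hs]
  refine tsum_congr fun k => ?_
  rw [HasseWitt.conv, ← tsum_mul_left, ← (Equiv.addRight k).tsum_eq]
  refine tsum_congr fun m => ?_
  simp [mul_assoc, sub_sub, add_comm]

theorem conv_single [DecidableEq Γ] (a : Γ) (c : K) (ξ : Γ → K) :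
    HasseWitt.conv (Pi.single a c) ξ = fun l => c * ξ (l - a) := by
  funext l
  rw [HasseWitt.conv, tsum_eq_single a]
  · simp
  · intro m hm
    simp [Pi.single_eq_of_ne hm]

theorem tame_single [DecidableEq Γ] (a : Γ) (c : K) : Tame φ (Pi.single a c : Γ → K) := by
  refine ⟨⟨‖c‖, fun l => ?_⟩, fun ε hε => ⟨φ a, fun l hl => ?_⟩⟩
  · by_cases h : l = a
    · subst h; simp
    · simp [Pi.single_eq_of_ne h]
  · by_cases h : l = a
    · rw [h]
    · rw [Pi.single_eq_of_ne h, norm_zero] at hl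
      exact absurd hl (not_lt.2 hε.le)

variable (K φ) in
/-- The ring of tame series. -/
def ConvRing : Type _ := tameSubgroup K φ

instance : AddCommGroup (ConvRing K φ) := inferInstanceAs (AddCommGroup (tameSubgroup K φ))

instance : CoeFun (ConvRing K φ) fun _ => Γ → K := ⟨Subtype.val⟩

@[ext] theorem ConvRing.ext {a b : ConvRing K φ} (h : ∀ l, a l = b l) : a = b :=
  Subtype.ext (funext h)

open Classical in
instance : CommRing (ConvRing K φ) where
  __ := (inferInstance : AddCommGroup (ConvRing K φ))
  mul a b := ⟨conv a.1 b.1, Tame.conv a.2 b.2⟩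
  one := ⟨Pi.single 0 1, tame_single 0 1⟩
  mul_assoc a b c := Subtype.ext (Tame.conv_assoc a.2 b.2 c.2)
  mul_comm a b := Subtype.ext (conv_comm _ _)
  one_mul a := Subtype.ext ((conv_single _ _ _).trans (by simp))
  mul_one a := Subtype.ext ((conv_comm _ _).trans ((conv_single _ _ _).trans (by simp)))
  zero_mul a := Subtype.ext (funext fun l => (tsum_congr fun m => zero_mul _).trans tsum_zero)
  mul_zero a := Subtype.ext (funext fun l => (tsum_congr fun m => mul_zero _).trans tsum_zero)
  left_distrib a b c := Subtype.ext (funext fun l =>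
    (tsum_congr fun m => mul_add _ _ _).trans
      ((Tame.summable_mul a.2 b.2 l).tsum_add (Tame.summable_mul a.2 c.2 l)))
  right_distrib a b c := Subtype.ext (funext fun l =>
    (tsum_congr fun m => add_mul _ _ _).trans
      ((Tame.summable_mul a.2 c.2 l).tsum_add (Tame.summable_mul b.2 c.2 l)))

namespace ConvRing

theorem coe_add (a b : ConvRing K φ) : (a + b).1 = a.1 + b.1 := rfl
theorem coe_sub (a b : ConvRing K φ) : (a - b).1 = a.1 - b.1 := rfl
theorem coe_neg (a : ConvRing K φ) : (-a).1 = -a.1 := rfl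
theorem coe_zero : (0 : ConvRing K φ).1 = 0 := rfl
open Classical in
theorem coe_one : (1 : ConvRing K φ).1 = Pi.single 0 1 := rfl

theorem one_apply [DecidableEq Γ] (l : Γ) :
    (1 : ConvRing K φ) l = if l = 0 then 1 else 0 := by
  rw [coe_one]
  by_cases h : l = 0 <;> simp [h]

theorem coe_sum {ι : Type*} (s : Finset ι) (f : ι → ConvRing K φ) :
    (∑ i ∈ s, f i).1 = ∑ i ∈ s, (f i).1 :=
  map_sum (tameSubgroup K φ).subtype f s

theorem mul_apply (a b : ConvRing K φ) (l : Γ) : (a * b) l = ∑' m, a m * b (l - m) := rfl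

open Classical in
/-- The monomial `c Λ^m`. -/
def mono (φ : Γ → ℤ) [PointedWeight φ] (m : Γ) (c : K) : ConvRing K φ :=
  ⟨Pi.single m c, tame_single m c⟩

theorem mono_apply [DecidableEq Γ] (m : Γ) (c : K) (l : Γ) :
    mono φ m c l = if l = m then c else 0 := by
  classical
  unfold mono
  by_cases h : l = m <;> simp [h]

theorem mono_mul_apply (m : Γ) (c : K) (a : ConvRing K φ) (l : Γ) :
    (mono φ m c * a) l = c * a (l - m) := by
  classical
  exact congrFun (conv_single m c a.1) l

theorem mono_mul_mono (m m' : Γ) (c c' : K) :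
    mono φ m c * mono φ m' c' = mono φ (m + m') (c * c') := by
  classical
  ext l
  rw [mono_mul_apply, mono_apply, mono_apply]
  simp only [sub_eq_iff_eq_add, add_comm m', mul_ite, mul_zero]

theorem mono_zero_one : mono φ 0 (1 : K) = 1 := by
  classical
  ext l
  rw [mono_apply, coe_one]
  by_cases h : l = 0 <;> simp [h]

theorem mono_add (m : Γ) (c c' : K) : mono φ m (c + c') = mono φ m c + mono φ m c' := by
  classical
  ext l
  rw [coe_add, Pi.add_apply, mono_apply, mono_apply, mono_apply]
  split_ifs <;> simp

theorem mono_zero (m : Γ) : mono φ m (0 : K) = 0 := by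
  classical
  ext l
  rw [mono_apply, coe_zero]; simp

variable (K φ) in
/-- Constants. -/
def const : K →+* ConvRing K φ where
  toFun := mono φ 0
  map_one' := mono_zero_one
  map_mul' a b := by rw [mono_mul_mono, add_zero]
  map_zero' := mono_zero 0
  map_add' a b := mono_add 0 a b

theorem const_mul_apply (c : K) (a : ConvRing K φ) (l : Γ) :
    (const K φ c * a) l = c * a l := by
  have := mono_mul_apply 0 c a l
  rwa [sub_zero] at this

/-- `a` has norm at most `C`. -/
def BddBy (a : ConvRing K φ) (C : ℝ) : Prop := ∀ l, ‖a l‖ ≤ C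

variable {a b : ConvRing K φ} {C D : ℝ}

theorem BddBy.nonneg (h : BddBy a C) : 0 ≤ C := (norm_nonneg _).trans (h 0)

theorem BddBy.mono_right (h : BddBy a C) (hCD : C ≤ D) : BddBy a D := fun l => (h l).trans hCD

theorem exists_bddBy (a : ConvRing K φ) : ∃ C, 0 < C ∧ BddBy a C := Tame.exists_pos_bound a.2

theorem BddBy.mul (ha : BddBy a C) (hb : BddBy b D) : BddBy (a * b) (C * D) :=
  norm_conv_le ha hb

theorem BddBy.add (ha : BddBy a C) (hb : BddBy b C) : BddBy (a + b) C := fun l =>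
  (IsUltrametricDist.norm_add_le_max _ _).trans (max_le (ha l) (hb l))

theorem BddBy.neg (ha : BddBy a C) : BddBy (-a) C := fun l => by
  rw [coe_neg, Pi.neg_apply, norm_neg]; exact ha l

theorem BddBy.sub (ha : BddBy a C) (hb : BddBy b C) : BddBy (a - b) C := by
  rw [sub_eq_add_neg]; exact ha.add hb.neg

theorem bddBy_zero (hC : 0 ≤ C) : BddBy (0 : ConvRing K φ) C := fun l => by
  rw [coe_zero]; simpa using hC

theorem bddBy_mono {m : Γ} {c : K} (hc : ‖c‖ ≤ C) : BddBy (mono φ m c) C := fun l => by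
  classical
  rw [mono_apply]
  split_ifs
  · exact hc
  · simpa using (norm_nonneg c).trans hc

theorem bddBy_const {c : K} (hc : ‖c‖ ≤ C) : BddBy (const K φ c) C := bddBy_mono hc

theorem bddBy_one : BddBy (1 : ConvRing K φ) 1 := by
  rw [← mono_zero_one]; exact bddBy_mono (by simp)

theorem bddBy_sum {ι : Type*} {s : Finset ι} {f : ι → ConvRing K φ} (hC : 0 ≤ C)
    (h : ∀ i ∈ s, BddBy (f i) C) : BddBy (∑ i ∈ s, f i) C := by
  classical
  induction s using Finset.induction_on with
  | empty => simpa using bddBy_zero hC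
  | insert i s his ih =>
    rw [Finset.sum_insert his]
    exact (h i (Finset.mem_insert_self _ _)).add
      (ih fun j hj => h j (Finset.mem_insert_of_mem hj))

variable (K φ) in
/-- The subring of elements of norm at most one. -/
def unitBall : Subring (ConvRing K φ) where
  carrier := {a | BddBy a 1}
  mul_mem' ha hb := by simpa using BddBy.mul ha hb
  one_mem' := bddBy_one
  add_mem' := BddBy.add
  zero_mem' := bddBy_zero zero_le_one
  neg_mem' := BddBy.neg

theorem BddBy.mul_one_one (ha : BddBy a 1) (hb : BddBy b 1) : BddBy (a * b) 1 := by
  simpa using ha.mul hb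

theorem BddBy.mul_unitBall (ha : BddBy a C) (hb : b ∈ unitBall K φ) : BddBy (a * b) C := by
  simpa using ha.mul hb

theorem BddBy.unitBall_mul (ha : a ∈ unitBall K φ) (hb : BddBy b C) : BddBy (a * b) C := by
  simpa using BddBy.mul ha hb

end ConvRing

end Conv

/-! ### The pointed weight on exponents -/

section Weight

variable {n d : ℕ}

/-- The squared length of the exponent vector of a monomial. -/
def sqLen (k : Mon n d) : ℤ := ∑ i, (k.1 i : ℤ) ^ 2

/-- The linear form `∑ l_k |b_k|²`, positive on `E ∖ {0}` by convexity. -/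
def height (n d : ℕ) : Expo n d →+ ℤ where
  toFun l := ∑ k, l k * sqLen k
  map_zero' := by simp
  map_add' a b := by simp [add_mul, Finset.sum_add_distrib]

/-- The superadditive weight `2 ∑ l_k |b_k|² - ∑ |l_k|`. -/
def wt (n d : ℕ) (l : Expo n d) : ℤ := 2 * height n d l - ∑ k, |l k|

instance : PointedWeight (wt n d) where
  superadd a b := by
    have : ∑ k, |a k + b k| ≤ ∑ k, |a k| + ∑ k, |b k| := by
      rw [← Finset.sum_add_distrib]
      exact Finset.sum_le_sum fun k _ => abs_add_le _ _
    simp only [wt, map_add, Pi.add_apply]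
    linarith
  finite c c' l := by
    set N : ℤ := 2 * height n d l - c - c'
    refine (Set.finite_Icc (fun _ : Mon n d => -N) (fun _ => N)).subset ?_
    rintro m ⟨h1, h2⟩
    simp only [wt, map_sub] at h1 h2
    have h3 : ∑ k, |m k| ≤ N := by
      have : 0 ≤ ∑ k, |(l - m) k| := Finset.sum_nonneg fun k _ => abs_nonneg _
      simp only [N]; linarith
    have h4 : ∀ k, |m k| ≤ N := fun k =>
      (Finset.single_le_sum (f := fun k => |m k|) (fun k _ => abs_nonneg _)
        (Finset.mem_univ k)).trans h3
    exact ⟨fun k => (abs_le.1 (h4 k)).1, fun k => (abs_le.1 (h4 k)).2⟩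

theorem wt_nsmul (c : ℕ) (l : Expo n d) : wt n d (c • l) = c * wt n d l := by
  rw [wt, wt, map_nsmul]
  simp only [Pi.smul_apply, nsmul_eq_mul, abs_mul, Nat.abs_cast, ← Finset.mul_sum]
  ring

/-- The degree as a homomorphism. -/
def degHom (n d : ℕ) : Expo n d →+ Lat n where
  toFun := deg
  map_zero' := by simp [deg]
  map_add' a b := by simp [deg, add_smul, Finset.sum_add_distrib]

theorem deg_add (a b : Expo n d) : deg (a + b) = deg a + deg b := map_add (degHom n d) a b
theorem deg_sub (a b : Expo n d) : deg (a - b) = deg a - deg b := map_sub (degHom n d) a b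
theorem deg_zero : deg (0 : Expo n d) = 0 := map_zero (degHom n d)
theorem deg_nsmul (c : ℕ) (a : Expo n d) : deg (c • a) = c • deg a := map_nsmul (degHom n d) c a

theorem deg_fst (l : Expo n d) (i : Fin (n + 1)) : (deg l).1 i = ∑ k, l k * (k.1 i : ℤ) := by
  simp [deg, avec, Prod.fst_sum, Finset.sum_apply]

theorem deg_snd (l : Expo n d) : (deg l).2 = ∑ k, l k := by
  simp [deg, avec, Prod.snd_sum]

theorem deg_single (k : Mon n d) (c : ℤ) : deg (Pi.single k c : Expo n d) = c • avec k := by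
  rw [deg, Finset.sum_eq_single k]
  · simp
  · intro b _ hb; simp [Pi.single_eq_of_ne hb]
  · simp

theorem sum_erase_of_mem_LSet {i : Inn n d} {l : Expo n d} (hl : l ∈ LSet i) :
    ∑ k ∈ Finset.univ.erase i.1, l k = -l i.1 := by
  have h := deg_snd l
  rw [hl.1, ← Finset.add_sum_erase _ _ (Finset.mem_univ i.1)] at h
  simp only [Prod.snd_zero] at h
  linarith

theorem height_of_deg_zero {l : Expo n d} (hl : deg l = 0) (i : Mon n d) :
    height n d l = ∑ k, l k * ∑ j, ((k.1 j : ℤ) - i.1 j) ^ 2 := by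
  have h1 : ∀ j, ∑ k, l k * (k.1 j : ℤ) = 0 := fun j => by rw [← deg_fst, hl]; rfl
  have h2 : ∑ k, l k = 0 := by rw [← deg_snd, hl]; rfl
  have h3 : ∀ k : Mon n d, l k * ∑ j, ((k.1 j : ℤ) - i.1 j) ^ 2
      = l k * sqLen k - 2 * ∑ j, (i.1 j : ℤ) * (l k * (k.1 j : ℤ)) + l k * sqLen i := by
    intro k
    simp only [sqLen, Finset.mul_sum, ← Finset.sum_sub_distrib, ← Finset.sum_add_distrib]
    exact Finset.sum_congr rfl fun j _ => by ring
  rw [Finset.sum_congr rfl fun k _ => h3 k, Finset.sum_add_distrib, Finset.sum_sub_distrib,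
    ← Finset.sum_mul, h2, ← Finset.mul_sum, Finset.sum_comm]
  simp only [← Finset.mul_sum, h1]
  simp [height]

theorem one_le_sqDist {k i : Mon n d} (h : k ≠ i) :
    1 ≤ ∑ j, ((k.1 j : ℤ) - i.1 j) ^ 2 := by
  obtain ⟨j, hj⟩ : ∃ j, k.1 j ≠ i.1 j := by
    by_contra! hh
    exact h (Subtype.ext (funext hh))
  have hj' : ((k.1 j : ℤ) - i.1 j) ≠ 0 := by
    rw [sub_ne_zero]; exact_mod_cast hj
  have : (0 : ℤ) < ((k.1 j : ℤ) - i.1 j) ^ 2 := by positivity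
  exact (Int.add_one_le_iff.2 this).trans (Finset.single_le_sum
    (f := fun j => ((k.1 j : ℤ) - i.1 j) ^ 2) (fun _ _ => sq_nonneg _) (Finset.mem_univ j))

theorem sum_abs_le_of_mem_LSet {i : Inn n d} {l : Expo n d} (hl : l ∈ LSet i) :
    ∑ k, |l k| ≤ 2 * height n d l := by
  have h1 := sum_erase_of_mem_LSet hl
  have h2 : ∑ k, |l k| = 2 * ∑ k ∈ Finset.univ.erase i.1, l k := by
    rw [← Finset.add_sum_erase _ _ (Finset.mem_univ i.1), abs_of_nonpos hl.2.1, ← h1,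
      two_mul]
    congr 1
    exact Finset.sum_congr rfl fun k hk => abs_of_nonneg (hl.2.2 k (Finset.ne_of_mem_erase hk))
  rw [h2, height_of_deg_zero hl.1 i.1, ← Finset.add_sum_erase _ _ (Finset.mem_univ i.1)]
  simp only [sub_self, ne_eq, OfNat.ofNat_ne_zero, not_false_eq_true, zero_pow,
    Finset.sum_const_zero, mul_zero, zero_add]
  refine mul_le_mul_of_nonneg_left (Finset.sum_le_sum fun k hk => ?_) (by norm_num)
  exact le_mul_of_one_le_right (hl.2.2 k (Finset.ne_of_mem_erase hk))
    (one_le_sqDist (Finset.ne_of_mem_erase hk))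

/-- Properties of points of the cone. -/
theorem cone_props {x : Mon n d → ℝ} (hx : x ∈ cone n d) :
    ∑ k, |x k| ≤ 2 * ∑ k, x k * (sqLen k : ℝ) ∧ (∑ k, x k = 0) ∧
      (∀ j, ∑ k, x k * (k.1 j : ℝ) = 0) ∧
      ∀ k : Mon n d, (¬ ∀ i, 0 < k.1 i) → 0 ≤ x k := by
  induction hx using Submodule.span_induction with
  | mem x hx =>
    obtain ⟨i, l, hl, rfl⟩ := hx
    refine ⟨?_, ?_, fun j => ?_, fun k hk => ?_⟩ <;> beta_reduce
    · have := sum_abs_le_of_mem_LSet hl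
      simp only [height, AddMonoidHom.coe_mk, ZeroHom.coe_mk] at this
      exact_mod_cast this
    · have := deg_snd l
      rw [hl.1, Prod.snd_zero] at this
      exact_mod_cast this.symm
    · have := deg_fst l j
      rw [hl.1, Prod.fst_zero, Pi.zero_apply] at this
      exact_mod_cast this.symm
    · exact_mod_cast hl.2.2 k (by rintro rfl; exact hk i.2)
  | zero => simp
  | add x y _ _ hx hy =>
    obtain ⟨h1, h2, h3, h4⟩ := hx
    obtain ⟨h1', h2', h3', h4'⟩ := hy
    refine ⟨?_, ?_, fun j => ?_, fun k hk => add_nonneg (h4 k hk) (h4' k hk)⟩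
    · have : ∑ k, |x k + y k| ≤ ∑ k, |x k| + ∑ k, |y k| := by
        rw [← Finset.sum_add_distrib]
        exact Finset.sum_le_sum fun k _ => abs_add_le _ _
      simp only [Pi.add_apply, add_mul, Finset.sum_add_distrib]
      linarith
    · simp [Finset.sum_add_distrib, h2, h2']
    · simp [Finset.sum_add_distrib, add_mul, h3 j, h3' j]
  | smul a x _ hx =>
    obtain ⟨h1, h2, h3, h4⟩ := hx
    refine ⟨?_, ?_, fun j => ?_, fun k hk => ?_⟩
    · simp only [Pi.smul_apply, NNReal.smul_def, smul_eq_mul, abs_mul, NNReal.abs_eq, mul_assoc,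
        ← Finset.mul_sum]
      have := mul_le_mul_of_nonneg_left h1 a.2
      rw [NNReal.val_eq_coe] at this
      linarith
    · simp [NNReal.smul_def, ← Finset.mul_sum, h2]
    · simp [NNReal.smul_def, ← Finset.mul_sum, mul_assoc, h3 j]
    · exact mul_nonneg a.2 (h4 k hk)

theorem zero_mem_ESet : (0 : Expo n d) ∈ ESet n d := by
  have : (fun k => ((0 : Expo n d) k : ℝ)) = 0 := by ext; simp
  simp only [ESet, Set.mem_ofPred_eq, this]
  exact Submodule.zero_mem _

theorem add_mem_ESet {a b : Expo n d} (ha : a ∈ ESet n d) (hb : b ∈ ESet n d) :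
    a + b ∈ ESet n d := by
  have : (fun k => ((a + b : Expo n d) k : ℝ)) = (fun k => (a k : ℝ)) + fun k => (b k : ℝ) := by
    ext; simp
  simp only [ESet, Set.mem_ofPred_eq, this]
  exact Submodule.add_mem _ ha hb

theorem nsmul_mem_ESet {a : Expo n d} (ha : a ∈ ESet n d) (c : ℕ) : c • a ∈ ESet n d := by
  induction c with
  | zero => simpa using zero_mem_ESet
  | succ c ih => rw [succ_nsmul]; exact add_mem_ESet ih ha

theorem LSet_subset_ESet (i : Inn n d) : LSet i ⊆ ESet n d := fun l hl =>
  Submodule.subset_span ⟨i, l, hl, rfl⟩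

theorem wt_nonneg_of_mem_ESet {l : Expo n d} (hl : l ∈ ESet n d) : 0 ≤ wt n d l := by
  have := (cone_props hl).1
  have h : ∑ k, |l k| ≤ 2 * ∑ k, l k * sqLen k := by exact_mod_cast this
  simp only [wt, height, AddMonoidHom.coe_mk, ZeroHom.coe_mk]
  linarith

theorem height_nonneg_of_mem_ESet {l : Expo n d} (hl : l ∈ ESet n d) : 0 ≤ height n d l := by
  have h1 := wt_nonneg_of_mem_ESet hl
  have h2 : 0 ≤ ∑ k, |l k| := Finset.sum_nonneg fun k _ => abs_nonneg _
  simp only [wt] at h1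
  linarith

theorem height_pos_of_mem_ESet {l : Expo n d} (hl : l ∈ ESet n d) (h0 : l ≠ 0) :
    0 < height n d l := by
  have h1 := wt_nonneg_of_mem_ESet hl
  have h2 : 0 < ∑ k, |l k| := by
    obtain ⟨k, hk⟩ : ∃ k, l k ≠ 0 := by
      by_contra! hh; exact h0 (funext hh)
    exact (abs_pos.2 hk).trans_le (Finset.single_le_sum (f := fun k => |l k|)
      (fun k _ => abs_nonneg _) (Finset.mem_univ k))
  simp only [wt] at h1
  linarith

theorem deg_of_mem_ESet {l : Expo n d} (hl : l ∈ ESet n d) : deg l = 0 := by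
  obtain ⟨-, h2, h3, -⟩ := cone_props hl
  refine Prod.ext (funext fun j => ?_) ?_
  · rw [deg_fst]; exact_mod_cast h3 j
  · rw [deg_snd]; exact_mod_cast h2

theorem nonnegOff_of_mem_ESet {l : Expo n d} (hl : l ∈ ESet n d) : NonnegOff l := fun k hk => by
  exact_mod_cast (cone_props hl).2.2.2 k hk

end Weight

/-! ### Laurent series as elements of the convolution ring -/

section Ring

variable {p : ℕ} [Fact p.Prime] {n d : ℕ}

open ConvRing

/-- The ring of tame Laurent series over `ℂ_p`, which contains `R`. -/
abbrev GSer (p : ℕ) [Fact p.Prime] (n d : ℕ) : Type := ConvRing ℂ_[p] (wt n d)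

theorem serMul_eq (a b : GSer p n d) : serMul a.1 b.1 = (a * b).1 := rfl

theorem shift_eq (m : Expo n d) (a : GSer p n d) : shift m a.1 = (mono (wt n d) m 1 * a).1 := by
  funext l
  rw [mono_mul_apply, one_mul]
  rfl

variable (p n d) in
/-- The series with exponents in `E`. -/
def supportE : Subring (GSer p n d) where
  carrier := {a | ∀ l, a l ≠ 0 → l ∈ ESet n d}
  mul_mem' {a b} ha hb l hl := by
    obtain ⟨m, hm⟩ : ∃ m, a m * b (l - m) ≠ 0 := by
      by_contra! hh
      exact hl (by rw [mul_apply]; simp [hh])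
    have := add_mem_ESet (ha m (left_ne_zero_of_mul hm)) (hb _ (right_ne_zero_of_mul hm))
    rwa [add_sub_cancel] at this
  one_mem' l hl := by
    rw [one_apply] at hl
    by_cases h : l = 0
    · rw [h]; exact zero_mem_ESet
    · simp [h] at hl
  add_mem' {a b} ha hb l hl := by
    rw [coe_add, Pi.add_apply] at hl
    by_cases h : a l = 0
    · exact hb l (by simpa [h] using hl)
    · exact ha l h
  zero_mem' l hl := by rw [coe_zero] at hl; simp at hl
  neg_mem' {a} ha l hl := ha l (by rw [coe_neg] at hl; simpa using hl)

theorem tame_of_bdd_supportE {ξ : Ser p n d} (h : ξ ∈ RE p n d) : Tame (wt n d) ξ :=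
  ⟨h.1, fun _ hε => ⟨0, fun l hl => wt_nonneg_of_mem_ESet
    (h.2 l (norm_pos_iff.1 (hε.trans hl)))⟩⟩

theorem mem_RE_iff {a : GSer p n d} : a.1 ∈ RE p n d ↔ a ∈ supportE p n d :=
  ⟨fun h => h.2, fun h => ⟨a.2.1, h⟩⟩

/-- The height of every exponent of the `k`-th power of a series supported on `E ∖ {0}` is at
least `k`. -/
theorem le_height_of_pow_ne_zero {a : GSer p n d} (ha : a ∈ supportE p n d) (h0 : a 0 = 0)
    (k : ℕ) {l : Expo n d} (hl : (a ^ k) l ≠ 0) : (k : ℤ) ≤ height n d l := by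
  induction k generalizing l with
  | zero => exact height_nonneg_of_mem_ESet (pow_mem ha 0 l hl)
  | succ k ih =>
    rw [pow_succ, mul_apply] at hl
    obtain ⟨m, hm⟩ : ∃ m, (a ^ k) m * a (l - m) ≠ 0 := by
      by_contra! hh
      exact hl (by simp [hh])
    have h1 := ih (left_ne_zero_of_mul hm)
    have h2 := right_ne_zero_of_mul hm
    have h3 := height_pos_of_mem_ESet (ha _ h2) (fun h => h2 (by rw [h, h0]))
    rw [map_sub] at h3
    push_cast
    linarith

/-- Series in the unit ball, supported on `E`, with unit constant term are invertible. -/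
theorem exists_inverse_supportE {f : GSer p n d} (hf : f ∈ supportE p n d) (hf1 : BddBy f 1)
    (hf0 : ‖f 0‖ = 1) : ∃ g ∈ supportE p n d, BddBy g 1 ∧ f * g = 1 := by
  classical
  have hne : f 0 ≠ 0 := norm_ne_zero_iff.1 (by rw [hf0]; exact one_ne_zero)
  have hcE : ∀ c, const ℂ_[p] (wt n d) c ∈ supportE p n d := fun c l hl => by
    have : (const ℂ_[p] (wt n d) c) l = if l = 0 then c else 0 := mono_apply 0 c l
    rw [this] at hl
    by_cases h : l = 0
    · rw [h]; exact zero_mem_ESet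
    · simp [h] at hl
  set c : GSer p n d := const ℂ_[p] (wt n d) (f 0)⁻¹ with hc
  have hc1 : BddBy c 1 := bddBy_const (by rw [norm_inv, hf0, inv_one])
  set a : GSer p n d := 1 - c * f with ha
  have haE : a ∈ supportE p n d := sub_mem (one_mem _) (mul_mem (hcE _) hf)
  have ha1 : a ∈ unitBall ℂ_[p] (wt n d) := sub_mem (one_mem _) (mul_mem hc1 hf1)
  have ha0 : a 0 = 0 := by
    rw [ha, coe_sub, Pi.sub_apply, hc, const_mul_apply, inv_mul_cancel₀ hne, one_apply]
    simp
  set s : ℕ → GSer p n d := fun K => ∑ k ∈ Finset.range K, a ^ k with hs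
  have hsE : ∀ K, s K ∈ supportE p n d := fun K => sum_mem fun k _ => pow_mem haE k
  have hs1 : ∀ K, s K ∈ unitBall ℂ_[p] (wt n d) := fun K => sum_mem fun k _ => pow_mem ha1 k
  have hstab : ∀ (K : ℕ) l, height n d l < K → (s K) l = (s ((height n d l).toNat + 1)) l := by
    intro K l hK
    by_cases hE : l ∈ ESet n d
    swap
    · rw [not_not.1 fun h => hE (hsE K l h), not_not.1 fun h => hE (hsE _ l h)]
    have hnn := height_nonneg_of_mem_ESet hE
    have hsub : Finset.range ((height n d l).toNat + 1) ⊆ Finset.range K := by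
      intro k hk
      simp only [Finset.mem_range] at hk ⊢
      omega
    simp only [hs, coe_sum, Finset.sum_apply]
    refine (Finset.sum_subset hsub fun k _ hk => ?_).symm
    by_contra hne
    have h1 := le_height_of_pow_ne_zero haE ha0 k hne
    simp only [Finset.mem_range] at hk
    omega
  let g0 : Ser p n d := fun l => (s ((height n d l).toNat + 1)) l
  have hg0 : g0 ∈ RE p n d := ⟨⟨1, fun l => hs1 _ l⟩, fun l hl => hsE _ l hl⟩
  let g : GSer p n d := ⟨g0, tame_of_bdd_supportE hg0⟩
  have hgE : g ∈ supportE p n d := hg0.2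
  have hg1 : g ∈ unitBall ℂ_[p] (wt n d) := fun l => hs1 _ l
  have key : g * (1 - a) = 1 := by
    refine ConvRing.ext fun l => ?_
    set K := (height n d l).toNat + 1
    have h1 : g * (1 - a) = (g - s K) * (1 - a) + (1 - a ^ K) := by
      rw [← geom_sum_mul_neg a K, sub_mul, sub_add_cancel]
    have h2 : ((g - s K) * (1 - a)) l = 0 := by
      rw [mul_apply]
      refine (tsum_congr fun m => ?_).trans tsum_zero
      by_cases h : (1 - a : GSer p n d) (l - m) = 0
      · rw [h, mul_zero]
      · have h3 := height_nonneg_of_mem_ESet (sub_mem (one_mem _) haE _ h)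
        rw [map_sub] at h3
        have : (g - s K) m = 0 := by
          rw [coe_sub, Pi.sub_apply, sub_eq_zero]
          refine (hstab K m ?_).symm
          simp only [K]
          omega
        rw [this, zero_mul]
    have h3 : (a ^ K) l = 0 := by
      by_contra hne
      have := le_height_of_pow_ne_zero haE ha0 K hne
      simp only [K] at this
      omega
    rw [h1, coe_add, Pi.add_apply, h2, coe_sub, Pi.sub_apply, h3]
    ring
  refine ⟨c * g, mul_mem (hcE _) hgE, hc1.mul_one_one hg1, ?_⟩
  calc f * (c * g) = g * (1 - a) := by rw [ha]; ring
    _ = 1 := key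

/-! ### Degrees -/

theorem hasDeg_mul {a b : GSer p n d} {u v : Lat n} (ha : HasDeg a.1 u) (hb : HasDeg b.1 v) :
    HasDeg (a * b).1 (u + v) := fun l hl => by
  obtain ⟨m, hm⟩ : ∃ m, a m * b (l - m) ≠ 0 := by
    by_contra! hh
    exact hl (by rw [mul_apply]; simp [hh])
  rw [← ha m (left_ne_zero_of_mul hm), ← hb _ (right_ne_zero_of_mul hm), ← deg_add,
    add_sub_cancel]

theorem hasDeg_sum {ι : Type*} {s : Finset ι} {f : ι → GSer p n d} {u : Lat n}
    (h : ∀ i ∈ s, HasDeg (f i).1 u) : HasDeg (∑ i ∈ s, f i).1 u := fun l hl => by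
  rw [coe_sum, Finset.sum_apply] at hl
  obtain ⟨i, hi, hne⟩ := Finset.exists_ne_zero_of_sum_ne_zero hl
  exact h i hi l hne

theorem hasDeg_of_supportE {a : GSer p n d} (ha : a ∈ supportE p n d) : HasDeg a.1 0 :=
  fun l hl => deg_of_mem_ESet (ha l hl)

/-! ### The substitution `Λ ↦ Λ^p` -/

theorem frob_nsmul (ξ : Ser p n d) (l : Expo n d) : frob ξ (p • l) = ξ l := by
  have hp : (p : ℤ) ≠ 0 := by exact_mod_cast (Fact.out : p.Prime).ne_zero
  rw [frob, if_pos fun k => by simp]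
  congr 1
  funext k
  simp [Int.mul_ediv_cancel_left _ hp]

theorem frob_of_notMem_range (ξ : Ser p n d) {l : Expo n d} (h : ∀ m : Expo n d, p • m ≠ l) :
    frob ξ l = 0 := by
  rw [frob, if_neg]
  intro hl
  refine h (fun k => l k / (p : ℤ)) (funext fun k => ?_)
  simp [Int.mul_ediv_cancel' (hl k)]

theorem nsmul_prime_injective : Function.Injective fun l : Expo n d => p • l := fun a b h => by
  funext k
  simpa [ (Fact.out : p.Prime).ne_zero] using congrFun h k

theorem exists_of_frob_ne_zero {ξ : Ser p n d} {l : Expo n d} (h : frob ξ l ≠ 0) :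
    ∃ m, l = p • m ∧ frob ξ l = ξ m := by
  by_contra! hh
  refine h (frob_of_notMem_range ξ fun m hm => hh m hm.symm ?_)
  rw [← hm, frob_nsmul]

theorem norm_frob_le {ξ : Ser p n d} {C : ℝ} (h : NormLE ξ C) : NormLE (frob ξ) C := fun l => by
  by_cases hl : frob ξ l = 0
  · rw [hl, norm_zero]; exact (norm_nonneg _).trans (h 0)
  · obtain ⟨m, -, hm⟩ := exists_of_frob_ne_zero hl
    rw [hm]; exact h m

theorem tame_frob {ξ : Ser p n d} (h : Tame (wt n d) ξ) : Tame (wt n d) (frob ξ) := by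
  obtain ⟨C, hC⟩ := h.1
  refine ⟨⟨C, norm_frob_le hC⟩, fun ε hε => ?_⟩
  obtain ⟨c, hc⟩ := h.2 ε hε
  refine ⟨p * c, fun l hl => ?_⟩
  obtain ⟨m, rfl, hm⟩ := exists_of_frob_ne_zero (norm_pos_iff.1 (hε.trans hl))
  rw [wt_nsmul]
  rw [hm] at hl
  exact mul_le_mul_of_nonneg_left (hc m hl) (by positivity)

theorem frob_mono (m : Expo n d) (c : ℂ_[p]) :
    frob (mono (wt n d) m c).1 = (mono (wt n d) (p • m) c).1 := funext fun l => by
  classical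
  by_cases hl : ∃ m : Expo n d, p • m = l
  · obtain ⟨l, rfl⟩ := hl
    rw [frob_nsmul, mono_apply, mono_apply]
    simp only [(nsmul_prime_injective (p := p)).eq_iff]
  · push Not at hl
    rw [frob_of_notMem_range _ hl, mono_apply, if_neg fun h => hl m h.symm]

variable (p n d) in
/-- The endomorphism `Λ ↦ Λ^p`. -/
def frobHom : GSer p n d →+* GSer p n d where
  toFun a := ⟨frob a.1, tame_frob a.2⟩
  map_zero' := ConvRing.ext fun l => by
    by_contra h
    obtain ⟨m, -, hm⟩ := exists_of_frob_ne_zero h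
    exact h hm
  map_one' := Subtype.ext <| by
    change frob (1 : GSer p n d).1 = (1 : GSer p n d).1
    have h := frob_mono (p := p) (0 : Expo n d) 1
    rwa [smul_zero, mono_zero_one] at h
  map_add' a b := ConvRing.ext fun l => by
    change frob (a + b).1 l = frob a.1 l + frob b.1 l
    by_cases hl : ∃ m : Expo n d, p • m = l
    · obtain ⟨m, rfl⟩ := hl
      rw [frob_nsmul, frob_nsmul, frob_nsmul, coe_add, Pi.add_apply]
    · push Not at hl
      rw [frob_of_notMem_range _ hl, frob_of_notMem_range _ hl, frob_of_notMem_range _ hl,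
        add_zero]
  map_mul' a b := ConvRing.ext fun l => by
    change frob (a * b).1 l = ∑' m, frob a.1 m * frob b.1 (l - m)
    have hsupp : Function.support (fun m => frob a.1 m * frob b.1 (l - m)) ⊆
        Set.range fun m : Expo n d => p • m := fun m hm => by
      obtain ⟨m', rfl, -⟩ := exists_of_frob_ne_zero (left_ne_zero_of_mul hm)
      exact ⟨m', rfl⟩
    rw [← (nsmul_prime_injective (p := p)).tsum_eq hsupp]
    by_cases hl : ∃ m : Expo n d, p • m = l
    · obtain ⟨l, rfl⟩ := hl
      rw [frob_nsmul, mul_apply]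
      exact tsum_congr fun m => by rw [frob_nsmul, ← smul_sub, frob_nsmul]
    · push Not at hl
      rw [frob_of_notMem_range _ hl]
      refine ((tsum_congr fun m => ?_).trans tsum_zero).symm
      rw [frob_of_notMem_range b.1, mul_zero]
      intro m' h
      exact hl (m + m') (by rw [smul_add, h]; abel)

theorem frobHom_coe (a : GSer p n d) : (frobHom p n d a).1 = frob a.1 := rfl

theorem bddBy_frobHom {a : GSer p n d} {C : ℝ} (h : BddBy a C) : BddBy (frobHom p n d a) C :=
  norm_frob_le h

theorem frobHom_mem_supportE {a : GSer p n d} (h : a ∈ supportE p n d) :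
    frobHom p n d a ∈ supportE p n d := fun l hl => by
  obtain ⟨m, rfl, hm⟩ := exists_of_frob_ne_zero hl
  exact nsmul_mem_ESet (h m (by rwa [frobHom_coe, hm] at hl)) p

theorem hasDeg_frobHom {a : GSer p n d} {u : Lat n} (h : HasDeg a.1 u) :
    HasDeg (frobHom p n d a).1 (p • u) := fun l hl => by
  obtain ⟨m, rfl, hm⟩ := exists_of_frob_ne_zero hl
  rw [deg_nsmul, h m (by rwa [frobHom_coe, hm] at hl)]

theorem frobHom_mono (m : Expo n d) (c : ℂ_[p]) :
    frobHom p n d (mono (wt n d) m c) = mono (wt n d) (p • m) c := Subtype.ext (frob_mono m c)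

/-! ### Membership in `R` -/

theorem RE_subset_Rtilde : RE p n d ⊆ Rtilde p n d := fun ξ hξ =>
  ⟨{0}, fun _ => ξ, fun _ _ => hξ, by funext l; simp [shift]⟩

theorem bdd_of_Rtilde {ξ : Ser p n d} (h : ξ ∈ Rtilde p n d) : Tame (wt n d) ξ := by
  obtain ⟨s, ξ, hξ, rfl⟩ := h
  refine sum_mem (S := tameSubgroup ℂ_[p] (wt n d)) fun m hm => ?_
  have := shift_eq m (⟨ξ m, tame_of_bdd_supportE (hξ m hm)⟩ : GSer p n d)
  change shift m (ξ m) = _ at this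
  rw [this]
  exact (mono (wt n d) m 1 * _ : GSer p n d).2

theorem Rtilde_subset_RR : Rtilde p n d ⊆ RR p n d := fun ξ hξ =>
  ⟨(bdd_of_Rtilde hξ).1, fun ε hε => ⟨ξ, hξ, fun l => by simpa using hε.le⟩⟩

theorem RE_subset_RR : RE p n d ⊆ RR p n d := RE_subset_Rtilde.trans Rtilde_subset_RR

theorem tame_of_approx {ξ : Ser p n d} (hb : ξ ∈ BddSer p n d)
    (h : ∀ ε > 0, ∃ η, Tame (wt n d) η ∧ NormLE (ξ - η) ε) : Tame (wt n d) ξ := by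
  refine ⟨hb, fun ε hε => ?_⟩
  obtain ⟨η, hη, hle⟩ := h ε hε
  obtain ⟨c, hc⟩ := hη.2 ε hε
  refine ⟨c, fun l hl => hc l ?_⟩
  by_contra hlt
  have h1 : ξ l = (ξ - η) l + η l := by simp
  rw [h1] at hl
  exact absurd (hl.trans_le (IsUltrametricDist.norm_add_le_max _ _))
    (not_lt.2 (max_le (hle l) (not_lt.1 hlt)))

theorem tame_of_mem_RR {ξ : Ser p n d} (h : ξ ∈ RR p n d) : Tame (wt n d) ξ :=
  tame_of_approx h.1 fun ε hε => by
    obtain ⟨η, hη, hle⟩ := h.2 ε hε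
    exact ⟨η, bdd_of_Rtilde hη, hle⟩

theorem mono_mul_supportE_mem_RR (m : Expo n d) {a : GSer p n d} (ha : a ∈ supportE p n d) :
    (mono (wt n d) m 1 * a).1 ∈ RR p n d := by
  refine Rtilde_subset_RR ⟨{m}, fun _ => a.1, fun _ _ => mem_RE_iff.2 ha, ?_⟩
  rw [Finset.sum_singleton, shift_eq]

/-! ### Matrices -/

/-- The matrix of underlying series of a matrix of tame series. -/
def toS (X : Matrix (Inn n d) (Inn n d) (GSer p n d)) : SMat p n d := fun i j => (X i j).1

theorem toS_injective : Function.Injective (toS (p := p) (n := n) (d := d)) := fun _ _ h =>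
  Matrix.ext fun i j => Subtype.ext (congrFun (congrFun h i) j)

theorem mmul_toS (X Y : Matrix (Inn n d) (Inn n d) (GSer p n d)) :
    mmul (toS X) (toS Y) = toS (X * Y) := by
  funext i j
  simp only [mmul, toS, Matrix.mul_apply, coe_sum, serMul_eq]

theorem mone_eq : (mone : SMat p n d) = toS 1 := by
  funext i j
  simp only [mone, toS, Matrix.one_apply]
  split_ifs
  · funext l
    rw [one_apply, Pi.single_apply]
  · rfl

theorem mfrob_toS (X : Matrix (Inn n d) (Inn n d) (GSer p n d)) :
    mfrob (toS X) = toS ((frobHom p n d).mapMatrix X) := rfl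

theorem isInverse_toS {X Y : Matrix (Inn n d) (Inn n d) (GSer p n d)}
    (hX : ∀ i j, X i j ∈ supportE p n d) (hY : ∀ i j, Y i j ∈ supportE p n d) (h : X * Y = 1) :
    IsInverse (toS X) (toS Y) := by
  refine ⟨fun i j => ⟨RE_subset_RR (mem_RE_iff.2 (hX i j)),
    RE_subset_RR (mem_RE_iff.2 (hY i j))⟩, ?_, ?_⟩
  · rw [mmul_toS, h, mone_eq]
  · rw [mmul_toS, mul_eq_one_comm.1 h, mone_eq]

theorem minv_toS {X Y : Matrix (Inn n d) (Inn n d) (GSer p n d)}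
    (hX : ∀ i j, X i j ∈ supportE p n d) (hY : ∀ i j, Y i j ∈ supportE p n d) (h : X * Y = 1) :
    minv (toS X) = toS Y := by
  have hinv : IsInverse (toS X) (minv (toS X)) :=
    Classical.epsilon_spec ⟨toS Y, isInverse_toS hX hY h⟩
  let Z : Matrix (Inn n d) (Inn n d) (GSer p n d) := fun i j =>
    ⟨minv (toS X) i j, tame_of_mem_RR (hinv.1 i j).2⟩
  have hZ : minv (toS X) = toS Z := rfl
  have h2 := hinv.2.2
  rw [hZ, mmul_toS, mone_eq] at h2
  have h3 : Z * X = 1 := toS_injective h2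
  rw [hZ]
  congr 1
  calc Z = Z * (X * Y) := by rw [h, mul_one]
    _ = Y := by rw [← mul_assoc, h3, one_mul]

theorem adjugate_mem {ι R : Type*} [Fintype ι] [DecidableEq ι] [CommRing R] (T : Subring R)
    {X : Matrix ι ι R} (hX : ∀ i j, X i j ∈ T) : X.det ∈ T ∧ ∀ i j, X.adjugate i j ∈ T := by
  let X' : Matrix ι ι T := fun i j => ⟨X i j, hX i j⟩
  have h : T.subtype.mapMatrix X' = X := rfl
  constructor
  · rw [← h, ← RingHom.map_det]; exact (X'.det).2
  · intro i j
    rw [← h, ← RingHom.map_adjugate]; exact (X'.adjugate i j).2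

/-- Matrices over the unit ball of `R_E` whose constant term is invertible over the unit ball
are invertible. -/
theorem exists_matrix_inverse {X : Matrix (Inn n d) (Inn n d) (GSer p n d)}
    (hX : ∀ i j, X i j ∈ supportE p n d) (hX1 : ∀ i j, BddBy (X i j) 1)
    (h0 : ‖X.det 0‖ = 1) :
    ∃ Y : Matrix (Inn n d) (Inn n d) (GSer p n d), (∀ i j, Y i j ∈ supportE p n d) ∧
      (∀ i j, BddBy (Y i j) 1) ∧ X * Y = 1 := by
  obtain ⟨hd1, ha1⟩ := adjugate_mem (unitBall ℂ_[p] (wt n d)) hX1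
  obtain ⟨hdE, haE⟩ := adjugate_mem (supportE p n d) hX
  obtain ⟨g, hgE, hg1, hg⟩ := exists_inverse_supportE hdE hd1 h0
  refine ⟨g • X.adjugate, fun i j => mul_mem hgE (haE i j),
    fun i j => hg1.mul_one_one (ha1 i j), ?_⟩
  rw [Matrix.mul_smul, Matrix.mul_adjugate, smul_smul, mul_comm, hg, one_smul]

variable (p n d) in
/-- The constant term, a ring homomorphism on series supported on `E`. -/
def constTerm : supportE p n d →+* ℂ_[p] where
  toFun a := a.1 0
  map_one' := by
    change (1 : GSer p n d) 0 = 1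
    rw [one_apply]; simp
  map_zero' := rfl
  map_add' a b := rfl
  map_mul' a b := by
    change (a.1 * b.1) 0 = a.1 0 * b.1 0
    rw [mul_apply, tsum_eq_single 0]
    · simp
    · intro m hm
      by_contra h
      have h1 := height_pos_of_mem_ESet (a.2 m (left_ne_zero_of_mul h)) hm
      have h2 := height_nonneg_of_mem_ESet (b.2 _ (right_ne_zero_of_mul h))
      rw [zero_sub, map_neg] at h2
      linarith

theorem det_constTerm {X : Matrix (Inn n d) (Inn n d) (GSer p n d)}
    (hX : ∀ i j, X i j ∈ supportE p n d) : X.det 0 = Matrix.det (fun i j => X i j 0) := by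
  let X' : Matrix (Inn n d) (Inn n d) (supportE p n d) := fun i j => ⟨X i j, hX i j⟩
  have h : (supportE p n d).subtype.mapMatrix X' = X := rfl
  have h2 : X.det = (X'.det).1 := by rw [← h, ← RingHom.map_det]; rfl
  rw [h2]
  exact RingHom.map_det (constTerm p n d) X'

end Ring

/-! ### Formal power series with lacunary logarithmic derivative -/

section Formal

open PowerSeries

variable {K : Type*} [Field K] [CharZero K] (p : ℕ)

/-- The series `∑_j ε_j t^{p^j}`. -/
def lacunary (ε : ℕ → K) : PowerSeries K :=
  PowerSeries.mk fun m => ∑ j ∈ Finset.range (m + 1), if m = p ^ j then ε j else 0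

theorem constantCoeff_lacunary [hp : Fact p.Prime] (ε : ℕ → K) :
    constantCoeff (lacunary p ε) = 0 := by
  rw [← coeff_zero_eq_constantCoeff_apply, lacunary, coeff_mk]
  exact Finset.sum_eq_zero fun j _ => if_neg (pow_pos hp.out.pos j).ne

theorem X_mul_derivative_lacunary (ε : ℕ → K) :
    X * d⁄dX K (lacunary p ε) = lacunary p fun j => (p : K) ^ j * ε j := by
  ext m
  cases m with
  | zero =>
    simp only [coeff_zero_X_mul, lacunary, coeff_mk]
    simp only [zero_add, Finset.range_one, Finset.sum_singleton, pow_zero]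
    simp
  | succ m =>
    rw [coeff_succ_X_mul, coeff_derivative, lacunary, lacunary, coeff_mk, coeff_mk,
      Finset.sum_mul]
    refine Finset.sum_congr rfl fun j _ => ?_
    split_ifs with h
    · have : ((m : K) + 1) = (p : K) ^ j := by exact_mod_cast congrArg (Nat.cast (R := K)) h
      rw [this, mul_comm]
    · simp

theorem lacunary_add (ε δ : ℕ → K) : lacunary p ε + lacunary p δ = lacunary p (ε + δ) := by
  ext m
  simp only [lacunary, map_add, coeff_mk, ← Finset.sum_add_distrib, Pi.add_apply]
  exact Finset.sum_congr rfl fun j _ => by split_ifs <;> simp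

theorem natCast_mul_lacunary (c : ℕ) (ε : ℕ → K) :
    (c : PowerSeries K) * lacunary p ε = lacunary p fun j => c * ε j := by
  ext m
  rw [← map_natCast C, coeff_C_mul]
  simp only [lacunary, coeff_mk, Finset.mul_sum, mul_ite, mul_zero]

theorem rescale_lacunary (c : K) (ε : ℕ → K) :
    rescale c (lacunary p ε) = lacunary p fun j => c ^ p ^ j * ε j := by
  ext m
  rw [coeff_rescale]
  simp only [lacunary, coeff_mk, Finset.mul_sum, mul_ite, mul_zero]
  refine Finset.sum_congr rfl fun j _ => ?_
  split_ifs with h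
  · rw [h]
  · rfl

theorem map_lacunary {L : Type*} [Field L] (φ : K →+* L) (ε : ℕ → K) :
    PowerSeries.map φ (lacunary p ε) = lacunary p fun j => φ (ε j) := by
  ext m
  rw [coeff_map]
  simp only [lacunary, coeff_mk, map_sum]
  exact Finset.sum_congr rfl fun j _ => by split_ifs <;> simp

theorem lacunary_single_zero [Fact p.Prime] :
    lacunary p (fun j => if j = 0 then (1 : K) else 0) = X := by
  ext m
  rw [lacunary, coeff_mk, coeff_X, Finset.sum_range_succ', Finset.sum_eq_zero]
  · simp
  · intro j _
    simp

theorem expand_lacunary [hp : Fact p.Prime] (ε : ℕ → K) :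
    expand p hp.out.ne_zero (lacunary p ε) =
      lacunary p fun j => if j = 0 then 0 else ε (j - 1) := by
  ext m
  rw [coeff_expand]
  simp only [lacunary, coeff_mk]
  by_cases hm : m = 0
  · subst hm
    simp
  rw [Finset.sum_range_succ' _ m]
  simp only [pow_zero, if_true, ite_self, add_zero, Nat.succ_ne_zero, if_false,
    Nat.add_sub_cancel]
  split_ifs with hdvd
  · obtain ⟨m, rfl⟩ := hdvd
    rw [Nat.mul_div_cancel_left _ hp.out.pos]
    simp only [pow_succ', mul_right_inj' hp.out.ne_zero]
    have hm' : m ≠ 0 := by rintro rfl; simp at hm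
    refine Finset.sum_subset (Finset.range_subset_range.2 ?_) fun j _ hj => if_neg ?_
    · have := hp.out.two_le
      nlinarith [Nat.pos_of_ne_zero hm']
    · rw [Finset.mem_range, not_lt] at hj
      have : j < p ^ j := Nat.lt_pow_self hp.out.one_lt
      omega
  · refine (Finset.sum_eq_zero fun j _ => if_neg ?_).symm
    rintro rfl
    exact hdvd (dvd_pow_self p (Nat.succ_ne_zero j))

/-- A power series is determined by its constant coefficient and its logarithmic derivative. -/
theorem eq_of_logDeriv_eq {f g h : PowerSeries K} (hg : constantCoeff g = 0)
    (hf : X * d⁄dX K f = g * f) (hh : X * d⁄dX K h = g * h)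
    (h0 : constantCoeff f = constantCoeff h) : f = h := by
  rw [← sub_eq_zero]
  have hk : X * d⁄dX K (f - h) = g * (f - h) := by rw [map_sub, mul_sub, hf, hh, mul_sub]
  have hk0 : constantCoeff (f - h) = 0 := by rw [map_sub, h0, sub_self]
  ext m
  rw [map_zero]
  induction m using Nat.strong_induction_on with
  | _ m ih =>
    cases m with
    | zero => rw [coeff_zero_eq_constantCoeff_apply, hk0]
    | succ m =>
      have h1 := congrArg (coeff (m + 1)) hk
      rw [coeff_succ_X_mul, coeff_derivative, coeff_mul, Finset.sum_eq_zero] at h1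
      · exact (mul_eq_zero.1 h1).resolve_right (by exact_mod_cast Nat.succ_ne_zero m)
      · rintro ⟨i, j⟩ hij
        rw [Finset.HasAntidiagonal.mem_antidiagonal] at hij
        simp only at hij ⊢
        by_cases hi : i = 0
        · rw [hi, coeff_zero_eq_constantCoeff_apply, hg, zero_mul]
        · rw [ih j (by omega), mul_zero]

theorem logDeriv_mul {f g a b : PowerSeries K} (hf : X * d⁄dX K f = a * f)
    (hg : X * d⁄dX K g = b * g) : X * d⁄dX K (f * g) = (a + b) * (f * g) := by
  rw [Derivation.leibniz, smul_eq_mul, smul_eq_mul, mul_add, mul_left_comm, hg,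
    mul_left_comm X g, hf]
  ring

theorem logDeriv_pow {f a : PowerSeries K} (hf : X * d⁄dX K f = a * f) (k : ℕ) :
    X * d⁄dX K (f ^ k) = (k : PowerSeries K) * a * f ^ k := by
  induction k with
  | zero => simp
  | succ k ih =>
    rw [pow_succ, logDeriv_mul ih hf]
    push_cast
    ring

theorem logDeriv_expand {f a : PowerSeries K} (hp : p ≠ 0) (hf : X * d⁄dX K f = a * f) :
    X * d⁄dX K (expand p hp f) = (p : PowerSeries K) * expand p hp a * expand p hp f := by
  have h1 : d⁄dX K (expand p hp f) = expand p hp (d⁄dX K f) * ((p : PowerSeries K) * X ^ (p - 1)) := by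
    rw [expand_apply, expand_apply, derivative_subst (HasSubst.X_pow hp), derivative_pow,
      derivative_X, mul_one]
  have h2 : (X : PowerSeries K) * X ^ (p - 1) = expand p hp X := by
    rw [expand_X, mul_comm, ← pow_succ, Nat.sub_add_cancel (Nat.one_le_iff_ne_zero.2 hp)]
  calc X * d⁄dX K (expand p hp f)
      = (p : PowerSeries K) * ((X * X ^ (p - 1)) * expand p hp (d⁄dX K f)) := by rw [h1]; ring
    _ = (p : PowerSeries K) * expand p hp (X * d⁄dX K f) := by rw [h2, map_mul]
    _ = _ := by rw [hf, map_mul]; ring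

theorem logDeriv_rescale {f a : PowerSeries K} (c : K) (hf : X * d⁄dX K f = a * f) :
    X * d⁄dX K (rescale c f) = rescale c a * rescale c f := by
  rw [← map_mul, ← hf]
  ext m
  cases m with
  | zero => simp
  | succ m =>
    rw [coeff_succ_X_mul, coeff_derivative, coeff_rescale, coeff_rescale, coeff_succ_X_mul,
      coeff_derivative]
    ring

theorem logDeriv_exp_subst [Algebra ℚ K] {g : PowerSeries K} (hg : constantCoeff g = 0) :
    X * d⁄dX K ((PowerSeries.exp K).subst g) =
      (X * d⁄dX K g) * (PowerSeries.exp K).subst g := by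
  rw [derivative_subst (HasSubst.of_constantCoeff_zero' hg), derivative_exp]
  ring

theorem constantCoeff_exp_subst [Algebra ℚ K] {g : PowerSeries K} (hg : constantCoeff g = 0) :
    constantCoeff ((PowerSeries.exp K).subst g) = 1 := by
  have hs := HasSubst.of_constantCoeff_zero' hg
  have h1 : PowerSeries.exp K = 1 + (PowerSeries.exp K - 1) := by ring
  rw [h1, subst_add hs]
  have h2 : constantCoeff (subst g (PowerSeries.exp K - 1)) = 0 :=
    constantCoeff_subst_eq_zero hg _ (by simp)
  have h3 : subst g (1 : PowerSeries K) = 1 := by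
    rw [← coe_substAlgHom hs, map_one]
  rw [map_add, h2, h3]
  simp

theorem logDeriv_exp [Algebra ℚ K] : X * d⁄dX K (PowerSeries.exp K) = X * PowerSeries.exp K := by
  rw [derivative_exp]

theorem logDeriv_map {L : Type*} [Field L] [CharZero L] (φ : K →+* L) {f a : PowerSeries K}
    (hf : X * d⁄dX K f = a * f) :
    X * d⁄dX L (PowerSeries.map φ f) = PowerSeries.map φ a * PowerSeries.map φ f := by
  rw [← map_mul, ← hf]
  ext m
  cases m with
  | zero => simp
  | succ m =>
    rw [coeff_succ_X_mul, coeff_derivative, coeff_map, coeff_map, coeff_succ_X_mul,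
      coeff_derivative, map_mul]
    simp

/-- The coefficients of a power series, extended by zero to negative indices. -/
def zcoeff (f : PowerSeries K) (m : ℤ) : K := if m < 0 then 0 else coeff m.toNat f

theorem zcoeff_of_neg (f : PowerSeries K) {m : ℤ} (h : m < 0) : zcoeff f m = 0 := if_pos h

theorem zcoeff_natCast (f : PowerSeries K) (m : ℕ) : zcoeff f m = coeff m f := by
  simp [zcoeff]

theorem lt_prime_pow [hp : Fact p.Prime] (j : ℕ) : j < p ^ j :=
  Nat.lt_pow_self hp.out.one_lt

/-- The recursion for the coefficients of a power series with lacunary logarithmic derivative. -/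
theorem sum_zcoeff_of_logDeriv [hp : Fact p.Prime] {ε : ℕ → K} {f : PowerSeries K}
    (hf : X * d⁄dX K f = lacunary p ε * f) (m : ℕ) :
    (m : K) * zcoeff f m = ∑ j ∈ Finset.range (m + 1), ε j * zcoeff f ((m : ℤ) - (p : ℤ) ^ j) := by
  have h1 : (m : K) * zcoeff f m = coeff m (lacunary p ε * f) := by
    rw [← hf, zcoeff_natCast]
    cases m with
    | zero => simp
    | succ m => rw [coeff_succ_X_mul, coeff_derivative, mul_comm]; push_cast; rfl
  have h2 : coeff m (lacunary p ε * f)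
      = coeff m ((∑ j ∈ Finset.range (m + 1), C (ε j) * X ^ p ^ j) * f) := by
    rw [coeff_mul, coeff_mul]
    refine Finset.sum_congr rfl fun x hx => ?_
    rw [Finset.HasAntidiagonal.mem_antidiagonal] at hx
    congr 1
    rw [lacunary, coeff_mk, map_sum]
    simp only [coeff_C_mul, coeff_X_pow, mul_ite, mul_one, mul_zero]
    refine Finset.sum_subset (Finset.range_subset_range.2 (by omega)) fun j _ hj => if_neg ?_
    rw [Finset.mem_range, not_lt] at hj
    have := lt_prime_pow p j
    omega
  rw [h1, h2, Finset.sum_mul, map_sum]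
  refine Finset.sum_congr rfl fun j _ => ?_
  rw [mul_assoc, coeff_C_mul, coeff_X_pow_mul']
  congr 1
  split_ifs with h
  · have : (m : ℤ) - (p : ℤ) ^ j = ((m - p ^ j : ℕ) : ℤ) := by
      rw [Nat.cast_sub h]; push_cast; rfl
    rw [this, zcoeff_natCast]
  · rw [zcoeff_of_neg]
    have : m < p ^ j := by omega
    have : (m : ℤ) < (p : ℤ) ^ j := by exact_mod_cast this
    linarith

theorem zcoeff_sub_pow_eq_zero [hp : Fact p.Prime] (f : PowerSeries K) {m : ℤ} {j : ℕ}
    (h : m ≤ j) : zcoeff f (m - (p : ℤ) ^ j) = 0 := by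
  refine zcoeff_of_neg f ?_
  have h1 : (j : ℤ) < (p : ℤ) ^ j := by exact_mod_cast lt_prime_pow p j
  linarith

end Formal

/-! ### The Artin–Hasse exponential -/

section ArtinHasse

open PowerSeries

variable (p : ℕ) [hp : Fact p.Prime]

/-- The Artin–Hasse exponential over `ℚ_p`. -/
def artinHasse : PowerSeries ℚ_[p] :=
  (PowerSeries.exp ℚ_[p]).subst (lacunary p fun j => ((p : ℚ_[p]) ^ j)⁻¹)

theorem logDeriv_artinHasse :
    X * d⁄dX ℚ_[p] (artinHasse p) = lacunary p (fun _ => 1) * artinHasse p := by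
  rw [artinHasse, logDeriv_exp_subst (constantCoeff_lacunary p _), X_mul_derivative_lacunary]
  have hp0 : (p : ℚ_[p]) ≠ 0 := by exact_mod_cast hp.out.ne_zero
  congr 2
  funext j
  exact mul_inv_cancel₀ (pow_ne_zero j hp0)

theorem constantCoeff_artinHasse : constantCoeff (artinHasse p) = 1 :=
  constantCoeff_exp_subst (constantCoeff_lacunary p _)

theorem artinHasse_pow :
    artinHasse p ^ p = expand p hp.out.ne_zero (artinHasse p) *
      rescale (p : ℚ_[p]) (PowerSeries.exp ℚ_[p]) := by
  have hp0 : (p : ℚ_[p]) ≠ 0 := by exact_mod_cast hp.out.ne_zero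
  refine eq_of_logDeriv_eq (g := (p : PowerSeries ℚ_[p]) * lacunary p fun _ => 1)
    (by rw [map_mul, constantCoeff_lacunary, mul_zero])
    (logDeriv_pow (logDeriv_artinHasse p) p) ?_ ?_
  · rw [logDeriv_mul (logDeriv_expand p hp.out.ne_zero (logDeriv_artinHasse p))
      (logDeriv_rescale (p : ℚ_[p]) logDeriv_exp), rescale_X]
    congr 1
    have : C (p : ℚ_[p]) * X = (p : PowerSeries ℚ_[p]) * X := by rw [map_natCast]
    rw [this, ← mul_add]
    rw [expand_lacunary, ← lacunary_single_zero p, lacunary_add]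
    congr 2
    funext j
    cases j <;> simp
  · rw [map_pow, map_mul, constantCoeff_artinHasse, constantCoeff_expand,
      constantCoeff_artinHasse]
    simp [← coeff_zero_eq_constantCoeff_apply]

theorem norm_prime_pow_div_factorial_le {s : ℕ} (hs : s ≠ 0) :
    ‖((p : ℚ_[p]) ^ s / (s.factorial : ℚ_[p]))‖ ≤ (p : ℝ)⁻¹ := by
  have h1 := sub_one_mul_padicValNat_factorial_lt_of_ne_zero (p := p) hs
  have h2 : padicValNat p s.factorial < s := by
    have : 1 ≤ p - 1 := Nat.le_sub_one_of_lt hp.out.one_lt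
    nlinarith
  have hp1 : (1 : ℝ) < p := by exact_mod_cast hp.out.one_lt
  rw [norm_div, norm_pow, Padic.norm_p, Padic.norm_eq_zpow_neg_valuation
    (by exact_mod_cast s.factorial_ne_zero), Padic.valuation_natCast, zpow_neg, div_inv_eq_mul,
    zpow_natCast, inv_pow, inv_mul_le_iff₀ (by positivity)]
  obtain ⟨k, hk⟩ : ∃ k, s = padicValNat p s.factorial + k + 1 := ⟨s - padicValNat p s.factorial - 1, by omega⟩
  rw [← div_eq_mul_inv, le_div_iff₀ (by positivity), ← pow_succ]
  exact pow_le_pow_right₀ hp1.le h2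

theorem norm_coeff_artinHasse_le (n : ℕ) : ‖coeff n (artinHasse p)‖ ≤ 1 := by
  induction n using Nat.strong_induction_on with
  | _ n ih =>
  by_cases hn : n = 0
  · rw [hn, coeff_zero_eq_constantCoeff_apply, constantCoeff_artinHasse, norm_one]
  have hpr : (0 : ℝ) < p := by exact_mod_cast hp.out.pos
  have hz : ∀ m, ∃ z : ℤ_[p], m < n → (z : ℚ_[p]) = coeff m (artinHasse p) := fun m => by
    by_cases hm : m < n
    · exact ⟨⟨_, ih m hm⟩, fun _ => rfl⟩
    · exact ⟨0, fun h => absurd h hm⟩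
  choose z hz using hz
  let g : Polynomial ℤ_[p] := ∑ m ∈ Finset.range n, Polynomial.monomial m (z m)
  have hg : ∀ m, ((g.coeff m : ℤ_[p]) : ℚ_[p]) = if m < n then coeff m (artinHasse p) else 0 := by
    intro m
    simp only [g, Polynomial.finsetSum_coeff, Polynomial.coeff_monomial]
    by_cases hm : m < n
    · rw [Finset.sum_eq_single m (fun b _ hb => if_neg hb)
        (fun h => absurd (Finset.mem_range.2 hm) h), if_pos rfl, if_pos hm, hz m hm]
    · rw [if_neg hm, Finset.sum_eq_zero]
      · rfl
      · intro b hb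
        rw [if_neg]
        rintro rfl
        exact hm (Finset.mem_range.1 hb)
  set G : PowerSeries ℚ_[p] := ((g.map (algebraMap ℤ_[p] ℚ_[p]) : Polynomial ℚ_[p]) :
    PowerSeries ℚ_[p]) with hG
  have hGc : ∀ m, coeff m G = if m < n then coeff m (artinHasse p) else 0 := fun m => by
    rw [hG, Polynomial.coeff_coe, Polynomial.coeff_map]
    exact hg m
  -- the Frobenius congruence for `g`
  have hfrob : ‖(((g ^ p - Polynomial.expand ℤ_[p] p g).coeff n : ℤ_[p]) : ℚ_[p])‖ ≤
      (p : ℝ)⁻¹ := by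
    have h1 : PadicInt.toZMod ((g ^ p - Polynomial.expand ℤ_[p] p g).coeff n) = 0 := by
      rw [← Polynomial.coeff_map, Polynomial.map_sub, Polynomial.map_pow, Polynomial.map_expand,
        ZMod.expand_card, sub_self, Polynomial.coeff_zero]
    have h2 : (g ^ p - Polynomial.expand ℤ_[p] p g).coeff n ∈
        RingHom.ker (PadicInt.toZMod : ℤ_[p] →+* ZMod p) := h1
    rw [PadicInt.ker_toZMod, PadicInt.maximalIdeal_eq_span_p] at h2
    have h3 := (PadicInt.norm_le_pow_iff_mem_span_pow _ 1).2 (by simpa using h2)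
    rw [PadicInt.norm_def] at h3
    simpa using h3
  have hdecomp : ∃ H : PowerSeries ℚ_[p], artinHasse p = G + X ^ n * H ∧
      coeff 0 H = coeff n (artinHasse p) := by
    have : X ^ n ∣ artinHasse p - G := by
      rw [X_pow_dvd_iff]
      intro m hm
      rw [map_sub, hGc, if_pos hm, sub_self]
    obtain ⟨H, hH⟩ := this
    refine ⟨H, by rw [← hH]; ring, ?_⟩
    have := congrArg (coeff n) hH
    rw [map_sub, hGc, if_neg (lt_irrefl n), sub_zero, coeff_X_pow_mul', if_pos le_rfl,
      Nat.sub_self] at this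
    exact this.symm
  obtain ⟨H, hH, hH0⟩ := hdecomp
  have hG0 : constantCoeff G = 1 := by
    rw [← coeff_zero_eq_constantCoeff_apply, hGc, if_pos (Nat.pos_of_ne_zero hn),
      coeff_zero_eq_constantCoeff_apply, constantCoeff_artinHasse]
  -- the `n`-th coefficient of the `p`-th power
  have hL : coeff n (artinHasse p ^ p) = coeff n (G ^ p) + p * coeff n (artinHasse p) := by
    obtain ⟨R, hR⟩ := (Polynomial.binomExpansion (Polynomial.X ^ p : Polynomial (PowerSeries ℚ_[p]))
      G (X ^ n * H))
    simp only [Polynomial.eval_pow, Polynomial.eval_X, Polynomial.derivative_X_pow,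
      Polynomial.eval_mul, Polynomial.eval_C] at hR
    rw [← hH] at hR
    rw [hR, map_add, map_add]
    have e1 : coeff n ((p : PowerSeries ℚ_[p]) * G ^ (p - 1) * (X ^ n * H))
        = p * coeff n (artinHasse p) := by
      rw [mul_left_comm, coeff_X_pow_mul', if_pos le_rfl, Nat.sub_self,
        coeff_zero_eq_constantCoeff_apply, map_mul, map_mul, map_pow, hG0, one_pow, mul_one,
        ← hH0, coeff_zero_eq_constantCoeff_apply, map_natCast]
    have e2 : coeff n (R * (X ^ n * H) ^ 2) = 0 := by
      rw [mul_pow, ← pow_mul, mul_left_comm, coeff_X_pow_mul', if_neg]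
      omega
    rw [e1, e2, add_zero]
  have hlt : ∀ i, p * i ≤ n → i < n := fun i hi => by
    have := hp.out.two_le
    by_contra h
    nlinarith [Nat.pos_of_ne_zero hn]
  have hRHS : ‖coeff n (artinHasse p ^ p) -
      coeff n (expand p hp.out.ne_zero (artinHasse p))‖ ≤ (p : ℝ)⁻¹ := by
    rw [artinHasse_pow, coeff_mul]
    have hmem : (n, 0) ∈ Finset.HasAntidiagonal.antidiagonal n := by simp
    rw [← Finset.add_sum_erase _ _ hmem, coeff_zero_eq_constantCoeff_apply]
    have : constantCoeff (rescale (p : ℚ_[p]) (PowerSeries.exp ℚ_[p])) = 1 := by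
      simp [← coeff_zero_eq_constantCoeff_apply]
    rw [this, mul_one, add_sub_cancel_left]
    refine IsUltrametricDist.norm_sum_le_of_forall_le_of_nonneg (by positivity) ?_
    rintro ⟨i, s⟩ his
    rw [Finset.mem_erase, Finset.HasAntidiagonal.mem_antidiagonal] at his
    have hs : s ≠ 0 := by
      rintro rfl
      exact his.1 (by simpa using his.2)
    simp only
    rw [norm_mul, coeff_rescale, coeff_exp, ← one_mul (p : ℝ)⁻¹]
    refine mul_le_mul ?_ ?_ (norm_nonneg _) zero_le_one
    · rw [coeff_expand]
      split_ifs with h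
      · refine ih _ (hlt _ ?_)
        rw [Nat.mul_div_cancel' h]
        omega
      · simp
    · have := norm_prime_pow_div_factorial_le p hs
      simpa [div_eq_mul_inv] using this
  have hexp : coeff n (expand p hp.out.ne_zero (artinHasse p)) =
      (((Polynomial.expand ℤ_[p] p g).coeff n : ℤ_[p]) : ℚ_[p]) := by
    rw [coeff_expand, Polynomial.coeff_expand hp.out.pos]
    split_ifs with h
    · rw [hg, if_pos (hlt _ (by rw [Nat.mul_div_cancel' h]))]
    · rfl
  have hGp : coeff n (G ^ p) = (((g ^ p).coeff n : ℤ_[p]) : ℚ_[p]) := by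
    rw [hG, ← Polynomial.coe_pow, ← Polynomial.map_pow, Polynomial.coeff_coe,
      Polynomial.coeff_map]
    rfl
  have hfin : (p : ℚ_[p]) * coeff n (artinHasse p) =
      (coeff n (artinHasse p ^ p) - coeff n (expand p hp.out.ne_zero (artinHasse p))) -
        (((g ^ p - Polynomial.expand ℤ_[p] p g).coeff n : ℤ_[p]) : ℚ_[p]) := by
    rw [Polynomial.coeff_sub, PadicInt.coe_sub, ← hexp, ← hGp, hL]
    ring
  have hle : ‖(p : ℚ_[p]) * coeff n (artinHasse p)‖ ≤ (p : ℝ)⁻¹ := by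
    rw [hfin]
    rw [sub_eq_add_neg]
    exact (IsUltrametricDist.norm_add_le_max _ _).trans
      (max_le hRHS (by rw [norm_neg]; exact hfrob))
  rw [norm_mul, Padic.norm_p] at hle
  have := inv_pos.2 hpr
  nlinarith

end ArtinHasse

/-! ### Convergent one-variable series -/

section OneVariable

variable {K : Type*} [NormedField K] [IsUltrametricDist K] [CompleteSpace K]

/-- Interchange of a double sum after a shift depending on one of the indices. -/
theorem tsum_tsum_shift {g : ℕ → ℤ → K} {σ : ℕ → ℝ} {ρ : ℤ → ℝ} (s : ℕ → ℤ) (hσ : Summable σ)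
    (hρ : Summable ρ) (hσ0 : ∀ j, 0 ≤ σ j) (hρ0 : ∀ b, 0 ≤ ρ b)
    (hg : ∀ j b, ‖g j b‖ ≤ σ j * ρ b) :
    Summable (fun b => ∑' j, g j (b - s j)) ∧ Summable (fun j => ∑' b, g j b) ∧
      ∑' b, ∑' j, g j (b - s j) = ∑' j, ∑' b, g j b := by
  have h1 : Summable fun x : ℕ × ℤ => g x.1 x.2 :=
    Summable.of_norm_bounded (hσ.mul_of_nonneg hρ hσ0 hρ0) fun x => hg x.1 x.2
  let e : ℕ × ℤ ≃ ℕ × ℤ :=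
    { toFun := fun x => (x.1, x.2 - s x.1)
      invFun := fun x => (x.1, x.2 + s x.1)
      left_inv := fun x => by simp
      right_inv := fun x => by simp }
  have h2 : Summable (Function.uncurry fun j b => g j (b - s j)) := (e.summable_iff).2 h1
  refine ⟨?_, h1.prod, ?_⟩
  · have h3 := ((Equiv.prodComm ℤ ℕ).summable_iff).2 h2
    exact h3.prod
  · rw [Summable.tsum_comm h2]
    exact tsum_congr fun j => (Equiv.subRight (s j)).tsum_eq (g j)

variable {p : ℕ} [hp : Fact p.Prime]

variable (p) in
/-- `p^{-1/2}`. -/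
def invSqrt : ℝ := (Real.sqrt p)⁻¹

theorem invSqrt_pos : 0 < invSqrt p := by
  have : (0 : ℝ) < p := by exact_mod_cast hp.out.pos
  exact inv_pos.2 (Real.sqrt_pos.2 this)

theorem invSqrt_sq : invSqrt p ^ 2 = (p : ℝ)⁻¹ := by
  rw [invSqrt, inv_pow, Real.sq_sqrt (Nat.cast_nonneg p)]

theorem invSqrt_lt_one : invSqrt p < 1 := by
  have h1 : (1 : ℝ) < p := by exact_mod_cast hp.out.one_lt
  refine inv_lt_one_of_one_lt₀ ?_
  rw [Real.lt_sqrt zero_le_one]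
  simpa using h1

/-- `r^b` for `b ≥ 0`, extended by zero. -/
def geom (r : ℝ) (b : ℤ) : ℝ := if b < 0 then 0 else r ^ b.toNat

theorem geom_nonneg {r : ℝ} (hr : 0 ≤ r) (b : ℤ) : 0 ≤ geom r b := by
  rw [geom]; split_ifs <;> positivity

theorem summable_geom {r : ℝ} (hr : 0 ≤ r) (hr1 : r < 1) : Summable (geom r) := by
  have h : ∀ b ∉ Set.range (Nat.cast : ℕ → ℤ), geom r b = 0 := fun b hb => by
    refine if_pos (not_le.1 fun h => hb ⟨b.toNat, ?_⟩)
    omega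
  refine (Function.Injective.summable_iff (Nat.cast_injective (R := ℤ)) h).1 ?_
  convert summable_geometric_of_lt_one hr hr1 using 2 with b
  simp [geom]

theorem summable_geom_neg {r : ℝ} (hr : 0 ≤ r) (hr1 : r < 1) : Summable fun b => geom r (-b) :=
  (summable_geom hr hr1).comp_injective (neg_injective (G := ℤ))

/-- The coefficients `(-1)^{m} m!` of `t^{-m-1}` in `q(t)`. -/
def qfun (K : Type*) [Field K] (l : ℤ) : K :=
  if l < 0 then (-1) ^ (-l - 1).toNat * ((-l - 1).toNat.factorial : K) else 0

theorem qfun_sub_one {l : ℤ} (hl : l < 0) : (l : K) * qfun K l = qfun K (l - 1) := by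
  obtain ⟨m, rfl⟩ : ∃ m : ℕ, l = -(m : ℤ) - 1 := ⟨(-l - 1).toNat, by omega⟩
  have h1 : (-(-(m : ℤ) - 1) - 1).toNat = m := by omega
  have h2 : (-(-(m : ℤ) - 1 - 1) - 1).toNat = m + 1 := by omega
  rw [qfun, qfun, if_pos hl, if_pos (by linarith), h1, h2, Nat.factorial_succ]
  push_cast
  ring

theorem norm_natCast_le_one' (m : ℕ) : ‖(m : K)‖ ≤ 1 := IsUltrametricDist.norm_natCast_le_one K m

theorem norm_mul_of_dvd {a b : ℕ} (h : a ∣ b) (x : K) : ‖(b : K) * x‖ ≤ ‖(a : K) * x‖ := by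
  obtain ⟨c, rfl⟩ := h
  push_cast
  rw [mul_comm (a : K), mul_assoc, norm_mul]
  exact mul_le_of_le_one_left (norm_nonneg _) (norm_natCast_le_one' c)

/-- A natural number prime to `p` has norm one. -/
theorem norm_natCast_eq_one (hK : ‖(p : K)‖ = (p : ℝ)⁻¹) {m : ℕ} (hm : ¬ p ∣ m) :
    ‖(m : K)‖ = 1 := by
  refine le_antisymm (norm_natCast_le_one' m) ?_
  have hcop : Nat.gcd p m = 1 := (Nat.Prime.coprime_iff_not_dvd hp.out).2 hm
  have h1 := Nat.gcd_eq_gcd_ab p m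
  rw [hcop] at h1
  have h2 : (1 : K) = p * (Nat.gcdA p m : ℤ) + m * (Nat.gcdB p m : ℤ) := by
    exact_mod_cast congrArg (Int.cast (R := K)) h1
  by_contra hlt
  have hint : ∀ z : ℤ, ‖(z : K)‖ ≤ 1 := fun z => IsUltrametricDist.norm_intCast_le_one K z
  have hp1 : (p : ℝ)⁻¹ < 1 := inv_lt_one_of_one_lt₀ (by exact_mod_cast hp.out.one_lt)
  have h3 : ‖(1 : K)‖ < 1 := by
    rw [h2]
    refine (IsUltrametricDist.norm_add_le_max _ _).trans_lt (max_lt ?_ ?_)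
    · rw [norm_mul, hK]
      exact (mul_le_of_le_one_right (by positivity) (hint _)).trans_lt hp1
    · rw [norm_mul]
      exact (mul_le_of_le_one_right (norm_nonneg _) (hint _)).trans_lt (not_le.1 hlt)
  simp at h3

theorem norm_factorial_eq_one (hK : ‖(p : K)‖ = (p : ℝ)⁻¹) {m : ℕ} (hm : m < p) :
    ‖(m.factorial : K)‖ = 1 :=
  norm_natCast_eq_one hK fun h => absurd (hp.out.dvd_factorial.1 h) (not_le.2 hm)

theorem pow_prime_pow_sub_one_le {j : ℕ} (hj : j ≠ 0) :
    ((p : ℝ)⁻¹) ^ (p ^ j - 1) ≤ invSqrt p ^ p ^ j := by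
  rw [← invSqrt_sq, ← pow_mul]
  refine pow_le_pow_of_le_one invSqrt_pos.le invSqrt_lt_one.le ?_
  have : 2 ≤ p ^ j := hp.out.two_le.trans (Nat.le_self_pow hj p)
  omega

theorem pow_prime_pow_sub_one_le' (j : ℕ) : ((p : ℝ)⁻¹) ^ (p ^ j - 1) ≤ ((p : ℝ)⁻¹) ^ j := by
  have h1 : (1 : ℝ) < p := by exact_mod_cast hp.out.one_lt
  refine pow_le_pow_of_le_one (by positivity) (inv_lt_one_of_one_lt₀ h1).le ?_
  have := lt_prime_pow p j
  omega

/-- The numbers `θ̂_{1,m}` are small. -/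
theorem norm_factorial_mul_le [CharZero K] {ε : ℕ → K} (hε0 : ε 0 = 0)
    (hε : ∀ j, ‖ε j‖ ≤ ((p : ℝ)⁻¹) ^ (p ^ j - 1))
    {f : PowerSeries K} (hf0 : PowerSeries.constantCoeff f = 1)
    (hf : PowerSeries.X * PowerSeries.derivative K f = lacunary p ε * f) (m : ℕ) :
    ‖(m.factorial : K) * zcoeff f m‖ ≤ invSqrt p ^ m := by
  induction m using Nat.strong_induction_on with
  | _ m ih =>
  cases m with
  | zero => simp [zcoeff, hf0]
  | succ m =>
    have h1 : ((m + 1).factorial : K) * zcoeff f (m + 1 : ℕ) =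
        ∑ j ∈ Finset.range (m + 1 + 1),
          (m.factorial : K) * (ε j * zcoeff f (((m + 1 : ℕ) : ℤ) - (p : ℤ) ^ j)) := by
      rw [← Finset.mul_sum, ← sum_zcoeff_of_logDeriv p hf, Nat.factorial_succ]
      push_cast; ring
    rw [h1]
    refine IsUltrametricDist.norm_sum_le_of_forall_le_of_nonneg
      (pow_nonneg invSqrt_pos.le _) fun j _ => ?_
    by_cases hj : j = 0
    · rw [hj, hε0]
      simpa using pow_nonneg invSqrt_pos.le _
    by_cases hjm : p ^ j ≤ m + 1
    · have hcast : ((m + 1 : ℕ) : ℤ) - (p : ℤ) ^ j = ((m + 1 - p ^ j : ℕ) : ℤ) := by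
        rw [Nat.cast_sub hjm]; push_cast; rfl
      have hpos : 0 < p ^ j := pow_pos hp.out.pos j
      rw [hcast, mul_left_comm, norm_mul]
      have h2 := norm_mul_of_dvd (K := K) (Nat.factorial_dvd_factorial
        (show m + 1 - p ^ j ≤ m by omega)) (zcoeff f (m + 1 - p ^ j : ℕ))
      calc _ ≤ invSqrt p ^ p ^ j * invSqrt p ^ (m + 1 - p ^ j) :=
            mul_le_mul ((hε j).trans (pow_prime_pow_sub_one_le hj))
              (h2.trans (ih _ (by omega))) (norm_nonneg _) (pow_nonneg invSqrt_pos.le _)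
        _ = invSqrt p ^ (m + 1) := by rw [← pow_add]; congr 1; omega
    · rw [zcoeff_of_neg, mul_zero, mul_zero, norm_zero]
      · exact pow_nonneg invSqrt_pos.le _
      · have : ((m + 1 : ℕ) : ℤ) < (p : ℤ) ^ j := by exact_mod_cast not_le.1 hjm
        linarith

variable [CharZero K]

/-- The recursion for all integers, as an infinite sum. -/
theorem hasSum_zcoeff_of_logDeriv {ε : ℕ → K} {f : PowerSeries K}
    (hf : PowerSeries.X * PowerSeries.derivative K f = lacunary p ε * f) (l : ℤ) :
    HasSum (fun j : ℕ => ε j * zcoeff f (l - (p : ℤ) ^ j)) (l * zcoeff f l) := by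
  by_cases hl : l < 0
  · rw [zcoeff_of_neg f hl, mul_zero]
    have h : (fun j : ℕ => ε j * zcoeff f (l - (p : ℤ) ^ j)) = fun _ => 0 := by
      funext j
      rw [zcoeff_sub_pow_eq_zero p f (by omega), mul_zero]
    rw [h]
    exact hasSum_zero
  · obtain ⟨m, rfl⟩ : ∃ m : ℕ, l = m := ⟨l.toNat, by omega⟩
    rw [Int.cast_natCast, sum_zcoeff_of_logDeriv p hf]
    refine hasSum_sum_of_ne_finset_zero fun j hj => ?_
    rw [zcoeff_sub_pow_eq_zero p f, mul_zero]
    rw [Finset.mem_range, not_lt] at hj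
    omega

theorem hasSum_zcoeff_mul (f g : PowerSeries K) (l : ℤ) :
    HasSum (fun b : ℤ => zcoeff f (l - b) * zcoeff g b) (zcoeff (f * g) l) := by
  by_cases hl : l < 0
  · rw [zcoeff_of_neg _ hl]
    have h : (fun b : ℤ => zcoeff f (l - b) * zcoeff g b) = fun _ => 0 := by
      funext b
      by_cases hb : b < 0
      · rw [zcoeff_of_neg g hb, mul_zero]
      · rw [zcoeff_of_neg f (by linarith), zero_mul]
    rw [h]
    exact hasSum_zero
  · obtain ⟨m, rfl⟩ : ∃ m : ℕ, l = m := ⟨l.toNat, by omega⟩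
    rw [zcoeff_natCast, mul_comm f g, PowerSeries.coeff_mul,
      Finset.Nat.sum_antidiagonal_eq_sum_range_succ_mk]
    have hsum : ∑ k ∈ Finset.range (m + 1),
        PowerSeries.coeff k g * PowerSeries.coeff (m - k) f =
        ∑ b ∈ (Finset.range (m + 1)).map ⟨((↑) : ℕ → ℤ), Nat.cast_injective⟩,
          zcoeff f (m - b) * zcoeff g b := by
      rw [Finset.sum_map]
      refine Finset.sum_congr rfl fun k hk => ?_
      rw [Finset.mem_range] at hk
      have : (m : ℤ) - k = ((m - k : ℕ) : ℤ) := by omega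
      simp only [Function.Embedding.coeFn_mk]
      rw [this, zcoeff_natCast, zcoeff_natCast, mul_comm]
    simp only
    rw [hsum]
    refine hasSum_sum_of_ne_finset_zero fun b hb => ?_
    by_cases hb0 : b < 0
    · rw [zcoeff_of_neg g hb0, mul_zero]
    · rw [zcoeff_of_neg f, zero_mul]
      by_contra hle
      refine hb (Finset.mem_map.2 ⟨b.toNat, Finset.mem_range.2 (by omega), ?_⟩)
      simp only [Function.Embedding.coeFn_mk]
      omega

theorem zcoeff_expand_mul (f : PowerSeries K) (a : ℤ) :
    zcoeff (PowerSeries.expand p hp.out.ne_zero f) (p * a) = zcoeff f a := by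
  have hp0 : (0 : ℤ) < p := by exact_mod_cast hp.out.pos
  by_cases ha : a < 0
  · rw [zcoeff_of_neg f ha, zcoeff_of_neg _ (mul_neg_of_pos_of_neg hp0 ha)]
  · obtain ⟨m, rfl⟩ : ∃ m : ℕ, a = m := ⟨a.toNat, by omega⟩
    have : (p : ℤ) * m = ((p * m : ℕ) : ℤ) := by push_cast; rfl
    rw [this, zcoeff_natCast, zcoeff_natCast, PowerSeries.coeff_expand_mul]

theorem zcoeff_expand_of_not_dvd (f : PowerSeries K) {b : ℤ} (hb : ¬ (p : ℤ) ∣ b) :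
    zcoeff (PowerSeries.expand p hp.out.ne_zero f) b = 0 := by
  by_cases h : b < 0
  · exact zcoeff_of_neg _ h
  · obtain ⟨m, rfl⟩ : ∃ m : ℕ, b = m := ⟨b.toNat, by omega⟩
    rw [zcoeff_natCast, PowerSeries.coeff_expand_of_not_dvd]
    exact fun h => hb (by exact_mod_cast h)

theorem hasSum_zcoeff_mul_expand (f g : PowerSeries K) (l : ℤ) :
    HasSum (fun a : ℤ => zcoeff g a * zcoeff f (l - p * a))
      (zcoeff (f * PowerSeries.expand p hp.out.ne_zero g) l) := by
  have h := hasSum_zcoeff_mul f (PowerSeries.expand p hp.out.ne_zero g) l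
  have hinj : Function.Injective fun a : ℤ => (p : ℤ) * a :=
    mul_right_injective₀ (by exact_mod_cast hp.out.ne_zero)
  rw [← hinj.hasSum_iff] at h
  · convert h using 2 with a
    simp only [Function.comp_apply]
    rw [zcoeff_expand_mul, mul_comm]
  · intro b hb
    rw [zcoeff_expand_of_not_dvd, mul_zero]
    rintro ⟨a, rfl⟩
    exact hb ⟨a, rfl⟩

theorem zcoeff_rescale (c : K) (f : PowerSeries K) (l : ℤ) :
    zcoeff (PowerSeries.rescale c f) l = c ^ l * zcoeff f l := by
  by_cases hl : l < 0
  · rw [zcoeff_of_neg _ hl, zcoeff_of_neg _ hl, mul_zero]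
  · obtain ⟨m, rfl⟩ : ∃ m : ℕ, l = m := ⟨l.toNat, by omega⟩
    rw [zcoeff_natCast, zcoeff_natCast, PowerSeries.coeff_rescale, zpow_natCast]

end OneVariable

/-! ### The negative part of `q(t) θ̂_1(t)` and its Frobenius eigenvalue -/

section Eigenvalue

variable {K : Type*} [NormedField K] [IsUltrametricDist K] [CompleteSpace K] [CharZero K]
  {p : ℕ} [hp : Fact p.Prime]

/-- The coefficients of negative powers in `q(t) f(t)`. -/
def negPart (f : PowerSeries K) (l : ℤ) : K :=
  if l < 0 then ∑' b : ℤ, qfun K (l - b) * zcoeff f b else 0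

theorem norm_qfun_mul_le {f : PowerSeries K}
    (hf : ∀ m : ℕ, ‖(m.factorial : K) * zcoeff f m‖ ≤ invSqrt p ^ m) {l : ℤ} (hl : l < 0)
    (b : ℤ) : ‖qfun K (l - b) * zcoeff f b‖ ≤ geom (invSqrt p) b := by
  rw [geom]
  split_ifs with hb
  · rw [zcoeff_of_neg f hb, mul_zero, norm_zero]
  · obtain ⟨m, rfl⟩ : ∃ m : ℕ, b = m := ⟨b.toNat, by omega⟩
    rw [qfun, if_pos (by omega), mul_assoc, norm_mul, norm_pow, norm_neg, norm_one, one_pow,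
      one_mul]
    exact (norm_mul_of_dvd (Nat.factorial_dvd_factorial (by omega)) _).trans (hf m)

theorem hasSum_negPart {f : PowerSeries K}
    (hf : ∀ m : ℕ, ‖(m.factorial : K) * zcoeff f m‖ ≤ invSqrt p ^ m) {l : ℤ} (hl : l < 0) :
    HasSum (fun b : ℤ => qfun K (l - b) * zcoeff f b) (negPart f l) := by
  rw [negPart, if_pos hl]
  exact (Summable.of_norm_bounded (summable_geom invSqrt_pos.le invSqrt_lt_one)
    (norm_qfun_mul_le hf hl)).hasSum

theorem norm_negPart_le {f : PowerSeries K}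
    (hf : ∀ m : ℕ, ‖(m.factorial : K) * zcoeff f m‖ ≤ invSqrt p ^ m) (l : ℤ) : ‖negPart f l‖ ≤ 1 := by
  rw [negPart]
  split_ifs with hl
  · refine IsUltrametricDist.norm_tsum_le_of_forall_le_of_nonneg zero_le_one fun b =>
      (norm_qfun_mul_le hf hl b).trans ?_
    rw [geom]
    split_ifs
    · exact zero_le_one
    · exact pow_le_one₀ invSqrt_pos.le invSqrt_lt_one.le
  · simp

/-- The recursion satisfied by the negative part, for `f` with lacunary logarithmic derivative. -/
theorem mul_negPart {ε : ℕ → K} {f : PowerSeries K}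
    (hf : ∀ m : ℕ, ‖(m.factorial : K) * zcoeff f m‖ ≤ invSqrt p ^ m)
    (hε0 : ε 0 = 1) (hε : ∀ j, ‖ε j‖ ≤ ((p : ℝ)⁻¹) ^ (p ^ j - 1))
    (hfd : PowerSeries.X * PowerSeries.derivative K f =
      lacunary p (fun j => if j = 0 then 0 else ε j) * f) {l : ℤ} (hl : l < 0) :
    (l : K) * negPart f l = ∑' j : ℕ, ε j * negPart f (l - (p : ℤ) ^ j) := by
  set ε' : ℕ → K := fun j => if j = 0 then 0 else ε j with hε'
  have hp1 : (1 : ℝ) < p := by exact_mod_cast hp.out.one_lt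
  have hσ : Summable fun j : ℕ => ((p : ℝ)⁻¹) ^ j :=
    summable_geometric_of_lt_one (by positivity) (inv_lt_one_of_one_lt₀ hp1)
  have hεb : ∀ j, ‖ε j‖ ≤ ((p : ℝ)⁻¹) ^ j := fun j => (hε j).trans (pow_prime_pow_sub_one_le' j)
  have hε'b : ∀ j, ‖ε' j‖ ≤ ((p : ℝ)⁻¹) ^ j := fun j => by
    simp only [hε']
    split_ifs
    · rw [norm_zero]; positivity
    · exact hεb j
  have hlt : ∀ j : ℕ, l - (p : ℤ) ^ j < 0 := fun j => by
    have : (0 : ℤ) < (p : ℤ) ^ j := pow_pos (by exact_mod_cast hp.out.pos) j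
    linarith
  obtain ⟨hs1, hs2, hs3⟩ := tsum_tsum_shift
    (g := fun j b => ε' j * (qfun K (l - (p : ℤ) ^ j - b) * zcoeff f b))
    (fun j => (p : ℤ) ^ j) hσ (summable_geom invSqrt_pos.le invSqrt_lt_one)
    (fun j => by positivity) (geom_nonneg invSqrt_pos.le) (fun j b => by
      rw [norm_mul]
      exact mul_le_mul (hε'b j) (norm_qfun_mul_le hf (hlt j) b) (norm_nonneg _) (by positivity))
  have hterm : ∀ b : ℤ, (l : K) * (qfun K (l - b) * zcoeff f b) =
      qfun K (l - 1 - b) * zcoeff f b + ∑' j : ℕ,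
        ε' j * (qfun K (l - (p : ℤ) ^ j - (b - (p : ℤ) ^ j)) * zcoeff f (b - (p : ℤ) ^ j)) := by
    intro b
    have h1 : ∑' j : ℕ, ε' j * (qfun K (l - (p : ℤ) ^ j - (b - (p : ℤ) ^ j)) *
        zcoeff f (b - (p : ℤ) ^ j)) = qfun K (l - b) * ((b : K) * zcoeff f b) := by
      rw [← (hasSum_zcoeff_of_logDeriv hfd b).tsum_eq, ← tsum_mul_left]
      refine tsum_congr fun j => ?_
      rw [sub_sub_sub_cancel_right]
      ring
    rw [h1]
    by_cases hb : b < 0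
    · rw [zcoeff_of_neg f hb]; ring
    · have h2 : l - 1 - b = l - b - 1 := by ring
      rw [h2, ← qfun_sub_one (by linarith)]
      push_cast
      ring
  have hP : ∀ j, HasSum (fun b : ℤ => qfun K (l - (p : ℤ) ^ j - b) * zcoeff f b)
      (negPart f (l - (p : ℤ) ^ j)) := fun j => hasSum_negPart hf (hlt j)
  have hsplit : ∑' j : ℕ, ε j * negPart f (l - (p : ℤ) ^ j) =
      negPart f (l - 1) + ∑' j : ℕ, ε' j * negPart f (l - (p : ℤ) ^ j) := by
    have hsum : ∀ c : ℕ → K, (∀ j, ‖c j‖ ≤ ((p : ℝ)⁻¹) ^ j) →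
        Summable fun j : ℕ => c j * negPart f (l - (p : ℤ) ^ j) := fun c hc =>
      Summable.of_norm_bounded hσ fun j => by
        rw [norm_mul]
        exact (mul_le_of_le_one_right (norm_nonneg _) (norm_negPart_le hf _)).trans (hc j)
    rw [(hsum ε hεb).tsum_eq_zero_add, (hsum ε' hε'b).tsum_eq_zero_add]
    simp [hε', hε0]
  have h0 := (hasSum_negPart hf hl).mul_left (l : K)
  rw [← h0.tsum_eq, tsum_congr hterm, Summable.tsum_add
    (hasSum_negPart hf (show l - 1 < 0 by linarith)).summable hs1, hs3, hsplit,
    (hasSum_negPart hf (show l - 1 < 0 by linarith)).tsum_eq]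
  congr 1
  exact tsum_congr fun j => ((hP j).mul_left (ε' j)).tsum_eq

/-- Bounded solutions of the recursion are determined by their first term. -/
theorem eq_zero_of_recursion {ε : ℕ → K} (hε0 : ε 0 = 1)
    (hε : ∀ j, ‖ε j‖ ≤ ((p : ℝ)⁻¹) ^ (p ^ j - 1)) {s : ℤ → K} {C : ℝ} (hC : ∀ l < 0, ‖s l‖ ≤ C)
    (h1 : s (-1) = 0)
    (hrec : ∀ l : ℤ, l < 0 → (l : K) * s l = ∑' j : ℕ, ε j * s (l - (p : ℤ) ^ j)) {l : ℤ} (hl : l < 0) :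
    s l = 0 := by
  have hp1 : (1 : ℝ) < p := by exact_mod_cast hp.out.one_lt
  have hpi : (p : ℝ)⁻¹ < 1 := inv_lt_one_of_one_lt₀ hp1
  have hpi0 : (0 : ℝ) ≤ (p : ℝ)⁻¹ := by positivity
  have hpow : ∀ j : ℕ, (0 : ℤ) < (p : ℤ) ^ j := fun j =>
    pow_pos (by exact_mod_cast hp.out.pos) j
  have hstep : ∀ C : ℝ, 0 ≤ C → (∀ l < 0, ‖s l‖ ≤ C) → ∀ l < 0, ‖s l‖ ≤ (p : ℝ)⁻¹ * C := by
    intro C hC0 hC l hl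
    obtain ⟨m, rfl⟩ : ∃ m : ℕ, l = -(m : ℤ) - 1 := ⟨(-l - 1).toNat, by omega⟩
    clear hl
    induction m with
    | zero => simpa [h1] using mul_nonneg hpi0 hC0
    | succ m ih =>
      set l : ℤ := -(m : ℤ) - 1 with hl
      have hl0 : l < 0 := by omega
      have hb : ∀ j : ℕ, ‖ε j * s (l - (p : ℤ) ^ j)‖ ≤ ((p : ℝ)⁻¹) ^ j * C := fun j => by
        rw [norm_mul]
        exact mul_le_mul ((hε j).trans (pow_prime_pow_sub_one_le' j))
          (hC _ (by linarith [hpow j])) (norm_nonneg _) (by positivity)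
      have hsum : Summable fun j : ℕ => ε j * s (l - (p : ℤ) ^ j) :=
        Summable.of_norm_bounded ((summable_geometric_of_lt_one hpi0 hpi).mul_right C) hb
      have h2 := hrec l hl0
      rw [hsum.tsum_eq_zero_add, hε0, one_mul, pow_zero] at h2
      have h3 : s (-((m + 1 : ℕ) : ℤ) - 1) = (l : K) * s l +
          -∑' j : ℕ, ε (j + 1) * s (l - (p : ℤ) ^ (j + 1)) := by
        rw [h2]
        have : -((m + 1 : ℕ) : ℤ) - 1 = l - 1 := by rw [hl]; push_cast; ring
        rw [this]
        ring
      rw [h3]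
      refine (IsUltrametricDist.norm_add_le_max _ _).trans (max_le ?_ ?_)
      · rw [norm_mul]
        exact (mul_le_of_le_one_left (norm_nonneg _)
          (IsUltrametricDist.norm_intCast_le_one K l)).trans ih
      · rw [norm_neg]
        refine IsUltrametricDist.norm_tsum_le_of_forall_le_of_nonneg (mul_nonneg hpi0 hC0)
          fun j => (hb (j + 1)).trans (mul_le_mul_of_nonneg_right ?_ hC0)
        rw [pow_succ]
        exact mul_le_of_le_one_left hpi0 (pow_le_one₀ hpi0 hpi.le)
  have hC0 : 0 ≤ C := (norm_nonneg _).trans (hC l hl)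
  have hall : ∀ k : ℕ, ∀ l < 0, ‖s l‖ ≤ ((p : ℝ)⁻¹) ^ k * C := by
    intro k
    induction k with
    | zero => simpa using hC
    | succ k ih =>
      intro l hl
      rw [pow_succ', mul_assoc]
      exact hstep _ (by positivity) ih l hl
  have hlim : Tendsto (fun k : ℕ => ((p : ℝ)⁻¹) ^ k * C) atTop (𝓝 0) := by
    simpa using (tendsto_pow_atTop_nhds_zero_of_lt_one hpi0 hpi).mul_const C
  exact norm_le_zero_iff.1 (ge_of_tendsto' hlim fun k => hall k l hl)

theorem norm_zpow_mul_le {lam : K} (hlam : ‖lam‖ = p) {x y : K} (hx : ‖x‖ ≤ 1) (hy : ‖y‖ ≤ 1)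
    {a : ℤ} (ha : a < 0) {j : ℕ} (hj : (j : ℤ) ≤ -a) :
    ‖lam ^ a * x * y‖ ≤ invSqrt p ^ j * geom (invSqrt p) (-a) := by
  obtain ⟨m, rfl⟩ : ∃ m : ℕ, a = -(m : ℤ) := ⟨(-a).toNat, by omega⟩
  have h0 := invSqrt_pos (p := p)
  rw [neg_neg, geom, if_neg (by omega), Int.toNat_natCast, norm_mul, norm_mul, norm_zpow, hlam,
    zpow_neg, zpow_natCast, ← inv_pow, ← invSqrt_sq, ← pow_mul, two_mul, pow_add]
  have h1 : invSqrt p ^ m ≤ invSqrt p ^ j :=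
    pow_le_pow_of_le_one h0.le invSqrt_lt_one.le (by omega)
  have h2 : ‖x‖ * ‖y‖ ≤ 1 := mul_le_one₀ hx (norm_nonneg _) hy
  rw [mul_assoc]
  calc _ ≤ invSqrt p ^ m * invSqrt p ^ m * 1 := by gcongr
    _ ≤ _ := by rw [mul_one]; gcongr

/-- The negative part of `q(t) θ̂_1(t)` is an eigenvector of the one-variable Frobenius, with an
eigenvalue of norm `1/p`. -/
theorem exists_eigenvalue {lam : K} (hlam : ‖lam‖ = p)
    {ε : ℕ → K} {f : PowerSeries K}
    (hf : ∀ m : ℕ, ‖(m.factorial : K) * zcoeff f m‖ ≤ invSqrt p ^ m)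
    (hf0 : PowerSeries.constantCoeff f = 1)
    (hε0 : ε 0 = 1) (hε : ∀ j, ‖ε j‖ ≤ ((p : ℝ)⁻¹) ^ (p ^ j - 1))
    (hεs : ∀ j, ε (j + 1) = 1 + p * ε j * lam ^ p ^ j)
    (hfd : PowerSeries.X * PowerSeries.derivative K f =
      lacunary p (fun j => if j = 0 then 0 else ε j) * f)
    {A : PowerSeries K} (hA : ∀ l, ‖zcoeff A l‖ ≤ 1) (hAp : ‖zcoeff A (p - 1)‖ = 1)
    (hAd : PowerSeries.X * PowerSeries.derivative K A = lacunary p (fun _ => 1) * A) :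
    ∃ κ : K, ‖κ‖ = (p : ℝ)⁻¹ ∧ ∀ l < 0,
      HasSum (fun a : ℤ => lam ^ a * negPart f a * zcoeff A (l - p * a)) (κ * negPart f l) := by
  have hp0 : (0 : ℤ) < p := by exact_mod_cast hp.out.pos
  have hp1 : (1 : ℝ) < p := by exact_mod_cast hp.out.one_lt
  have hlam0 : lam ≠ 0 := norm_ne_zero_iff.1 (by rw [hlam]; positivity)
  have hr0 := invSqrt_pos (p := p)
  have hr1 := invSqrt_lt_one (p := p)
  set P := negPart f with hP
  have hP1 : ∀ l, ‖P l‖ ≤ 1 := norm_negPart_le hf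
  have hPneg : ∀ l, 0 ≤ l → P l = 0 := fun l hl => if_neg (not_lt.2 hl)
  set β : ℤ → K := fun l => ∑' a : ℤ, lam ^ a * P a * zcoeff A (l - p * a) with hβ
  have hbound : ∀ (l a : ℤ), ‖lam ^ a * P a * zcoeff A l‖ ≤ geom (invSqrt p) (-a) := by
    intro l a
    by_cases ha : a < 0
    · simpa using norm_zpow_mul_le hlam (hP1 a) (hA l) ha (j := 0) (by simpa using ha.le)
    · rw [hPneg a (not_lt.1 ha), mul_zero, zero_mul, norm_zero]
      exact geom_nonneg hr0.le _
  have hρ := summable_geom_neg hr0.le hr1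
  have hσ := summable_geometric_of_lt_one hr0.le hr1
  have hβs : ∀ l, HasSum (fun a : ℤ => lam ^ a * P a * zcoeff A (l - p * a)) (β l) := fun l =>
    (Summable.of_norm_bounded hρ fun a => hbound _ a).hasSum
  have hβ1 : ∀ l, ‖β l‖ ≤ 1 := fun l =>
    IsUltrametricDist.norm_tsum_le_of_forall_le_of_nonneg zero_le_one fun a =>
      (hbound _ a).trans (by
        rw [geom]; split_ifs
        · exact zero_le_one
        · exact pow_le_one₀ hr0.le hr1.le)
  have hPrec : ∀ a : ℤ, a < 0 → (a : K) * P a = ∑' j : ℕ, ε j * P (a - (p : ℤ) ^ j) :=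
    fun a ha => mul_negPart hf hε0 hε hfd ha
  have hsupp : ∀ (l a : ℤ) (j : ℕ), (0 ≤ l - p * a → a < 0 ∧ (j : ℤ) ≤ -a) →
      ‖lam ^ a * P a * zcoeff A (l - p * a)‖ ≤ invSqrt p ^ j * geom (invSqrt p) (-a) := by
    intro l a j hj
    by_cases hA0 : zcoeff A (l - p * a) = 0
    · rw [hA0, mul_zero, norm_zero]
      exact mul_nonneg (by positivity) (geom_nonneg hr0.le _)
    · obtain ⟨h1, h2⟩ := hj (not_lt.1 fun h => hA0 (zcoeff_of_neg A h))
      exact norm_zpow_mul_le hlam (hP1 a) (hA _) h1 h2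
  have hεlam : ∀ j, ‖(p : K) * ε j * lam ^ p ^ j‖ ≤ 1 := fun j => by
    have h : (p : K) * ε j * lam ^ p ^ j = ε (j + 1) + -1 := by rw [hεs]; ring
    rw [h]
    refine (IsUltrametricDist.norm_add_le_max _ _).trans (max_le ?_ (by simp))
    exact (hε _).trans (pow_le_one₀ (by positivity) (inv_lt_one_of_one_lt₀ hp1).le)
  have hβrec : ∀ l : ℤ, l < 0 → (l : K) * β l = ∑' j : ℕ, ε j * β (l - (p : ℤ) ^ j) := by
    intro l hl
    have hpow : ∀ j : ℕ, (j : ℤ) < (p : ℤ) ^ j := fun j => by exact_mod_cast lt_prime_pow p j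
    obtain ⟨ha1, ha2, ha3⟩ := tsum_tsum_shift
      (g := fun j a => ((p : K) * ε j * lam ^ p ^ j) *
        (lam ^ a * P a * zcoeff A (l - (p : ℤ) ^ (j + 1) - p * a)))
      (fun j => (p : ℤ) ^ j) hσ hρ (fun j => by positivity) (fun b => geom_nonneg hr0.le _)
      (fun j a => by
        rw [norm_mul]
        refine (mul_le_of_le_one_left (norm_nonneg _) (hεlam j)).trans (hsupp _ a j fun h => ?_)
        have := hpow j
        rw [pow_succ'] at h
        constructor <;> nlinarith)
    obtain ⟨hb1, hb2, hb3⟩ := tsum_tsum_shift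
      (g := fun j a => lam ^ a * P a * zcoeff A (l - (p : ℤ) ^ j - p * a))
      (fun _ => 0) hσ hρ (fun j => by positivity) (fun b => geom_nonneg hr0.le _)
      (fun j a => hsupp _ a j fun h => by
        cases j with
        | zero =>
          simp only [pow_zero] at h
          constructor <;> push_cast <;> nlinarith
        | succ j =>
          have := hpow j
          rw [pow_succ'] at h
          push_cast
          constructor <;> nlinarith)
    have hterm : ∀ a : ℤ, (l : K) * (lam ^ a * P a * zcoeff A (l - p * a)) =
        (∑' j : ℕ, ((p : K) * ε j * lam ^ p ^ j) * (lam ^ (a - (p : ℤ) ^ j) * P (a - (p : ℤ) ^ j) *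
          zcoeff A (l - (p : ℤ) ^ (j + 1) - p * (a - (p : ℤ) ^ j)))) +
        ∑' j : ℕ, lam ^ (a - 0) * P (a - 0) * zcoeff A (l - (p : ℤ) ^ j - p * (a - 0)) := by
      intro a
      have e1 : ∑' j : ℕ, lam ^ (a - 0) * P (a - 0) * zcoeff A (l - (p : ℤ) ^ j - p * (a - 0)) =
          lam ^ a * P a * (((l - p * a : ℤ) : K) * zcoeff A (l - p * a)) := by
        rw [← (hasSum_zcoeff_of_logDeriv hAd (l - p * a)).tsum_eq, ← tsum_mul_left]
        refine tsum_congr fun j => ?_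
        rw [sub_zero, one_mul, sub_right_comm]
      have e2 : ∑' j : ℕ, ((p : K) * ε j * lam ^ p ^ j) *
          (lam ^ (a - (p : ℤ) ^ j) * P (a - (p : ℤ) ^ j) *
          zcoeff A (l - (p : ℤ) ^ (j + 1) - p * (a - (p : ℤ) ^ j))) =
          (p : K) * lam ^ a * zcoeff A (l - p * a) * ∑' j : ℕ, ε j * P (a - (p : ℤ) ^ j) := by
        rw [← tsum_mul_left]
        refine tsum_congr fun j => ?_
        have h1 : l - (p : ℤ) ^ (j + 1) - p * (a - (p : ℤ) ^ j) = l - p * a := by ring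
        have h2 : lam ^ a = lam ^ p ^ j * lam ^ (a - (p : ℤ) ^ j) := by
          rw [← zpow_natCast lam (p ^ j), ← zpow_add₀ hlam0]
          congr 1
          push_cast
          ring
        rw [h1, h2]
        ring
      rw [e1, e2]
      by_cases ha : a < 0
      · rw [← hPrec a ha]
        push_cast
        ring
      · rw [zcoeff_of_neg A (show l - p * a < 0 by nlinarith)]
        ring
    have hga : ∀ j : ℕ, ∑' a : ℤ, ((p : K) * ε j * lam ^ p ^ j) *
        (lam ^ a * P a * zcoeff A (l - (p : ℤ) ^ (j + 1) - p * a)) =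
        ((p : K) * ε j * lam ^ p ^ j) * β (l - (p : ℤ) ^ (j + 1)) := fun j => tsum_mul_left
    simp only [hga] at ha2 ha3
    have hb2' : Summable fun j : ℕ => β (l - (p : ℤ) ^ j) := hb2
    have hb2s : Summable fun j : ℕ => β (l - (p : ℤ) ^ (j + 1)) :=
      (summable_nat_add_iff (f := fun j : ℕ => β (l - (p : ℤ) ^ j)) 1).2 hb2'
    have hfin : Summable fun j : ℕ => ε j * β (l - (p : ℤ) ^ j) := by
      rw [← summable_nat_add_iff 1]
      refine (ha2.add hb2s).congr fun j => ?_
      rw [hεs]; ring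
    rw [← ((hβs l).mul_left (l : K)).tsum_eq, tsum_congr hterm, Summable.tsum_add ha1 hb1, ha3, hb3,
      hfin.tsum_eq_zero_add, hb2'.tsum_eq_zero_add, hε0, one_mul]
    change _ + (β _ + ∑' j : ℕ, β _) = _
    rw [add_left_comm, ← Summable.tsum_add ha2 hb2s]
    congr 1
    refine tsum_congr fun j => ?_
    rw [hεs]; ring
  have hPm1 : ‖P (-1)‖ = 1 := by
    have h1 := hasSum_negPart hf (show (-1 : ℤ) < 0 by norm_num)
    have h2 : ‖P (-1) - 1‖ ≤ invSqrt p := by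
      have h3 := h1.sub (hasSum_ite_eq (0 : ℤ) (1 : K))
      rw [hP, ← h3.tsum_eq]
      refine IsUltrametricDist.norm_tsum_le_of_forall_le_of_nonneg hr0.le fun b => ?_
      by_cases hb : b = 0
      · subst hb
        have : zcoeff f 0 = 1 := by simp [zcoeff, hf0]
        simp [this, qfun, hr0.le]
      · rw [if_neg hb, sub_zero]
        refine (norm_qfun_mul_le hf (by norm_num) b).trans ?_
        rw [geom]
        split_ifs with hb0
        · exact hr0.le
        · exact pow_le_of_le_one hr0.le hr1.le (by omega)
    have h4 : P (-1) = 1 + (P (-1) - 1) := by ring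
    rw [h4, IsUltrametricDist.norm_add_eq_max_of_norm_ne_norm]
    · rw [norm_one, max_eq_left (h2.trans hr1.le)]
    · rw [norm_one]; exact (h2.trans_lt hr1).ne'
  have hβm1 : ‖β (-1)‖ = (p : ℝ)⁻¹ := by
    set x : K := lam ^ (-1 : ℤ) * P (-1) * zcoeff A (-1 - p * (-1)) with hx
    have hxn : ‖x‖ = (p : ℝ)⁻¹ := by
      have : (-1 : ℤ) - p * (-1) = p - 1 := by ring
      rw [hx, this, norm_mul, norm_mul, hAp, hPm1, norm_zpow, hlam]
      simp
    have h3 := (hβs (-1)).sub (hasSum_ite_eq (-1 : ℤ) x)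
    have h2 : ‖β (-1) - x‖ ≤ ((p : ℝ)⁻¹) ^ 2 := by
      rw [← h3.tsum_eq]
      refine IsUltrametricDist.norm_tsum_le_of_forall_le_of_nonneg (by positivity) fun a => ?_
      by_cases ha : a = -1
      · subst ha
        simp [hx]
      · rw [if_neg ha, sub_zero]
        by_cases ha0 : 0 ≤ a
        · rw [hPneg a ha0]; simp
        obtain ⟨m, rfl⟩ : ∃ m : ℕ, a = -((m + 2 : ℕ) : ℤ) := ⟨(-a - 2).toNat, by omega⟩
        rw [norm_mul, norm_mul, norm_zpow, hlam, zpow_neg, zpow_natCast, ← inv_pow, mul_assoc]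
        refine (mul_le_of_le_one_right (by positivity)
          (mul_le_one₀ (hP1 _) (norm_nonneg _) (hA _))).trans ?_
        exact pow_le_pow_of_le_one (by positivity) (inv_lt_one_of_one_lt₀ hp1).le (by omega)
    have hlt : ((p : ℝ)⁻¹) ^ 2 < (p : ℝ)⁻¹ := by
      have h5 := inv_lt_one_of_one_lt₀ hp1
      have h6 : (0 : ℝ) < (p : ℝ)⁻¹ := by positivity
      nlinarith
    have h4 : β (-1) = x + (β (-1) - x) := by ring
    rw [h4, IsUltrametricDist.norm_add_eq_max_of_norm_ne_norm]
    · rw [hxn, max_eq_left (h2.trans hlt.le)]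
    · rw [hxn]; exact (h2.trans_lt hlt).ne'
  have hPne : P (-1) ≠ 0 := norm_ne_zero_iff.1 (by rw [hPm1]; exact one_ne_zero)
  refine ⟨β (-1) / P (-1), by rw [norm_div, hPm1, hβm1, div_one], fun l hl => ?_⟩
  set κ := β (-1) / P (-1) with hκ
  have hκ1 : ‖κ‖ ≤ 1 := by
    rw [hκ, norm_div, hPm1, hβm1, div_one]
    exact (inv_lt_one_of_one_lt₀ hp1).le
  have hεb : ∀ j, ‖ε j‖ ≤ ((p : ℝ)⁻¹) ^ j := fun j => (hε j).trans (pow_prime_pow_sub_one_le' j)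
  have hsum : ∀ (c : ℤ → K), (∀ l, ‖c l‖ ≤ 1) → ∀ l : ℤ,
      Summable fun j : ℕ => ε j * c (l - (p : ℤ) ^ j) := fun c hc l =>
    Summable.of_norm_bounded (summable_geometric_of_lt_one (by positivity)
      (inv_lt_one_of_one_lt₀ hp1)) fun j => by
        rw [norm_mul]
        exact (mul_le_of_le_one_right (norm_nonneg _) (hc _)).trans (hεb j)
  have hz := eq_zero_of_recursion hε0 hε (s := fun l => β l - κ * P l) (C := 1)
    (fun l _ => by
      rw [sub_eq_add_neg]
      refine (IsUltrametricDist.norm_add_le_max _ _).trans (max_le (hβ1 l) ?_)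
      rw [norm_neg, norm_mul]
      exact mul_le_one₀ hκ1 (norm_nonneg _) (hP1 l))
    (by simp only [hκ]; rw [div_mul_cancel₀ _ hPne, sub_self])
    (fun l hl => by
      rw [mul_sub, hβrec l hl, mul_left_comm, hPrec l hl, ← tsum_mul_left,
        ← Summable.tsum_sub (hsum β hβ1 l) ((hsum P hP1 l).mul_left κ)]
      exact tsum_congr fun j => by ring) hl
  rw [← sub_eq_zero.1 hz]
  exact hβs l

end Eigenvalue

/-! ### The series `θ̂_1`, `θ̂` and the Artin–Hasse series over `ℂ_p` -/

section Theta

variable {p : ℕ} [hp : Fact p.Prime]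

theorem norm_prime : ‖(p : ℂ_[p])‖ = (p : ℝ)⁻¹ := by
  have h := PadicComplex.norm_extends' p (p : ℚ_[p])
  rw [Padic.norm_p] at h
  rw [← h]
  congr 1
  rw [← map_natCast (algebraMap ℚ_[p] ℂ_[p])]
  rfl

/-- The normalised coefficients `p^j γ_j / γ^{p^j}`. -/
def gamNorm (γ : ℂ_[p]) (j : ℕ) : ℂ_[p] := (p : ℂ_[p]) ^ j * gam γ j / γ ^ p ^ j

/-- `γ^{-(p-1)}`. -/
def lamb (γ : ℂ_[p]) : ℂ_[p] := (γ ^ (p - 1))⁻¹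

variable {γ : ℂ_[p]}

theorem prime_ne_zero : (p : ℂ_[p]) ≠ 0 := by exact_mod_cast hp.out.ne_zero

theorem IsGamma.norm_lamb (hγ : IsGamma γ) : ‖lamb γ‖ = p := by
  rw [lamb, norm_inv, norm_pow, hγ.1, inv_inv]

theorem IsGamma.ne_zero (hγ : IsGamma γ) : γ ≠ 0 := by
  rintro rfl
  have h := hγ.1
  have h1 : p - 1 ≠ 0 := by have := hp.out.two_le; omega
  rw [norm_zero, zero_pow h1] at h
  have : (0 : ℝ) < (p : ℝ)⁻¹ := inv_pos.2 (by exact_mod_cast hp.out.pos)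
  exact this.ne h

theorem gamNorm_zero (hγ : IsGamma γ) : gamNorm γ 0 = 1 := by
  simp [gamNorm, gam, hγ.ne_zero]

theorem gamNorm_succ (hγ : IsGamma γ) (j : ℕ) :
    gamNorm γ (j + 1) = 1 + p * gamNorm γ j * lamb γ ^ p ^ j := by
  have h0 := hγ.ne_zero
  have hp0 : (p : ℂ_[p]) ≠ 0 := prime_ne_zero
  have h1 : gam γ (j + 1) = gam γ j + γ ^ p ^ (j + 1) / (p : ℂ_[p]) ^ (j + 1) :=
    Finset.sum_range_succ _ _
  have h2 : γ ^ p ^ (j + 1) = γ ^ p ^ j * (γ ^ (p - 1)) ^ p ^ j := by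
    rw [← pow_mul, ← pow_add]
    congr 1
    obtain ⟨q, hq⟩ : ∃ q, p = q + 1 := ⟨p - 1, by have := hp.out.pos; omega⟩
    rw [pow_succ]
    conv_rhs => rw [show p - 1 = q by omega]
    conv_lhs => rw [show p ^ j * p = p ^ j * (q + 1) by rw [← hq]]
    ring
  rw [gamNorm, gamNorm, lamb, h1, mul_add, mul_div_cancel₀ _ (pow_ne_zero _ hp0), add_div,
    div_self (pow_ne_zero _ h0), add_comm, h2, inv_pow]
  congr 1
  have h3 : (γ ^ (p - 1)) ^ p ^ j ≠ 0 := pow_ne_zero _ (pow_ne_zero _ h0)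
  field_simp
  ring

theorem norm_gamma_pow (hγ : IsGamma γ) (j : ℕ) :
    ‖γ‖ ^ p ^ (j + 1) = ‖γ‖ ^ p ^ j * ((p : ℝ)⁻¹) ^ p ^ j := by
  rw [← hγ.1, ← pow_mul, ← pow_add]
  congr 1
  obtain ⟨q, hq⟩ : ∃ q, p = q + 1 := ⟨p - 1, by have := hp.out.pos; omega⟩
  rw [pow_succ]
  conv_rhs => rw [show p - 1 = q by omega]
  conv_lhs => rw [show p ^ j * p = p ^ j * (q + 1) by rw [← hq]]
  ring

theorem norm_gamNorm_le (hγ : IsGamma γ) (j : ℕ) :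
    ‖gamNorm γ j‖ ≤ ((p : ℝ)⁻¹) ^ (p ^ j - 1) := by
  have hp1 : (1 : ℝ) < p := by exact_mod_cast hp.out.one_lt
  have hpi : (p : ℝ)⁻¹ ≤ 1 := (inv_lt_one_of_one_lt₀ hp1).le
  have hγ0 : 0 < ‖γ‖ := norm_pos_iff.2 hγ.ne_zero
  set a : ℕ → ℝ := fun i => ‖γ ^ p ^ i / (p : ℂ_[p]) ^ i‖ with ha
  have hav : ∀ i, a i = ‖γ‖ ^ p ^ i * (p : ℝ) ^ i := fun i => by
    simp only [ha]
    rw [norm_div, norm_pow, norm_pow, norm_prime, inv_pow, div_inv_eq_mul]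
  have hanti : Antitone a := antitone_nat_of_succ_le fun i => by
    rw [hav, hav, norm_gamma_pow hγ, pow_succ, mul_assoc]
    refine mul_le_mul_of_nonneg_left ?_ (by positivity)
    rw [← mul_assoc, mul_comm, ← mul_assoc]
    refine mul_le_of_le_one_left (by positivity) ?_
    calc (p : ℝ) * (p : ℝ)⁻¹ ^ p ^ i ≤ (p : ℝ) * (p : ℝ)⁻¹ ^ 1 := by
          refine mul_le_mul_of_nonneg_left ?_ (by positivity)
          exact pow_le_pow_of_le_one (by positivity) hpi (Nat.one_le_pow _ _ hp.out.pos)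
      _ = 1 := by rw [pow_one, mul_inv_cancel₀ (by positivity)]
  have hgam : ‖gam γ j‖ ≤ a (j + 1) := by
    have h1 := (hasSum_nat_add_iff' (f := fun i : ℕ => γ ^ p ^ i / (p : ℂ_[p]) ^ i) (j + 1)).2 hγ.2
    have h2 : gam γ j = -∑' i : ℕ, γ ^ p ^ (i + (j + 1)) / (p : ℂ_[p]) ^ (i + (j + 1)) := by
      rw [h1.tsum_eq, zero_sub, neg_neg]
      rfl
    rw [h2, norm_neg]
    exact IsUltrametricDist.norm_tsum_le_of_forall_le_of_nonneg (norm_nonneg _) fun i =>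
      hanti (by omega)
  have hpj : 1 ≤ p ^ j := Nat.one_le_pow _ _ hp.out.pos
  rw [gamNorm, norm_div, norm_mul, norm_pow, norm_pow, norm_prime,
    div_le_iff₀ (by positivity)]
  calc (p : ℝ)⁻¹ ^ j * ‖gam γ j‖ ≤ (p : ℝ)⁻¹ ^ j * a (j + 1) := by gcongr
    _ = (p : ℝ)⁻¹ ^ (p ^ j - 1) * ‖γ‖ ^ p ^ j := by
      rw [hav, norm_gamma_pow hγ]
      obtain ⟨m, hm⟩ : ∃ m, p ^ j = m + 1 := ⟨p ^ j - 1, by omega⟩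
      rw [hm, Nat.add_sub_cancel, pow_succ ((p : ℝ)⁻¹) m, pow_succ (p : ℝ) j, inv_pow]
      field_simp

/-- The series with coefficients `θ̂_{1,m} / m!`. -/
def thetaOne (γ : ℂ_[p]) : PowerSeries ℂ_[p] := PowerSeries.rescale γ⁻¹ (thetaHat γ)

theorem thetaHat_eq (γ : ℂ_[p]) : thetaHat γ =
    (PowerSeries.exp ℂ_[p]).subst (lacunary p fun j => if j = 0 then 0 else gam γ j) := by
  rw [thetaHat]
  congr 1
  ext m
  rw [lacunary, PowerSeries.coeff_mk, PowerSeries.coeff_mk]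
  have h : Finset.Icc 1 m ⊆ Finset.range (m + 1) := fun j hj => by
    rw [Finset.mem_Icc] at hj
    rw [Finset.mem_range]; omega
  rw [← Finset.sum_subset h]
  · refine Finset.sum_congr rfl fun j hj => ?_
    rw [Finset.mem_Icc] at hj
    rw [if_neg (show j ≠ 0 by omega)]
  · intro j hj hj'
    rw [Finset.mem_range] at hj
    rw [Finset.mem_Icc] at hj'
    rw [if_pos (show j = 0 by omega), ite_self]

theorem constantCoeff_thetaOne (γ : ℂ_[p]) : PowerSeries.constantCoeff (thetaOne γ) = 1 := by
  rw [thetaOne, ← PowerSeries.coeff_zero_eq_constantCoeff_apply, PowerSeries.coeff_rescale,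
    pow_zero, one_mul, PowerSeries.coeff_zero_eq_constantCoeff_apply, thetaHat_eq,
    constantCoeff_exp_subst (constantCoeff_lacunary p _)]

theorem logDeriv_thetaOne (γ : ℂ_[p]) :
    PowerSeries.X * PowerSeries.derivative ℂ_[p] (thetaOne γ) =
      lacunary p (fun j => if j = 0 then 0 else gamNorm γ j) * thetaOne γ := by
  have h := logDeriv_exp_subst (constantCoeff_lacunary p fun j => if j = 0 then 0 else gam γ j)
  rw [← thetaHat_eq, X_mul_derivative_lacunary] at h
  have h2 := logDeriv_rescale γ⁻¹ h
  rw [rescale_lacunary] at h2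
  rw [thetaOne, h2]
  congr 2
  funext j
  split_ifs
  · simp
  · rw [gamNorm, inv_pow]; ring

theorem norm_thetaOne_le (hγ : IsGamma γ) (m : ℕ) :
    ‖(m.factorial : ℂ_[p]) * zcoeff (thetaOne γ) m‖ ≤ invSqrt p ^ m :=
  norm_factorial_mul_le (ε := fun j => if j = 0 then 0 else gamNorm γ j) (by simp)
    (fun j => by
      split_ifs
      · rw [norm_zero]; positivity
      · exact norm_gamNorm_le hγ j) (constantCoeff_thetaOne γ) (logDeriv_thetaOne γ) m

theorem thetaNum_div (γ : ℂ_[p]) (m : ℕ) :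
    thetaNum γ m / (m.factorial : ℂ_[p]) = zcoeff (thetaOne γ) m := by
  have hm : (m.factorial : ℂ_[p]) ≠ 0 := by exact_mod_cast m.factorial_ne_zero
  rw [thetaNum, zcoeff_natCast, thetaOne, PowerSeries.coeff_rescale, inv_pow]
  field_simp

variable (p) in
/-- The Artin–Hasse exponential over `ℂ_p`. -/
def artinHasseC : PowerSeries ℂ_[p] := (artinHasse p).map (algebraMap ℚ_[p] ℂ_[p])

theorem logDeriv_artinHasseC :
    PowerSeries.X * PowerSeries.derivative ℂ_[p] (artinHasseC p) =
      lacunary p (fun _ => 1) * artinHasseC p := by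
  rw [artinHasseC, logDeriv_map (algebraMap ℚ_[p] ℂ_[p]) (logDeriv_artinHasse p), map_lacunary]
  simp

theorem constantCoeff_artinHasseC : PowerSeries.constantCoeff (artinHasseC p) = 1 := by
  rw [artinHasseC, ← PowerSeries.coeff_zero_eq_constantCoeff_apply, PowerSeries.coeff_map,
    PowerSeries.coeff_zero_eq_constantCoeff_apply, constantCoeff_artinHasse, map_one]

theorem norm_artinHasseC_le (l : ℤ) : ‖zcoeff (artinHasseC p) l‖ ≤ 1 := by
  rw [zcoeff]
  split_ifs
  · simp
  · rw [artinHasseC, PowerSeries.coeff_map]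
    exact (PadicComplex.norm_extends' p _).trans_le (norm_coeff_artinHasse_le p _)

theorem artinHasseC_of_lt {m : ℕ} (hm : m < p) :
    zcoeff (artinHasseC p) m = (m.factorial : ℂ_[p])⁻¹ := by
  induction m with
  | zero => simp [zcoeff, constantCoeff_artinHasseC]
  | succ m ih =>
    have h := sum_zcoeff_of_logDeriv p (logDeriv_artinHasseC (p := p)) (m + 1)
    rw [Finset.sum_range_succ', Finset.sum_eq_zero] at h
    · have h1 : ((m + 1 : ℕ) : ℤ) - (p : ℤ) ^ 0 = (m : ℤ) := by simp
      rw [h1, ih (by omega), one_mul, zero_add] at h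
      have h2 : ((m + 1 : ℕ) : ℂ_[p]) ≠ 0 := by exact_mod_cast Nat.succ_ne_zero m
      rw [Nat.factorial_succ, Nat.cast_mul, mul_inv, ← h, inv_mul_cancel_left₀ h2]
    · intro j _
      rw [zcoeff_of_neg, mul_zero]
      have h1 : p ^ 1 ≤ p ^ (j + 1) := Nat.pow_le_pow_right hp.out.pos (by omega)
      have h2 : ((m + 1 : ℕ) : ℤ) < (p : ℤ) ^ (j + 1) := by
        exact_mod_cast (hm.trans_le (by simpa using h1))
      linarith

/-- The series `θ̂`, normalised. -/
def thetaFull (γ : ℂ_[p]) : PowerSeries ℂ_[p] := PowerSeries.exp ℂ_[p] * thetaOne γ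

theorem logDeriv_thetaFull (hγ : IsGamma γ) :
    PowerSeries.X * PowerSeries.derivative ℂ_[p] (thetaFull γ) =
      lacunary p (gamNorm γ) * thetaFull γ := by
  rw [thetaFull, logDeriv_mul logDeriv_exp (logDeriv_thetaOne γ), ← lacunary_single_zero p,
    lacunary_add]
  congr 2
  funext j
  by_cases hj : j = 0
  · simp [hj, gamNorm_zero hγ]
  · simp [hj]

theorem constantCoeff_thetaFull : PowerSeries.constantCoeff (thetaFull γ) = 1 := by
  rw [thetaFull, map_mul, constantCoeff_thetaOne]
  simp

/-- The identity `θ̂(t) = θ(t) θ̂(t^p)`. -/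
theorem thetaFull_eq (hγ : IsGamma γ) : thetaFull γ = artinHasseC p *
    PowerSeries.expand p hp.out.ne_zero (PowerSeries.rescale (lamb γ) (thetaFull γ)) := by
  refine eq_of_logDeriv_eq (constantCoeff_lacunary p _) (logDeriv_thetaFull hγ) ?_ ?_
  · rw [logDeriv_mul logDeriv_artinHasseC (logDeriv_expand p hp.out.ne_zero
      (logDeriv_rescale (lamb γ) (logDeriv_thetaFull hγ))), rescale_lacunary, expand_lacunary,
      natCast_mul_lacunary, lacunary_add]
    congr 2
    funext j
    cases j with
    | zero => simp [gamNorm_zero hγ]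
    | succ j =>
      rw [gamNorm_succ hγ]
      simp
      ring
  · rw [constantCoeff_thetaFull, map_mul, constantCoeff_artinHasseC,
      PowerSeries.constantCoeff_expand, ← PowerSeries.coeff_zero_eq_constantCoeff_apply,
      PowerSeries.coeff_rescale, PowerSeries.coeff_zero_eq_constantCoeff_apply,
      constantCoeff_thetaFull]
    simp

theorem hasSum_thetaFull_frob (hγ : IsGamma γ) (l : ℤ) :
    HasSum (fun a : ℤ => lamb γ ^ a * zcoeff (thetaFull γ) a * zcoeff (artinHasseC p) (l - p * a))
      (zcoeff (thetaFull γ) l) := by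
  have h := hasSum_zcoeff_mul_expand (p := p) (artinHasseC p)
    (PowerSeries.rescale (lamb γ) (thetaFull γ)) l
  rw [← thetaFull_eq hγ] at h
  simpa only [zcoeff_rescale] using h

theorem hasSum_thetaFull (γ : ℂ_[p]) (l : ℤ) :
    HasSum (fun b : ℤ => zcoeff (PowerSeries.exp ℂ_[p]) (l - b) * zcoeff (thetaOne γ) b)
      (zcoeff (thetaFull γ) l) :=
  hasSum_zcoeff_mul _ _ l

theorem zcoeff_exp (m : ℕ) :
    zcoeff (PowerSeries.exp ℂ_[p]) m = (m.factorial : ℂ_[p])⁻¹ := by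
  rw [zcoeff_natCast, PowerSeries.coeff_exp]
  simp

theorem exists_frobenius_eigenvalue (hγ : IsGamma γ) :
    ∃ κ : ℂ_[p], ‖κ‖ = (p : ℝ)⁻¹ ∧ ∀ l < 0, HasSum (fun a : ℤ =>
      lamb γ ^ a * negPart (thetaOne γ) a * zcoeff (artinHasseC p) (l - p * a))
      (κ * negPart (thetaOne γ) l) := by
  refine exists_eigenvalue hγ.norm_lamb (norm_thetaOne_le hγ) (constantCoeff_thetaOne γ)
    (gamNorm_zero hγ) (norm_gamNorm_le hγ) (gamNorm_succ hγ) (logDeriv_thetaOne γ)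
    norm_artinHasseC_le ?_ logDeriv_artinHasseC
  have h : ((p : ℤ) - 1) = ((p - 1 : ℕ) : ℤ) := by
    have := hp.out.pos
    omega
  have hlt : p - 1 < p := by have := hp.out.pos; omega
  rw [h, artinHasseC_of_lt hlt, norm_inv, norm_factorial_eq_one norm_prime hlt, inv_one]

end Theta

/-! ### Products of one-variable sums -/

theorem hasSum_prod_pi {K : Type*} [NormedField K] [IsUltrametricDist K]
    [CompleteSpace K] {ι : Type*} [Fintype ι] : ∀ {f : ι → ℤ → K} {s : ι → K},
    (∀ k, HasSum (f k) (s k)) → HasSum (fun m : ι → ℤ => ∏ k, f k (m k)) (∏ k, s k) := by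
  have : NonarchimedeanRing K :=
    { is_nonarchimedean := NonarchimedeanAddGroup.is_nonarchimedean }
  apply Fintype.induction_empty_option (P := fun ι [Fintype ι] => ∀ {f : ι → ℤ → K} {s : ι → K},
    (∀ k, HasSum (f k) (s k)) → HasSum (fun m : ι → ℤ => ∏ k, f k (m k)) (∏ k, s k))
  · intro α β _ e ih f s h
    let := Fintype.ofEquiv β e.symm
    have h1 := ih (f := fun a => f (e a)) (s := fun a => s (e a)) fun a => h _
    have h2 : ∏ a, s (e a) = ∏ b, s b := Fintype.prod_equiv e _ _ fun a => rfl
    rw [h2] at h1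
    rw [← (Equiv.arrowCongr e (Equiv.refl ℤ)).hasSum_iff]
    have h3 : (fun m : β → ℤ => ∏ k, f k (m k)) ∘ (Equiv.arrowCongr e (Equiv.refl ℤ)) =
        fun m : α → ℤ => ∏ a, f (e a) (m a) := by
      funext m
      exact (Fintype.prod_equiv e _ _ fun a => by simp).symm
    rw [h3]
    exact h1
  · intro f s _
    simp
  · intro α _ ih f s h
    have h2 : HasSum (fun m : α → ℤ => ∏ k, f (some k) (m k)) (∏ k, s (some k)) :=
      ih fun a => h (some a)
    have h1 := HasSum.mul_of_nonarchimedean (R := K) (h none) h2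
    rw [Fintype.prod_option]
    let e : (Option α → ℤ) ≃ ℤ × (α → ℤ) := Equiv.piOptionEquivProd
    have h3 := e.hasSum_iff.2 h1
    have h4 : (fun m : Option α → ℤ => ∏ k, f k (m k)) =
        (fun q : ℤ × (α → ℤ) => f none q.1 * ∏ k, f (some k) (q.2 k)) ∘ e := by
      funext m
      rw [Fintype.prod_option]
      rfl
    rw [h4]
    exact h3

/-! ### Degrees -/

section Degrees

variable {n d : ℕ}

theorem deg_mem_MGroup (l : Expo n d) : deg l ∈ MGroup n d :=
  sum_mem fun k _ => zsmul_mem (AddSubgroup.subset_closure (Set.mem_range_self k)) _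

theorem sum_fst_of_mem_MGroup {u : Lat n} (hu : u ∈ MGroup n d) : ∑ i, u.1 i = d * u.2 := by
  induction hu using AddSubgroup.closure_induction with
  | mem x hx =>
    obtain ⟨k, rfl⟩ := hx
    simp only [avec, mul_one]
    exact_mod_cast k.2
  | zero => simp
  | add x y _ _ hx hy => simp [Finset.sum_add_distrib, hx, hy, mul_add]
  | neg x _ hx => simp [hx]

theorem mem_NA_iff {v : Lat n} : v ∈ NA n d ↔ ∃ m : Expo n d, (∀ k, 0 ≤ m k) ∧ deg m = v := by
  constructor
  · intro hv
    induction hv using AddSubmonoid.closure_induction with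
    | mem x hx =>
      obtain ⟨k, rfl⟩ := hx
      refine ⟨Pi.single k 1, fun j => ?_, by rw [deg_single, one_smul]⟩
      by_cases h : j = k
      · subst h; simp
      · simp [Pi.single_eq_of_ne h]
    | zero => exact ⟨0, fun _ => le_rfl, deg_zero⟩
    | add x y _ _ hx hy =>
      obtain ⟨a, ha, rfl⟩ := hx
      obtain ⟨b, hb, rfl⟩ := hy
      exact ⟨a + b, fun k => add_nonneg (ha k) (hb k), deg_add a b⟩
  · rintro ⟨m, hm, rfl⟩
    refine sum_mem fun k _ => ?_
    obtain ⟨c, hc⟩ := Int.eq_ofNat_of_zero_le (hm k)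
    rw [hc, natCast_zsmul]
    exact nsmul_mem (AddSubmonoid.subset_closure (Set.mem_range_self k)) _

theorem NA_nonneg {v : Lat n} (hv : v ∈ NA n d) : (∀ i, 0 ≤ v.1 i) ∧ 0 ≤ v.2 := by
  obtain ⟨m, hm, rfl⟩ := mem_NA_iff.1 hv
  refine ⟨fun i => ?_, ?_⟩
  · rw [deg_fst]
    exact Finset.sum_nonneg fun k _ => mul_nonneg (hm k) (Int.natCast_nonneg _)
  · rw [deg_snd]
    exact Finset.sum_nonneg fun k _ => hm k

theorem NA_le_MGroup {v : Lat n} (hv : v ∈ NA n d) : v ∈ MGroup n d := by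
  obtain ⟨m, -, rfl⟩ := mem_NA_iff.1 hv
  exact deg_mem_MGroup m

theorem sub_mem_MMinus {u v : Lat n} (hu : u ∈ MMinus n d) (hv : v ∈ NA n d) :
    u - v ∈ MMinus n d := by
  obtain ⟨h1, h2⟩ := NA_nonneg hv
  refine ⟨sub_mem hu.1 (NA_le_MGroup hv), fun i => ?_, ?_⟩
  · have := hu.2.1 i; have := h1 i
    simp only [Prod.fst_sub, Pi.sub_apply]; linarith
  · have := hu.2.2
    simp only [Prod.snd_sub]; linarith

theorem deg_mem_MMinus_of_nsmul {c : ℕ} (hc : 0 < c) {u : Lat n} {a : Expo n d}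
    (hu : u ∈ MMinus n d) (h : u - c • deg a ∈ NA n d) : deg a ∈ MMinus n d := by
  have h1 : c • deg a ∈ MMinus n d := by
    have := sub_mem_MMinus hu h
    rwa [sub_sub_cancel] at this
  have hc' : (0 : ℤ) < c := by exact_mod_cast hc
  refine ⟨deg_mem_MGroup a, fun i => ?_, ?_⟩
  · have := h1.2.1 i
    change c • (deg a).1 i < 0 at this
    rw [nsmul_eq_mul] at this
    exact (pos_iff_neg_of_mul_neg this).1 hc'
  · have := h1.2.2
    change c • (deg a).2 < 0 at this
    rw [nsmul_eq_mul] at this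
    exact (pos_iff_neg_of_mul_neg this).1 hc'

theorem exists_le_sum_eq {ι : Type*} [Fintype ι] (f : ι → ℕ) {e : ℕ} (h : e ≤ ∑ i, f i) :
    ∃ b ≤ f, ∑ i, b i = e := by
  classical
  induction e with
  | zero => exact ⟨0, fun _ => Nat.zero_le _, by simp⟩
  | succ e ih =>
    obtain ⟨b, hb, hs⟩ := ih (by omega)
    obtain ⟨i, hi⟩ : ∃ i, b i < f i := by
      by_contra! hh
      have := Finset.sum_le_sum fun i (_ : i ∈ Finset.univ) => hh i
      omega
    refine ⟨b + Pi.single i 1, fun j => ?_, ?_⟩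
    · by_cases hj : j = i
      · subst hj; simpa using hi
      · simpa [Pi.single_eq_of_ne hj] using hb j
    · simp [Finset.sum_add_distrib, hs]

theorem exists_deg_eq (m : ℕ) (f : Fin (n + 1) → ℕ) (hf : ∑ i, f i = d * m) :
    ∃ c : Expo n d, (∀ k, 0 ≤ c k) ∧ deg c = (fun i => (f i : ℤ), (m : ℤ)) := by
  induction m generalizing f with
  | zero =>
    refine ⟨0, fun _ => le_rfl, ?_⟩
    rw [mul_zero, Finset.sum_eq_zero_iff] at hf
    rw [deg_zero]
    ext i
    · simp [hf i (Finset.mem_univ i)]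
    · simp
  | succ m ih =>
    obtain ⟨b, hb, hs⟩ := exists_le_sum_eq f (e := d) (by rw [hf]; nlinarith)
    obtain ⟨c, hc, hcd⟩ := ih (f - b) (by
      have : ∑ i, (f - b) i + ∑ i, b i = ∑ i, f i := by
        rw [← Finset.sum_add_distrib]
        exact Finset.sum_congr rfl fun i _ => Nat.sub_add_cancel (hb i)
      rw [hs, hf, mul_add, mul_one] at this
      omega)
    refine ⟨c + Pi.single ⟨b, hs⟩ 1, fun k => add_nonneg (hc k) ?_, ?_⟩
    · rw [Pi.single_apply]; split_ifs <;> simp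
    · rw [deg_add, hcd, deg_single, one_smul]
      ext i
      · have := hb i
        simp only [Prod.fst_add, Pi.add_apply, Pi.sub_apply, avec]
        rw [Nat.cast_sub this]; ring
      · simp [avec]

/-- `|u|`. -/
def len (u : Lat n) : ℕ := (-u.2).toNat

theorem len_pos {u : Lat n} (hu : u ∈ MMinus n d) : 0 < len u := by
  have := hu.2.2
  rw [len]; omega

theorem len_eq {u : Lat n} (hu : u ∈ MMinus n d) : (len u : ℤ) = -u.2 := by
  have := hu.2.2
  rw [len]; omega

theorem exists_deg_eq_neg {u : Lat n} (hu : u ∈ MMinus n d) :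
    ∃ c : Expo n d, (∀ k, 0 ≤ c k) ∧ deg c = -u := by
  have h := sum_fst_of_mem_MGroup hu.1
  have h2 := len_eq hu
  have h3 : ∀ i, (((-u.1 i).toNat : ℕ) : ℤ) = -u.1 i := fun i => by
    have := hu.2.1 i; omega
  obtain ⟨c, hc, hcd⟩ := exists_deg_eq (d := d) (len u) (fun i => (-u.1 i).toNat) (by
    zify
    simp only [h3, h2, Finset.sum_neg_distrib, h]
    ring)
  refine ⟨c, hc, hcd.trans ?_⟩
  ext i
  · exact h3 i
  · exact h2

theorem neg_avec_mem_MMinus (j : Inn n d) : -avec j.1 ∈ MMinus n d := by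
  refine ⟨neg_mem (AddSubgroup.subset_closure ⟨j.1, rfl⟩), fun i => ?_, ?_⟩
  · have := j.2 i
    simp only [avec, Prod.fst_neg, Pi.neg_apply]; omega
  · simp [avec]

theorem len_neg_avec (j : Mon n d) : len (-avec j) = 1 := by simp [len, avec]

theorem eq_neg_avec_of_len {u : Lat n} (hu : u ∈ MMinus n d) (h1 : len u = 1) :
    ∃ j : Inn n d, u = -avec j.1 := by
  have h := sum_fst_of_mem_MGroup hu.1
  have h2 := len_eq hu
  have h3 : ∀ i, (((-u.1 i).toNat : ℕ) : ℤ) = -u.1 i := fun i => by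
    have := hu.2.1 i; omega
  refine ⟨⟨⟨fun i => (-u.1 i).toNat, ?_⟩, fun i => ?_⟩, ?_⟩
  · zify
    simp only [h3, Finset.sum_neg_distrib, h]
    rw [h1] at h2
    rw [show u.2 = -1 by omega]; simp
  · have := hu.2.1 i
    simp only; omega
  · ext i
    · simp only [avec, Prod.fst_neg, Pi.neg_apply, h3, neg_neg]
    · simp only [avec, Prod.snd_neg]; omega

theorem finite_MMinus_len_le (K : ℕ) : {v : Lat n | v ∈ MMinus n d ∧ len v ≤ K}.Finite := by
  classical
  refine (Set.finite_Icc ((fun _ => -(d * K : ℤ), -(K : ℤ)) : Lat n) (0, 0)).subset ?_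
  rintro v ⟨hv, hK⟩
  have h := sum_fst_of_mem_MGroup hv.1
  have h2 := len_eq hv
  have h3 : -(K : ℤ) ≤ v.2 := by omega
  refine ⟨⟨fun i => ?_, h3⟩, ⟨fun i => (hv.2.1 i).le, hv.2.2.le⟩⟩
  have h4 : ∑ i, v.1 i ≤ v.1 i :=  by
    rw [← Finset.add_sum_erase _ _ (Finset.mem_univ i)]
    have : ∑ j ∈ Finset.univ.erase i, v.1 j ≤ 0 :=
      Finset.sum_nonpos fun j _ => (hv.2.1 j).le
    linarith
  have h5 : (d : ℤ) * (-(K : ℤ)) ≤ d * v.2 := mul_le_mul_of_nonneg_left h3 (by positivity)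
  simp only
  linarith

theorem finite_NA_snd_le (K : ℕ) : {v : Lat n | v ∈ NA n d ∧ v.2 ≤ K}.Finite := by
  refine ((Set.finite_Icc (0 : Expo n d) fun _ => (K : ℤ)).image deg).subset ?_
  rintro v ⟨hv, hK⟩
  obtain ⟨m, hm, rfl⟩ := mem_NA_iff.1 hv
  refine ⟨m, ⟨hm, fun k => ?_⟩, rfl⟩
  rw [deg_snd] at hK
  exact (Finset.single_le_sum (fun k _ => hm k) (Finset.mem_univ k)).trans hK

theorem eq_zero_of_snd_le_zero {v : Lat n} (hv : v ∈ NA n d) (h : v.2 ≤ 0) : v = 0 := by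
  obtain ⟨m, hm, rfl⟩ := mem_NA_iff.1 hv
  rw [deg_snd] at h
  have h0 := (Finset.sum_eq_zero_iff_of_nonneg fun k _ => hm k).1
    (le_antisymm h (Finset.sum_nonneg fun k _ => hm k))
  rw [show m = 0 from funext fun k => h0 k (Finset.mem_univ k), deg_zero]

end Degrees

/-! ### Homogeneous polynomials -/

section Homogeneous

variable {p : ℕ} [hp : Fact p.Prime] {n d : ℕ}

open Classical in
/-- The polynomial `∑ (∏ g(m_k)) Λ^m` over the `m ∈ ℕ^N` of degree `s`. -/
def prodPoly {K : Type*} [Field K] (g : ℤ → K) (s : Lat n) : LPoly K n d :=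
  ∑ m ∈ (Fintype.piFinset fun _ : Mon n d => Finset.Icc (0 : ℤ) s.2).filter (fun m => deg m = s),
    AddMonoidAlgebra.single m (∏ k, g (m k))

open Classical in
theorem coeff_prodPoly {K : Type*} [Field K] (g : ℤ → K) (s : Lat n) (l : Expo n d) :
    (prodPoly g s).coeff l = if (∀ k, 0 ≤ l k) ∧ deg l = s then ∏ k, g (l k) else 0 := by
  rw [prodPoly, AddMonoidAlgebra.coeff_sum, Finsupp.finsetSum_apply]
  simp only [AddMonoidAlgebra.coeff_single, Finsupp.single_apply]
  rw [Finset.sum_ite_eq']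
  refine if_congr ?_ rfl rfl
  rw [Finset.mem_filter, Fintype.mem_piFinset]
  simp only [Finset.mem_Icc]
  refine ⟨fun h => ⟨fun k => (h.1 k).1, h.2⟩, fun h => ⟨fun k => ⟨h.1 k, ?_⟩, h.2⟩⟩
  rw [← h.2, deg_snd]
  exact Finset.single_le_sum (fun k _ => h.1 k) (Finset.mem_univ k)

open ConvRing

variable (p n d) in
/-- The ring homomorphism from Laurent polynomials to series. -/
def polyHom : LPoly ℂ_[p] n d →+* GSer p n d :=
  AddMonoidAlgebra.liftNCRingHom (const ℂ_[p] (wt n d))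
    { toFun := fun m => mono (wt n d) m.toAdd 1
      map_one' := mono_zero_one
      map_mul' := fun a b => by rw [mono_mul_mono, one_mul]; rfl }
    (fun _ _ => mul_comm _ _)

theorem polyHom_single (m : Expo n d) (c : ℂ_[p]) :
    polyHom p n d (AddMonoidAlgebra.single m c) = mono (wt n d) m c := by
  refine (AddMonoidAlgebra.liftNC_single _ _ _ _).trans ?_
  change mono (wt n d) 0 c * mono (wt n d) m 1 = _
  rw [mono_mul_mono, zero_add, mul_one]

theorem polyHom_coe (h : LPoly ℂ_[p] n d) : (polyHom p n d h).1 = ofPoly h := by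
  classical
  induction h using AddMonoidAlgebra.induction_linear with
  | zero => rw [map_zero]; rfl
  | add a b ha hb => rw [map_add, coe_add, ha, hb]; rfl
  | single m c =>
    funext l
    rw [polyHom_single, mono_apply, ofPoly, AddMonoidAlgebra.coeff_single, Finsupp.single_apply]
    exact if_congr eq_comm rfl rfl

end Homogeneous

open ConvRing

section General

variable {K : Type*} [NormedField K] [IsUltrametricDist K] [CompleteSpace K]

theorem hasSum_congr {ι : Type*} {f g : ι → K} {a : K} (h : ∀ i, f i = g i) :
    HasSum f a ↔ HasSum g a := by
  rw [funext h]

theorem norm_hasSum_sub_le {ι : Type*} {f : ι → K} {a : K} (hf : HasSum f a) (s : Finset ι) {C : ℝ}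
    (hC : 0 ≤ C) (h : ∀ i ∉ s, ‖f i‖ ≤ C) : ‖a - ∑ i ∈ s, f i‖ ≤ C := by
  have h1 := hf.summable.sum_add_tsum_compl (s := s)
  rw [hf.tsum_eq] at h1
  rw [← h1, add_sub_cancel_left]
  exact IsUltrametricDist.norm_tsum_le_of_forall_le_of_nonneg hC fun i => h i.1 (by have := i.2; simpa only [Finset.mem_coe, Set.mem_compl_iff] using this)

theorem norm_factorial_add_sum_le {ι : Type*} (s : Finset ι) (t : ℕ) (c : ι → ℕ) :
    ‖((t + ∑ k ∈ s, c k).factorial : K)‖ ≤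
      ‖(t.factorial : K)‖ * ∏ k ∈ s, ‖((c k).factorial : K)‖ := by
  have h1 : t.factorial * ∏ k ∈ s, (c k).factorial ∣ (t + ∑ k ∈ s, c k).factorial :=
    (Nat.mul_dvd_mul_left _ (Nat.prod_factorial_dvd_factorial_sum s c)).trans
      (Nat.factorial_mul_factorial_dvd_factorial_add _ _)
  have h2 := norm_mul_of_dvd h1 (1 : K)
  simpa [norm_mul, norm_prod] using h2

/-- The product of a one-variable function at the index `i` and another one at the other
indices. -/
def starProd {ι : Type*} [Fintype ι] [DecidableEq ι] (i : ι) (f g : ℤ → K) (l : ι → ℤ) : K :=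
  ∏ k, if k = i then f (l k) else g (l k)

theorem starProd_eq {ι : Type*} [Fintype ι] [DecidableEq ι] (i : ι) (f g : ℤ → K) (l : ι → ℤ) :
    starProd i f g l = f (l i) * ∏ k ∈ Finset.univ.erase i, g (l k) := by
  rw [starProd, ← Finset.mul_prod_erase _ _ (Finset.mem_univ i), if_pos rfl]
  congr 1
  exact Finset.prod_congr rfl fun k hk => if_neg (Finset.ne_of_mem_erase hk)

theorem apply_ne_zero_of_starProd {ι : Type*} [Fintype ι] [DecidableEq ι] {i : ι} {f g : ℤ → K}
    {l : ι → ℤ} (h : starProd i f g l ≠ 0) : f (l i) ≠ 0 ∧ ∀ k, k ≠ i → g (l k) ≠ 0 := by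
  rw [starProd_eq] at h
  exact ⟨left_ne_zero_of_mul h, fun k hk => Finset.prod_ne_zero_iff.1 (right_ne_zero_of_mul h) k
    (Finset.mem_erase.2 ⟨hk, Finset.mem_univ k⟩)⟩

theorem zcoeff_ne_zero [CharZero K] {f : PowerSeries K} {l : ℤ} (h : zcoeff f l ≠ 0) : 0 ≤ l := by
  by_contra hl
  exact h (zcoeff_of_neg f (not_le.1 hl))

end General

section Series

variable {p : ℕ} [hp : Fact p.Prime] {n d : ℕ} {γ : ℂ_[p]}

theorem norm_starProd_exp_le {ι : Type*} [Fintype ι] [DecidableEq ι] (i : ι) {l : ι → ℤ} {t : ℕ}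
    (hl : ∑ k, l k = -(t + 1)) :
    ‖starProd i (qfun ℂ_[p]) (zcoeff (PowerSeries.exp ℂ_[p])) l‖ ≤ ‖(t.factorial : ℂ_[p])‖ := by
  by_cases h : starProd i (qfun ℂ_[p]) (zcoeff (PowerSeries.exp ℂ_[p])) l = 0
  · rw [h, norm_zero]; exact norm_nonneg _
  obtain ⟨-, h2⟩ := apply_ne_zero_of_starProd h
  have h3 : ∀ k, k ≠ i → ∃ c : ℕ, l k = c := fun k hk =>
    Int.eq_ofNat_of_zero_le (zcoeff_ne_zero (h2 k hk))
  choose! c hc using h3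
  rw [← Finset.add_sum_erase _ _ (Finset.mem_univ i)] at hl
  have h4 : ∑ k ∈ Finset.univ.erase i, l k = ((∑ k ∈ Finset.univ.erase i, c k : ℕ) : ℤ) := by
    push_cast
    exact Finset.sum_congr rfl fun k hk => hc k (Finset.ne_of_mem_erase hk)
  have h5 : (-l i - 1).toNat = t + ∑ k ∈ Finset.univ.erase i, c k := by omega
  have h6 : ∏ k ∈ Finset.univ.erase i, zcoeff (PowerSeries.exp ℂ_[p]) (l k) =
      ∏ k ∈ Finset.univ.erase i, ((c k).factorial : ℂ_[p])⁻¹ :=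
    Finset.prod_congr rfl fun k hk => by rw [hc k (Finset.ne_of_mem_erase hk), zcoeff_exp]
  rw [starProd_eq, qfun, if_pos (by omega), h5, h6, Finset.prod_inv_distrib, norm_mul, norm_mul,
    norm_pow, norm_neg, norm_one, one_pow, one_mul, norm_inv, ← div_eq_mul_inv, norm_prod]
  refine div_le_of_le_mul₀ (Finset.prod_nonneg fun k _ => norm_nonneg _) (norm_nonneg _) ?_
  exact norm_factorial_add_sum_le _ _ _

theorem norm_factorial_mul_prod_theta_le (hγ : IsGamma γ) {ι : Type*} [Fintype ι] (s t : ℕ)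
    {m : ι → ℤ} (hm : ∀ k, 0 ≤ m k) (ht : ∑ k, m k = t) :
    ‖((s + t).factorial : ℂ_[p]) * ∏ k, zcoeff (thetaOne γ) (m k)‖ ≤
      ‖(s.factorial : ℂ_[p])‖ * invSqrt p ^ t := by
  have h3 : ∀ k, ∃ c : ℕ, m k = c := fun k => Int.eq_ofNat_of_zero_le (hm k)
  choose c hc using h3
  have h4 : ∑ k, c k = t := by zify; rw [← ht]; exact Finset.sum_congr rfl fun k _ => (hc k).symm
  have h5 := norm_factorial_add_sum_le (K := ℂ_[p]) Finset.univ s c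
  rw [h4] at h5
  rw [norm_mul]
  refine (mul_le_mul_of_nonneg_right h5 (norm_nonneg _)).trans ?_
  rw [norm_prod, mul_assoc, ← Finset.prod_mul_distrib, ← h4, ← Finset.prod_pow_eq_pow_sum]
  refine mul_le_mul_of_nonneg_left (Finset.prod_le_prod (fun k _ => by positivity) fun k _ => ?_)
    (norm_nonneg _)
  rw [← norm_mul, hc k]
  exact norm_thetaOne_le hγ (c k)

theorem norm_starProd_mul_prod_theta_le (hγ : IsGamma γ) {ι : Type*} [Fintype ι] [DecidableEq ι]
    (i : ι) (s t : ℕ) {l m : ι → ℤ} (hm : ∀ k, 0 ≤ m k) (ht : ∑ k, m k = t)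
    (hl : ∑ k, l k = -(s + t + 1)) :
    ‖starProd i (qfun ℂ_[p]) (zcoeff (PowerSeries.exp ℂ_[p])) l *
      ∏ k, zcoeff (thetaOne γ) (m k)‖ ≤ ‖(s.factorial : ℂ_[p])‖ * invSqrt p ^ t := by
  refine le_trans ?_ (norm_factorial_mul_prod_theta_le hγ s t hm ht)
  rw [norm_mul, norm_mul]
  refine mul_le_mul_of_nonneg_right (norm_starProd_exp_le i ?_) (norm_nonneg _)
  rw [hl]; push_cast; ring

/-- The coefficients of `G^{(i)}(Λ, x)`. -/
def gCoeff (γ : ℂ_[p]) (i : Inn n d) (l : Expo n d) : ℂ_[p] :=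
  starProd i.1 (negPart (thetaOne γ)) (zcoeff (thetaFull γ)) l

theorem exists_neg_of_deg {u : Lat n} (hu : u ∈ MMinus n d) {l : Expo n d} (hl : deg l = u)
    {i : Mon n d} (hi : ¬ l i < 0) : ∃ k, k ≠ i ∧ l k < 0 := by
  by_contra! hh
  have h1 := hu.2.2
  rw [← hl, deg_snd] at h1
  refine absurd (Finset.sum_nonneg fun k _ => ?_) (not_le.2 h1)
  by_cases hk : k = i
  · rw [hk]; exact not_lt.1 hi
  · exact hh k hk

theorem negPart_of_nonneg {K : Type*} [NormedField K] (f : PowerSeries K) {l : ℤ} (hl : ¬ l < 0) :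
    negPart f l = 0 :=
  if_neg hl

theorem gCoeff_of_nonneg (γ : ℂ_[p]) (i : Inn n d) {l : Expo n d} (hl : ¬ l i.1 < 0) :
    gCoeff γ i l = 0 := by
  rw [gCoeff, starProd_eq, negPart_of_nonneg _ hl, zero_mul]

theorem hasSum_gCoeff (hγ : IsGamma γ) (i : Inn n d) {u : Lat n} (hu : u ∈ MMinus n d)
    {l : Expo n d} (hl : deg l = u) :
    HasSum (fun m : Expo n d =>
      starProd i.1 (qfun ℂ_[p]) (zcoeff (PowerSeries.exp ℂ_[p])) (l - m) *
        ∏ k, zcoeff (thetaOne γ) (m k)) (gCoeff γ i l) := by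
  by_cases hi : l i.1 < 0
  · have h := hasSum_prod_pi (K := ℂ_[p]) (f := fun (k : Mon n d) b => if k = i.1 then
        qfun ℂ_[p] (l k - b) * zcoeff (thetaOne γ) b
        else zcoeff (PowerSeries.exp ℂ_[p]) (l k - b) * zcoeff (thetaOne γ) b)
      (s := fun k => if k = i.1 then negPart (thetaOne γ) (l k) else zcoeff (thetaFull γ) (l k))
      (fun k => by
        by_cases hk : k = i.1
        · simp only [if_pos hk]
          rw [hk]
          exact hasSum_negPart (norm_thetaOne_le hγ) hi
        · simp only [if_neg hk]
          exact hasSum_thetaFull γ (l k))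
    refine (hasSum_congr fun m => ?_).1 h
    rw [starProd, ← Finset.prod_mul_distrib]
    refine Finset.prod_congr rfl fun k _ => ?_
    split_ifs <;> rfl
  · rw [gCoeff_of_nonneg γ i hi]
    refine (hasSum_congr fun m => ?_).1 hasSum_zero
    by_contra hne
    obtain ⟨k, hk, hk0⟩ := exists_neg_of_deg hu hl hi
    have h1 := zcoeff_ne_zero ((apply_ne_zero_of_starProd (left_ne_zero_of_mul (Ne.symm hne))).2 k hk)
    have h2 := zcoeff_ne_zero (Finset.prod_ne_zero_iff.1 (right_ne_zero_of_mul (Ne.symm hne)) k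
      (Finset.mem_univ k))
    rw [Pi.sub_apply] at h1
    linarith

theorem hasSum_frob_gCoeff (hγ : IsGamma γ) {κ : ℂ_[p]} (hκ : ∀ l < 0, HasSum (fun a : ℤ =>
      lamb γ ^ a * negPart (thetaOne γ) a * zcoeff (artinHasseC p) (l - p * a))
      (κ * negPart (thetaOne γ) l)) (i : Inn n d) {u : Lat n} (hu : u ∈ MMinus n d)
    {l : Expo n d} (hl : deg l = u) :
    HasSum (fun a : Expo n d => lamb γ ^ (deg a).2 * (gCoeff γ i a *
        ∏ k, zcoeff (artinHasseC p) ((l - p • a) k))) (κ * gCoeff γ i l) := by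
  have hlam : lamb γ ≠ 0 := inv_ne_zero (pow_ne_zero _ hγ.ne_zero)
  by_cases hi : l i.1 < 0
  · have h := hasSum_prod_pi (K := ℂ_[p]) (f := fun (k : Mon n d) b => if k = i.1 then
        lamb γ ^ b * negPart (thetaOne γ) b * zcoeff (artinHasseC p) (l k - p * b)
        else lamb γ ^ b * zcoeff (thetaFull γ) b * zcoeff (artinHasseC p) (l k - p * b))
      (s := fun k => if k = i.1 then κ * negPart (thetaOne γ) (l k) else zcoeff (thetaFull γ) (l k))
      (fun k => by
        by_cases hk : k = i.1
        · simp only [if_pos hk]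
          rw [hk]
          exact hκ _ hi
        · simp only [if_neg hk]
          exact hasSum_thetaFull_frob hγ (l k))
    have h2 : ∏ k, (if k = i.1 then κ * negPart (thetaOne γ) (l k) else zcoeff (thetaFull γ) (l k))
        = κ * gCoeff γ i l := by
      rw [gCoeff, starProd_eq, ← Finset.mul_prod_erase _ _ (Finset.mem_univ i.1), if_pos rfl,
        mul_assoc]
      congr 2
      exact Finset.prod_congr rfl fun k hk => if_neg (Finset.ne_of_mem_erase hk)
    rw [h2] at h
    refine (hasSum_congr fun a => ?_).1 h
    have h3 : lamb γ ^ (deg a).2 = ∏ k, lamb γ ^ a k := by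
      rw [deg_snd]
      generalize (Finset.univ : Finset (Mon n d)) = s
      classical
      induction s using Finset.induction_on with
      | empty => simp
      | insert k s hk ih => rw [Finset.sum_insert hk, Finset.prod_insert hk, zpow_add₀ hlam, ih]
    rw [h3, gCoeff, starProd, ← Finset.prod_mul_distrib, ← Finset.prod_mul_distrib]
    refine Finset.prod_congr rfl fun k _ => ?_
    rw [Pi.sub_apply, Pi.smul_apply, nsmul_eq_mul]
    split_ifs <;> ring
  · rw [gCoeff_of_nonneg γ i hi, mul_zero]
    refine (hasSum_congr fun a => ?_).1 hasSum_zero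
    by_contra hne
    obtain ⟨k, hk, hk0⟩ := exists_neg_of_deg hu hl hi
    have h0 := right_ne_zero_of_mul (Ne.symm hne)
    have h1 := zcoeff_ne_zero ((apply_ne_zero_of_starProd (left_ne_zero_of_mul h0)).2 k hk)
    have h2 := zcoeff_ne_zero (Finset.prod_ne_zero_iff.1 (right_ne_zero_of_mul h0) k
      (Finset.mem_univ k))
    rw [Pi.sub_apply, Pi.smul_apply, nsmul_eq_mul] at h2
    have h3 : 0 ≤ (p : ℤ) * a k := mul_nonneg (Int.natCast_nonneg _) h1
    linarith

open Classical in
theorem Fser_apply (i : Inn n d) {u : Lat n} (hu : u ∈ MMinus n d) (l : Expo n d) :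
    Fser p i u l = if deg l = u then
      starProd i.1 (qfun ℂ_[p]) (zcoeff (PowerSeries.exp ℂ_[p])) l else 0 := by
  rw [Fser]
  by_cases hl : deg l = u
  · rw [if_pos hl]
    split_ifs with h
    · have hi : l i.1 < 0 := by
        by_contra hi
        obtain ⟨k, hk, hk0⟩ := exists_neg_of_deg hu hl hi
        exact absurd (h.2.2 k hk) (not_le.2 hk0)
      rw [starProd_eq, qfun, if_pos hi, div_eq_mul_inv, ← Finset.prod_inv_distrib]
      congr 1
      refine Finset.prod_congr rfl fun k hk => ?_
      rw [← zcoeff_exp, Int.toNat_of_nonneg (h.2.2 k (Finset.ne_of_mem_erase hk))]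
    · by_contra hne
      obtain ⟨h1, h2⟩ := apply_ne_zero_of_starProd (Ne.symm hne)
      refine h ⟨hl, ?_, fun k hk => zcoeff_ne_zero (h2 k hk)⟩
      by_contra hi
      exact h1 (if_neg (by linarith))
  · rw [if_neg hl, if_neg fun h => hl h.1]

theorem thetaSer_eq (γ : ℂ_[p]) (v : Lat n) :
    thetaSer γ v = ofPoly (prodPoly (zcoeff (thetaOne γ)) v : LPoly ℂ_[p] n d) := by
  classical
  funext l
  rw [ofPoly, coeff_prodPoly, thetaSer]
  refine if_ctx_congr Iff.rfl (fun h => Finset.prod_congr rfl fun k _ => ?_) fun _ => rfl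
  rw [thetaNum_div, Int.toNat_of_nonneg (h.1 k)]

theorem serMul_Fser_thetaSer (γ : ℂ_[p]) (i : Inn n d) {u v : Lat n} (hv : u - v ∈ MMinus n d)
    {l : Expo n d} (hl : deg l = u) :
    serMul (Fser p i (u - v)) (thetaSer γ v) l = ∑' m : deg ⁻¹' {v},
      starProd i.1 (qfun ℂ_[p]) (zcoeff (PowerSeries.exp ℂ_[p])) (l - m.1) *
        ∏ k, zcoeff (thetaOne γ) (m.1 k) := by
  classical
  rw [serMul, ← (Equiv.subLeft l).tsum_eq, tsum_subtype (deg ⁻¹' {v}) fun m : Expo n d =>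
    starProd i.1 (qfun ℂ_[p]) (zcoeff (PowerSeries.exp ℂ_[p])) (l - m) *
        ∏ k, zcoeff (thetaOne γ) (m k)]
  refine tsum_congr fun m => ?_
  rw [Equiv.subLeft_apply, sub_sub_cancel, Fser_apply i hv, thetaSer_eq, ofPoly, coeff_prodPoly,
    Set.indicator_apply, deg_sub, hl]
  by_cases hm : deg m = v
  · have hmem : m ∈ deg ⁻¹' {v} := hm
    rw [if_pos (by rw [hm]), if_pos hmem]
    split_ifs with h
    · rfl
    · rw [mul_zero]
      by_contra hne
      exact h ⟨fun k => zcoeff_ne_zero (Finset.prod_ne_zero_iff.1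
        (right_ne_zero_of_mul (Ne.symm hne)) k (Finset.mem_univ k)), hm⟩
  · have hmem : m ∉ deg ⁻¹' {v} := hm
    rw [if_neg (by simpa using hm), if_neg hmem, zero_mul]

theorem hasSum_gCoeff_fiber (hγ : IsGamma γ) (i : Inn n d) {u : Lat n} (hu : u ∈ MMinus n d)
    {l : Expo n d} (hl : deg l = u) :
    HasSum (fun v : Lat n => ∑' m : deg ⁻¹' {v},
      starProd i.1 (qfun ℂ_[p]) (zcoeff (PowerSeries.exp ℂ_[p])) (l - m.1) *
        ∏ k, zcoeff (thetaOne γ) (m.1 k)) (gCoeff γ i l) ∧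
    (∀ v ∉ NA n d, ∑' m : deg ⁻¹' {v},
      starProd i.1 (qfun ℂ_[p]) (zcoeff (PowerSeries.exp ℂ_[p])) (l - m.1) *
        ∏ k, zcoeff (thetaOne γ) (m.1 k) = 0) ∧
    ∀ v ∈ NA n d, ‖∑' m : deg ⁻¹' {v},
      starProd i.1 (qfun ℂ_[p]) (zcoeff (PowerSeries.exp ℂ_[p])) (l - m.1) *
        ∏ k, zcoeff (thetaOne γ) (m.1 k)‖ ≤
        ‖((len u - 1).factorial : ℂ_[p])‖ * invSqrt p ^ v.2.toNat := by
  have hpos : ∀ m : Expo n d, ¬ (∀ k, 0 ≤ m k) → ∏ k, zcoeff (thetaOne γ) (m k) = 0 := by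
    intro m hm
    by_contra hne
    exact hm fun k => zcoeff_ne_zero (Finset.prod_ne_zero_iff.1 hne k (Finset.mem_univ k))
  refine ⟨(hasSum_gCoeff hγ i hu hl).tsum_fiberwise deg, fun v hv => ?_, fun v hv => ?_⟩
  · refine (tsum_congr fun m => ?_).trans tsum_zero
    rw [hpos m.1 fun h => hv (mem_NA_iff.2 ⟨m.1, h, m.2⟩), mul_zero]
  · have h0 : 0 ≤ invSqrt p := invSqrt_pos.le
    refine IsUltrametricDist.norm_tsum_le_of_forall_le_of_nonneg (by positivity) fun m => ?_
    by_cases hm : ∀ k, 0 ≤ m.1 k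
    · have h1 : deg m.1 = v := m.2
      have h2 : ∑ k, m.1 k = v.2 := (deg_snd m.1).symm.trans (congrArg Prod.snd h1)
      have h3 := len_eq hu
      have h4 := len_pos hu
      have h5 := (NA_nonneg hv).2
      refine norm_starProd_mul_prod_theta_le hγ i.1 _ _ hm (by rw [h2]; omega) ?_
      have h6 : ∑ k, (l - m.1) k = u.2 - v.2 := by rw [← deg_snd, deg_sub, hl, h1]; rfl
      rw [h6]; omega
    · rw [hpos m.1 hm, mul_zero, norm_zero]; positivity

open Classical in
theorem summable_Gterm_and_Gser_apply (hγ : IsGamma γ) (i : Inn n d) {u : Lat n}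
    (hu : u ∈ MMinus n d) (l : Expo n d) :
    HasSum (fun w : Pairs n d u => Gterm γ i u w l) (if deg l = u then gCoeff γ i l else 0) := by
  split_ifs with hl
  · obtain ⟨h1, h2, -⟩ := hasSum_gCoeff_fiber hγ i hu hl
    have hinj : Function.Injective fun w : Pairs n d u => w.1.2 := fun w w' h => by
      have h3 := w.2.2.2.trans w'.2.2.2.symm
      simp only at h
      rw [h] at h3
      exact Subtype.ext (Prod.ext (add_right_cancel h3) h)
    rw [← hinj.hasSum_iff fun v hv => h2 v fun hNA => hv
      ⟨⟨(u - v, v), sub_mem_MMinus hu hNA, hNA, sub_add_cancel u v⟩, rfl⟩] at h1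
    refine (hasSum_congr fun w => ?_).1 h1
    have h4 : w.1.1 = u - w.1.2 := eq_sub_of_add_eq w.2.2.2
    rw [Gterm, h4]
    exact (serMul_Fser_thetaSer γ i (h4 ▸ w.2.1) hl).symm
  · refine (hasSum_congr fun w => ?_).1 hasSum_zero
    rw [Gterm, serMul]
    refine (tsum_zero.symm.trans (tsum_congr fun m => ?_))
    rw [Fser_apply i w.2.1, thetaSer_eq, ofPoly, coeff_prodPoly]
    by_contra hne
    have h1 := left_ne_zero_of_mul (Ne.symm hne)
    have h2 := right_ne_zero_of_mul (Ne.symm hne)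
    have h3 : deg m = w.1.1 := by by_contra h; exact h1 (if_neg h)
    have h4 : deg (l - m) = w.1.2 := by by_contra h; exact h2 (if_neg fun h' => h h'.2)
    exact hl (by rw [← w.2.2.2, ← h3, ← h4, ← deg_add, add_sub_cancel])

open Classical in
theorem Gser_apply (hγ : IsGamma γ) (i : Inn n d) {u : Lat n} (hu : u ∈ MMinus n d)
    (l : Expo n d) : Gser γ i u l = if deg l = u then gCoeff γ i l else 0 :=
  (summable_Gterm_and_Gser_apply hγ i hu l).tsum_eq

theorem norm_Fser_le (i : Inn n d) {u : Lat n} (hu : u ∈ MMinus n d) :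
    NormLE (Fser p i u) ‖((len u - 1).factorial : ℂ_[p])‖ := fun l => by
  classical
  rw [Fser_apply i hu]
  split_ifs with hl
  · refine norm_starProd_exp_le i.1 ?_
    have h3 := len_eq hu
    have h4 := len_pos hu
    rw [← deg_snd, hl]; omega
  · rw [norm_zero]; exact norm_nonneg _

theorem norm_Gser_le (hγ : IsGamma γ) (i : Inn n d) {u : Lat n} (hu : u ∈ MMinus n d) :
    NormLE (Gser γ i u) ‖((len u - 1).factorial : ℂ_[p])‖ := fun l => by
  classical
  have h0 : 0 ≤ invSqrt p := invSqrt_pos.le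
  rw [Gser_apply hγ i hu]
  split_ifs with hl
  · obtain ⟨h1, h2, h3⟩ := hasSum_gCoeff_fiber hγ i hu hl
    rw [← h1.tsum_eq]
    refine IsUltrametricDist.norm_tsum_le_of_forall_le_of_nonneg (norm_nonneg _) fun v => ?_
    by_cases hv : v ∈ NA n d
    · refine (h3 v hv).trans (mul_le_of_le_one_right (norm_nonneg _) ?_)
      exact pow_le_one₀ h0 invSqrt_lt_one.le
    · rw [h2 v hv, norm_zero]; exact norm_nonneg _
  · rw [norm_zero]; exact norm_nonneg _

theorem norm_factorial_le_one (m : ℕ) : ‖(m.factorial : ℂ_[p])‖ ≤ 1 := norm_natCast_le_one' _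

theorem Fser_support {i : Inn n d} {u : Lat n} {l : Expo n d} (h : Fser p i u l ≠ 0) :
    l ∈ LSetDeg i u := by
  by_contra hl
  exact h (if_neg hl)

theorem Gser_support (hγ : IsGamma γ) {i : Inn n d} {u : Lat n} (hu : u ∈ MMinus n d)
    {l : Expo n d} (h : Gser γ i u l ≠ 0) : l ∈ LSetDeg i u := by
  classical
  rw [Gser_apply hγ i hu] at h
  by_cases hl : deg l = u
  · rw [if_pos hl] at h
    obtain ⟨h1, h2⟩ := apply_ne_zero_of_starProd h
    refine ⟨hl, ?_, fun k hk => zcoeff_ne_zero (h2 k hk)⟩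
    by_contra hi
    exact h1 (negPart_of_nonneg _ (by linarith))
  · rw [if_neg hl] at h
    exact absurd rfl h

theorem add_mem_LSet {i : Inn n d} {u : Lat n} {l c : Expo n d}
    (hl : l ∈ LSetDeg i u) (hc : ∀ k, 0 ≤ c k) (hcd : deg c = -u) : c + l ∈ LSet i := by
  refine ⟨by rw [deg_add, hcd, hl.1, neg_add_cancel], ?_, fun k hk => add_nonneg (hc k) (hl.2.2 k hk)⟩
  have h1 := congrArg Prod.snd hl.1
  have h2 := congrArg Prod.snd hcd
  rw [deg_snd, ← Finset.add_sum_erase _ _ (Finset.mem_univ i.1)] at h1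
  rw [deg_snd, ← Finset.add_sum_erase _ _ (Finset.mem_univ i.1)] at h2
  have h3 : 0 ≤ ∑ k ∈ Finset.univ.erase i.1, l k :=
    Finset.sum_nonneg fun k hk => hl.2.2 k (Finset.ne_of_mem_erase hk)
  have h4 : 0 ≤ ∑ k ∈ Finset.univ.erase i.1, c k := Finset.sum_nonneg fun k _ => hc k
  rw [Prod.snd_neg] at h2
  rw [Pi.add_apply]
  linarith

theorem exists_shift_supportE {i : Inn n d} {u : Lat n} (hu : u ∈ MMinus n d) {ξ : Ser p n d}
    {C : ℝ} (hξ : NormLE ξ C) (hs : ∀ l, ξ l ≠ 0 → l ∈ LSetDeg i u) :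
    ∃ (c : Expo n d) (a : GSer p n d), a ∈ supportE p n d ∧ (mono (wt n d) c 1 * a).1 = ξ := by
  obtain ⟨c, hc, hcd⟩ := exists_deg_eq_neg hu
  have h1 : (fun l => ξ (l - c)) ∈ RE p n d := ⟨⟨C, fun l => hξ _⟩, fun l hl =>
    LSet_subset_ESet i (by have := add_mem_LSet (hs _ hl) hc hcd; rwa [add_sub_cancel] at this)⟩
  refine ⟨-c, ⟨_, tame_of_bdd_supportE h1⟩, h1.2, funext fun l => ?_⟩
  refine (mono_mul_apply _ _ _ _).trans ((one_mul _).trans ?_)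
  change ξ (l - -c - c) = ξ l
  simp

theorem mem_RR_of_support {i : Inn n d} {u : Lat n} (hu : u ∈ MMinus n d) {ξ : Ser p n d}
    {C : ℝ} (hξ : NormLE ξ C) (hs : ∀ l, ξ l ≠ 0 → l ∈ LSetDeg i u) :
    ξ ∈ RRdeg p n d u := by
  obtain ⟨c, a, ha, rfl⟩ := exists_shift_supportE hu hξ hs
  exact ⟨mono_mul_supportE_mem_RR c ha, fun l hl => (hs l hl).1⟩

theorem Fser_mem_RRdeg (i : Inn n d) {u : Lat n} (hu : u ∈ MMinus n d) :
    Fser p i u ∈ RRdeg p n d u :=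
  mem_RR_of_support hu (norm_Fser_le i hu) fun _ => Fser_support

theorem Gser_mem_RRdeg (hγ : IsGamma γ) (i : Inn n d) {u : Lat n} (hu : u ∈ MMinus n d) :
    Gser γ i u ∈ RRdeg p n d u :=
  mem_RR_of_support hu (norm_Gser_le hγ i hu) fun _ => Gser_support hγ hu

open Classical in
/-- A series as an element of the ring of tame series (zero if it is not tame). -/
def liftSer (ξ : Ser p n d) : GSer p n d := if h : Tame (wt n d) ξ then ⟨ξ, h⟩ else 0

theorem coe_liftSer {ξ : Ser p n d} (h : Tame (wt n d) ξ) : (liftSer ξ).1 = ξ := by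
  have h1 : liftSer ξ = (⟨ξ, h⟩ : tameSubgroup ℂ_[p] (wt n d)) := dif_pos h
  rw [h1]

theorem coe_liftSer_F (i : Inn n d) {u : Lat n} (hu : u ∈ MMinus n d) :
    (liftSer (Fser p i u)).1 = Fser p i u := coe_liftSer (tame_of_mem_RR (Fser_mem_RRdeg i hu).1)

theorem coe_liftSer_G (hγ : IsGamma γ) (i : Inn n d) {u : Lat n} (hu : u ∈ MMinus n d) :
    (liftSer (Gser γ i u)).1 = Gser γ i u :=
  coe_liftSer (tame_of_mem_RR (Gser_mem_RRdeg hγ i hu).1)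

variable (n d) in
/-- The elements of `ℕA` with last coordinate at most `K`. -/
def finNA (K : ℕ) : Finset (Lat n) := (finite_NA_snd_le (d := d) K).toFinset

theorem mem_finNA {K : ℕ} {v : Lat n} : v ∈ finNA n d K ↔ v ∈ NA n d ∧ v.2 ≤ K := by
  rw [finNA, Set.Finite.mem_toFinset]; rfl

variable (n d) in
/-- The elements of `𝓜_-` of length at most `K`. -/
def finMM (K : ℕ) : Finset (Lat n) := (finite_MMinus_len_le (d := d) K).toFinset

theorem mem_finMM {K : ℕ} {v : Lat n} : v ∈ finMM n d K ↔ v ∈ MMinus n d ∧ len v ≤ K := by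
  rw [finMM, Set.Finite.mem_toFinset]; rfl

theorem hasDeg_polyHom_prodPoly (g : ℤ → ℂ_[p]) (s : Lat n) :
    HasDeg (polyHom p n d (prodPoly g s)).1 s := fun l hl => by
  classical
  rw [polyHom_coe, ofPoly, coeff_prodPoly] at hl
  by_contra h
  exact hl (if_neg fun h' => h h'.2)

theorem BddBy.of_hasDeg {a : GSer p n d} {u : Lat n} {C : ℝ} (hC : 0 ≤ C) (ha : HasDeg a.1 u)
    (h : ∀ l, deg l = u → ‖a l‖ ≤ C) : BddBy a C := fun l => by
  by_cases hl : a l = 0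
  · rw [hl, norm_zero]; exact hC
  · exact h l (ha l hl)

theorem hasDeg_sub {a b : GSer p n d} {u : Lat n} (ha : HasDeg a.1 u) (hb : HasDeg b.1 u) :
    HasDeg (a - b).1 u := fun l hl => by
  rw [coe_sub, Pi.sub_apply] at hl
  by_cases h : a l = 0
  · rw [h, zero_sub] at hl
    exact hb l (neg_ne_zero.1 hl)
  · exact ha l h

theorem hasDeg_const_mul (c : ℂ_[p]) {a : GSer p n d} {u : Lat n} (ha : HasDeg a.1 u) :
    HasDeg (const ℂ_[p] (wt n d) c * a).1 u := fun l hl => by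
  rw [const_mul_apply] at hl
  exact ha l (right_ne_zero_of_mul hl)

/-- `G_u = ∑_v F_{u-v} θ̂_{1,v}` up to a small error when the sum is truncated. -/
theorem bddBy_G_sub_sum (hγ : IsGamma γ) (i : Inn n d) {u : Lat n} (hu : u ∈ MMinus n d) (K : ℕ) :
    BddBy (liftSer (Gser γ i u) - ∑ v ∈ finNA n d K, liftSer (Fser p i (u - v)) *
      polyHom p n d (prodPoly (zcoeff (thetaOne γ)) v))
      (‖((len u - 1).factorial : ℂ_[p])‖ * invSqrt p ^ (K + 1)) := by
  have h0 : 0 ≤ invSqrt p := invSqrt_pos.le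
  refine BddBy.of_hasDeg (u := u) (by positivity) (hasDeg_sub ?_ (hasDeg_sum fun v hv => ?_)) ?_
  · rw [coe_liftSer_G hγ i hu]; exact (Gser_mem_RRdeg hγ i hu).2
  · have := hasDeg_mul (a := liftSer (Fser p i (u - v))) (u := u - v)
      (by rw [coe_liftSer_F i (sub_mem_MMinus hu (mem_finNA.1 hv).1)]
          exact (Fser_mem_RRdeg i (sub_mem_MMinus hu (mem_finNA.1 hv).1)).2)
      (hasDeg_polyHom_prodPoly (zcoeff (thetaOne γ)) v)
    rwa [sub_add_cancel] at this
  · intro l hl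
    classical
    obtain ⟨h1, h2, h3⟩ := hasSum_gCoeff_fiber hγ i hu hl
    have h4 : (liftSer (Gser γ i u)) l = gCoeff γ i l := by
      rw [coe_liftSer_G hγ i hu, Gser_apply hγ i hu, if_pos hl]
    rw [coe_sub, Pi.sub_apply, h4, coe_sum, Finset.sum_apply]
    have h5 := norm_hasSum_sub_le h1 (finNA n d K)
      (C := ‖((len u - 1).factorial : ℂ_[p])‖ * invSqrt p ^ (K + 1)) (by positivity) fun v hv => by
        by_cases hNA : v ∈ NA n d
        · refine (h3 v hNA).trans (mul_le_mul_of_nonneg_left ?_ (norm_nonneg _))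
          refine pow_le_pow_of_le_one h0 invSqrt_lt_one.le ?_
          have : ¬ v.2 ≤ K := fun h => hv (mem_finNA.2 ⟨hNA, h⟩)
          omega
        · rw [h2 v hNA, norm_zero]; positivity
    refine (congrArg norm ?_).trans_le h5
    congr 1
    refine Finset.sum_congr rfl fun v hv => ?_
    have h6 := sub_mem_MMinus hu (mem_finNA.1 hv).1
    rw [← serMul_Fser_thetaSer γ i h6 hl, thetaSer_eq, ← polyHom_coe, ← coe_liftSer_F i h6, serMul_eq,
      coe_liftSer_F i h6]

/-- The Frobenius relation `κ G_u(Λ) = ∑_v γ^{(p-1)|v|} G_v(Λ^p) A_{u-pv}(Λ)`, truncated. -/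
theorem bddBy_frobenius (hγ : IsGamma γ) {κ : ℂ_[p]} (hκ : ∀ l < 0, HasSum (fun a : ℤ =>
      lamb γ ^ a * negPart (thetaOne γ) a * zcoeff (artinHasseC p) (l - p * a))
      (κ * negPart (thetaOne γ) l)) (i : Inn n d) {u : Lat n} (hu : u ∈ MMinus n d) (K : ℕ) :
    BddBy (const ℂ_[p] (wt n d) κ * liftSer (Gser γ i u) -
      ∑ v ∈ finMM n d K, const ℂ_[p] (wt n d) ((γ ^ (p - 1)) ^ len v) *
        (frobHom p n d (liftSer (Gser γ i v)) *
          polyHom p n d (prodPoly (zcoeff (artinHasseC p)) (u - p • v))))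
      ((p : ℝ)⁻¹ ^ (K + 1)) := by
  have hp1 : (1 : ℝ) < p := by exact_mod_cast hp.out.one_lt
  refine BddBy.of_hasDeg (u := u) (by positivity) (hasDeg_sub (hasDeg_const_mul κ ?_)
    (hasDeg_sum fun v hv => hasDeg_const_mul _ ?_)) ?_
  · rw [coe_liftSer_G hγ i hu]; exact (Gser_mem_RRdeg hγ i hu).2
  · have := hasDeg_mul (hasDeg_frobHom (a := liftSer (Gser γ i v)) (u := v)
      (by rw [coe_liftSer_G hγ i (mem_finMM.1 hv).1]
          exact (Gser_mem_RRdeg hγ i (mem_finMM.1 hv).1).2))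
      (hasDeg_polyHom_prodPoly (zcoeff (artinHasseC p)) (u - p • v))
    rwa [add_sub_cancel] at this
  · intro l hl
    classical
    have h1 := (hasSum_frob_gCoeff hγ hκ i hu hl).tsum_fiberwise deg
    have h2 : ∀ a : Expo n d, deg a ∉ MMinus n d →
        ∏ k, zcoeff (artinHasseC p) ((l - p • a) k) = 0 := fun a ha => by
      by_contra hne
      refine ha (deg_mem_MMinus_of_nsmul hp.out.pos hu ?_)
      rw [← hl, ← deg_nsmul, ← deg_sub]
      exact mem_NA_iff.2 ⟨_, fun k => zcoeff_ne_zero (Finset.prod_ne_zero_iff.1 hne k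
        (Finset.mem_univ k)), rfl⟩
    have h4 : (liftSer (Gser γ i u)) l = gCoeff γ i l := by
      rw [coe_liftSer_G hγ i hu, Gser_apply hγ i hu, if_pos hl]
    have h5 := norm_hasSum_sub_le h1 (finMM n d K) (C := (p : ℝ)⁻¹ ^ (K + 1)) (by positivity)
      fun v hv => by
        refine IsUltrametricDist.norm_tsum_le_of_forall_le_of_nonneg (by positivity) fun a => ?_
        have ha : deg a.1 = v := a.2
        by_cases hM : v ∈ MMinus n d
        · have h6 : ‖gCoeff γ i a.1‖ ≤ 1 := by
            have := (norm_Gser_le hγ i hM a.1).trans (norm_factorial_le_one _)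
            rwa [Gser_apply hγ i hM, if_pos ha] at this
          have h7 : ‖∏ k, zcoeff (artinHasseC p) ((l - p • a.1) k)‖ ≤ 1 := by
            rw [norm_prod]
            exact Finset.prod_le_one (fun k _ => norm_nonneg _) fun k _ => norm_artinHasseC_le _
          have h8 : K + 1 ≤ len v := by
            by_contra h
            exact hv (mem_finMM.2 ⟨hM, by omega⟩)
          have h9 : v.2 = -(len v : ℤ) := by rw [len_eq hM, neg_neg]
          rw [norm_mul, norm_zpow, hγ.norm_lamb, ha, h9, zpow_neg, zpow_natCast, norm_mul, ← inv_pow]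
          calc (p : ℝ)⁻¹ ^ len v * (_ * _) ≤ (p : ℝ)⁻¹ ^ len v * (1 * 1) := by gcongr
            _ ≤ _ := by
              rw [mul_one, mul_one]
              exact pow_le_pow_of_le_one (by positivity) (inv_lt_one_of_one_lt₀ hp1).le h8
        · rw [h2 a.1 (by rwa [ha]), mul_zero, mul_zero, norm_zero]; positivity
    rw [coe_sub, Pi.sub_apply, const_mul_apply, h4, coe_sum, Finset.sum_apply]
    refine (congrArg norm ?_).trans_le h5
    congr 1
    refine Finset.sum_congr rfl fun v hv => ?_
    have hM := (mem_finMM.1 hv).1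
    have h9 : v.2 = -(len v : ℤ) := by rw [len_eq hM, neg_neg]
    rw [const_mul_apply, mul_apply, tsum_subtype (deg ⁻¹' {v}) fun a : Expo n d =>
      lamb γ ^ (deg a).2 * (gCoeff γ i a * ∏ k, zcoeff (artinHasseC p) ((l - p • a) k)),
      ← tsum_mul_left, ← (nsmul_prime_injective (p := p) (n := n) (d := d)).tsum_eq]
    · refine tsum_congr fun a => ?_
      rw [frobHom_coe, frob_nsmul, coe_liftSer_G hγ i hM, Gser_apply hγ i hM, polyHom_coe, ofPoly,
        coeff_prodPoly, Set.indicator_apply]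
      by_cases ha : deg a = v
      · have hmem : a ∈ deg ⁻¹' {v} := ha
        rw [if_pos ha, if_pos hmem, ha, h9, zpow_neg, zpow_natCast, lamb, inv_pow, inv_inv]
        congr 2
        split_ifs with h
        · rfl
        · by_contra hne
          refine h ⟨fun k => zcoeff_ne_zero (Finset.prod_ne_zero_iff.1 (Ne.symm hne) k
            (Finset.mem_univ k)), ?_⟩
          rw [deg_sub, deg_nsmul, ha, hl]
      · have hmem : a ∉ deg ⁻¹' {v} := ha
        rw [if_neg ha, if_neg hmem, zero_mul, mul_zero]
    · intro m hm
      have h10 : frob (liftSer (Gser γ i v)).1 m ≠ 0 := by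
        intro h
        refine hm ?_
        simp only [frobHom_coe, h, zero_mul, mul_zero]
      obtain ⟨a, rfl, -⟩ := exists_of_frob_ne_zero h10
      exact ⟨a, rfl⟩

end Series

/-! ### Congruences -/

section Congruence

variable {K : Type*} [NormedField K] [IsUltrametricDist K] [CompleteSpace K]
  {Γ : Type*} [AddCommGroup Γ] {φ : Γ → ℤ} [PointedWeight φ]

variable (φ K) in
/-- The ideal of the unit ball of elements of norm at most `ε`. -/
def smallIdeal (ε : ℝ) (hε : 0 ≤ ε) : Ideal (unitBall K φ) where
  carrier := {a | BddBy a.1 ε}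
  add_mem' ha hb := BddBy.add ha hb
  zero_mem' := bddBy_zero hε
  smul_mem' c _ ha := BddBy.unitBall_mul c.2 ha

theorem bddBy_det_sub {ι : Type*} [Fintype ι] [DecidableEq ι] {X Y : Matrix ι ι (ConvRing K φ)}
    (hX : ∀ i j, BddBy (X i j) 1) (hY : ∀ i j, BddBy (Y i j) 1) {ε : ℝ} (hε : 0 ≤ ε)
    (h : ∀ i j, BddBy (X i j - Y i j) ε) : BddBy (X.det - Y.det) ε := by
  let X' : Matrix ι ι (unitBall K φ) := fun i j => ⟨X i j, hX i j⟩
  let Y' : Matrix ι ι (unitBall K φ) := fun i j => ⟨Y i j, hY i j⟩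
  have h1 : X'.det - Y'.det ∈ smallIdeal K φ ε hε := by
    rw [← Ideal.Quotient.eq, RingHom.map_det, RingHom.map_det]
    congr 1
    ext i j
    exact Ideal.Quotient.eq.2 (h i j)
  have hXd : X.det = (unitBall K φ).subtype X'.det := by rw [RingHom.map_det]; rfl
  have hYd : Y.det = (unitBall K φ).subtype Y'.det := by rw [RingHom.map_det]; rfl
  rw [hXd, hYd]
  exact h1

variable (φ K) in
/-- The elements of norm at most one which are within `ε` of a subring. -/
def nearRing (S : Subring (ConvRing K φ)) (ε : ℝ) (hε : 0 ≤ ε) (hε1 : ε ≤ 1) :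
    Subring (ConvRing K φ) where
  carrier := {a | BddBy a 1 ∧ ∃ s ∈ S, BddBy (a - s) ε}
  mul_mem' := by
    rintro a b ⟨ha, s, hs, has⟩ ⟨hb, t, ht, hbt⟩
    refine ⟨ha.mul_one_one hb, s * t, mul_mem hs ht, ?_⟩
    have ht1 : BddBy t 1 := by
      have := hb.sub (hbt.mono_right hε1)
      rwa [sub_sub_cancel] at this
    have : a * b - s * t = a * (b - t) + (a - s) * t := by ring
    rw [this]
    exact (BddBy.unitBall_mul ha hbt).add (has.mul_unitBall ht1)
  one_mem' := ⟨bddBy_one, 1, one_mem _, by rw [sub_self]; exact bddBy_zero hε⟩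
  add_mem' := by
    rintro a b ⟨ha, s, hs, has⟩ ⟨hb, t, ht, hbt⟩
    refine ⟨ha.add hb, s + t, add_mem hs ht, ?_⟩
    rw [add_sub_add_comm]
    exact has.add hbt
  zero_mem' := ⟨bddBy_zero zero_le_one, 0, zero_mem _, by rw [sub_self]; exact bddBy_zero hε⟩
  neg_mem' := by
    rintro a ⟨ha, s, hs, has⟩
    refine ⟨ha.neg, -s, neg_mem hs, ?_⟩
    rw [← neg_sub']
    exact has.neg

variable {S : Subring (ConvRing K φ)} {ε : ℝ} {hε : 0 ≤ ε} {hε1 : ε ≤ 1}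

theorem mem_nearRing_of_mem {a : ConvRing K φ} (ha : a ∈ S) (h1 : BddBy a 1) :
    a ∈ nearRing K φ S ε hε hε1 :=
  ⟨h1, a, ha, by rw [sub_self]; exact bddBy_zero hε⟩

theorem mem_nearRing_of_sub {a b : ConvRing K φ} (ha : a ∈ nearRing K φ S ε hε hε1)
    (h : BddBy (b - a) ε) : b ∈ nearRing K φ S ε hε hε1 := by
  obtain ⟨h1, s, hs, h2⟩ := ha
  refine ⟨?_, s, hs, ?_⟩
  · have := (h.mono_right hε1).add h1
    rwa [sub_add_cancel] at this
  · have := h.add h2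
    rwa [sub_add_sub_cancel] at this

/-- Inversion of a unit close to a unit of the subring. -/
theorem inv_mem_nearRing (hε0 : 0 < ε) {δ δ₀ e f : ConvRing K φ} {η : ℝ} (hη : η < 1)
    (hδ : δ ∈ nearRing K φ S ε hε hε1) (he : e ∈ nearRing K φ S ε hε hε1)
    (he0 : δ₀ * e = 1) (hf : BddBy f 1) (hf0 : δ * f = 1) (hd : BddBy (δ - δ₀) η) :
    f ∈ nearRing K φ S ε hε hε1 := by
  set x := 1 - δ * e with hx
  have hx1 : BddBy x η := by
    have : x = -((δ - δ₀) * e) := by rw [sub_mul, he0, hx]; ring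
    rw [this]
    exact (hd.mul_unitBall he.1).neg
  have hxT : x ∈ nearRing K φ S ε hε hε1 := sub_mem (one_mem _) (mul_mem hδ he)
  have hη0 : 0 ≤ η := hd.nonneg
  obtain ⟨N, hN⟩ := exists_pow_lt_of_lt_one hε0 hη
  have hpow : ∀ N : ℕ, BddBy (x ^ N) (η ^ N) := fun N => by
    induction N with
    | zero => simpa using bddBy_one
    | succ N ih => rw [pow_succ, pow_succ]; exact ih.mul hx1
  have hfe : f * (1 - x) = e := by
    rw [hx, sub_sub_cancel, ← mul_assoc, mul_comm f, hf0, one_mul]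
  refine mem_nearRing_of_sub (a := e * ∑ i ∈ Finset.range N, x ^ i)
    (mul_mem he (sum_mem fun i _ => pow_mem hxT i)) ?_
  have : f - e * ∑ i ∈ Finset.range N, x ^ i = f * x ^ N := by
    rw [← hfe, mul_assoc, mul_neg_geom_sum]; ring
  rw [this]
  exact (BddBy.unitBall_mul hf (hpow N)).mono_right hN.le

theorem matrix_inv_mem_nearRing (hε0 : 0 < ε) {ι : Type*} [Fintype ι] [DecidableEq ι]
    {X Z B : Matrix ι ι (ConvRing K φ)} {e : ConvRing K φ} {η : ℝ} (hη : η < 1)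
    (hX : ∀ i j, X i j ∈ nearRing K φ S ε hε hε1) (hB : ∀ i j, BddBy (B i j) 1)
    (hXB : ∀ i j, BddBy (X i j - B i j) η) (hη0 : 0 ≤ η)
    (he : e ∈ nearRing K φ S ε hε hε1) (he0 : B.det * e = 1)
    (hZ : ∀ i j, BddBy (Z i j) 1) (hXZ : X * Z = 1) (i j : ι) :
    Z i j ∈ nearRing K φ S ε hε hε1 := by
  have h1 := adjugate_mem (nearRing K φ S ε hε hε1) hX
  have hZd : BddBy Z.det 1 := (adjugate_mem (unitBall K φ) hZ).1
  have hd : X.det * Z.det = 1 := by rw [← Matrix.det_mul, hXZ, Matrix.det_one]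
  have h2 : Z.det ∈ nearRing K φ S ε hε hε1 := inv_mem_nearRing hε0 hη h1.1 he he0 hZd hd
    (bddBy_det_sub (fun i j => (hX i j).1) hB hη0 hXB)
  have h3 : Z = Z.det • X.adjugate := by
    have : X.adjugate * X * Z = X.adjugate := by rw [mul_assoc, hXZ, mul_one]
    rw [← this, Matrix.adjugate_mul, Matrix.smul_mul, one_mul, smul_smul, mul_comm, hd, one_smul]
  rw [h3, Matrix.smul_apply, smul_eq_mul]
  exact mul_mem h2 (h1.2 i j)

end Congruence

/-! ### The matrices `F(Λ)`, `G(Λ)` -/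

section Matrices

variable {p : ℕ} [hp : Fact p.Prime] {n d : ℕ} {γ : ℂ_[p]}

variable (p n d) in
/-- `F(Λ)` as a matrix over the ring of series. -/
def gF : Matrix (Inn n d) (Inn n d) (GSer p n d) := Matrix.of fun i j =>
  mono (wt n d) (Pi.single j.1 1) 1 * liftSer (Fser p i (-avec j.1))

variable (n d) in
/-- `G(Λ)` as a matrix over the ring of series. -/
def gG (γ : ℂ_[p]) : Matrix (Inn n d) (Inn n d) (GSer p n d) := Matrix.of fun i j =>
  mono (wt n d) (Pi.single j.1 1) 1 * liftSer (Gser γ i (-avec j.1))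

theorem toS_gG (hγ : IsGamma γ) : toS (gG n d γ) = Gmat n d γ := by
  funext i j
  rw [Gmat, toS, gG, Matrix.of_apply, ← shift_eq, coe_liftSer_G hγ i (neg_avec_mem_MMinus j)]

theorem single_nonneg (j k : Mon n d) : 0 ≤ (Pi.single j (1 : ℤ) : Expo n d) k := by
  rw [Pi.single_apply]; split_ifs <;> simp

theorem gF_apply (i j : Inn n d) (l : Expo n d) :
    gF p n d i j l = Fser p i (-avec j.1) (l - Pi.single j.1 1) := by
  rw [gF, Matrix.of_apply, mono_mul_apply, one_mul, coe_liftSer_F i (neg_avec_mem_MMinus j)]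

theorem gG_apply (hγ : IsGamma γ) (i j : Inn n d) (l : Expo n d) :
    gG n d γ i j l = Gser γ i (-avec j.1) (l - Pi.single j.1 1) := by
  rw [gG, Matrix.of_apply, mono_mul_apply, one_mul, coe_liftSer_G hγ i (neg_avec_mem_MMinus j)]

theorem gF_mem_supportE (i j : Inn n d) : gF p n d i j ∈ supportE p n d := fun l hl => by
  rw [gF_apply] at hl
  have := add_mem_LSet (Fser_support hl) (single_nonneg j.1)
    (by rw [deg_single, one_smul, neg_neg])
  rw [add_sub_cancel] at this
  exact LSet_subset_ESet i this

theorem gG_mem_supportE (hγ : IsGamma γ) (i j : Inn n d) : gG n d γ i j ∈ supportE p n d :=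
  fun l hl => by
  rw [gG_apply hγ] at hl
  have := add_mem_LSet (Gser_support hγ (neg_avec_mem_MMinus j) hl) (single_nonneg j.1)
    (by rw [deg_single, one_smul, neg_neg])
  rw [add_sub_cancel] at this
  exact LSet_subset_ESet i this

theorem toS_gF : toS (gF p n d) = Fmat p n d := by
  classical
  funext i j l
  rw [toS, gF_apply, Fser, Fmat]
  have hdeg : deg (l - Pi.single j.1 1) = -avec j.1 ↔ deg l = 0 := by
    rw [deg_sub, deg_single, one_smul, sub_eq_neg_self]
  by_cases hij : i = j
  · subst hij
    rw [if_pos rfl]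
    have hiff : l - Pi.single i.1 1 ∈ LSetDeg i (-avec i.1) ↔ l ∈ LSet i := by
      constructor
      · intro h
        have := add_mem_LSet h (single_nonneg i.1) (by rw [deg_single, one_smul, neg_neg])
        rwa [add_sub_cancel] at this
      · intro h
        refine ⟨hdeg.2 h.1, ?_, fun k hk => ?_⟩
        · have := h.2.1; rw [Pi.sub_apply, Pi.single_eq_same]; linarith
        · rw [Pi.sub_apply, Pi.single_eq_of_ne hk, sub_zero]; exact h.2.2 k hk
    refine if_ctx_congr hiff (fun _ => ?_) fun _ => rfl
    have h1 : (-((l - Pi.single i.1 1 : Expo n d) i.1) - 1).toNat = (-(l i.1)).toNat := by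
      rw [Pi.sub_apply, Pi.single_eq_same]; congr 1; ring
    rw [h1]
    congr 1
    refine Finset.prod_congr rfl fun k hk => ?_
    rw [Pi.sub_apply, Pi.single_eq_of_ne (Finset.ne_of_mem_erase hk), sub_zero]
  · rw [if_neg hij]
    have hij' : i.1 ≠ j.1 := fun h => hij (Subtype.ext h)
    have hiff : l - Pi.single j.1 1 ∈ LSetDeg i (-avec j.1) ↔ l ∈ LSet i ∧ 0 < l j.1 := by
      constructor
      · intro h
        refine ⟨?_, ?_⟩
        · have := add_mem_LSet h (single_nonneg j.1) (by rw [deg_single, one_smul, neg_neg])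
          rwa [add_sub_cancel] at this
        · have := h.2.2 j.1 hij'.symm
          rw [Pi.sub_apply, Pi.single_eq_same] at this
          linarith
      · rintro ⟨h, hj⟩
        refine ⟨hdeg.2 h.1, ?_, fun k hk => ?_⟩
        · rw [Pi.sub_apply, Pi.single_eq_of_ne hij', sub_zero]; exact h.2.1
        · by_cases hkj : k = j.1
          · subst hkj
            rw [Pi.sub_apply, Pi.single_eq_same]; linarith
          · rw [Pi.sub_apply, Pi.single_eq_of_ne hkj, sub_zero]; exact h.2.2 k hk
    refine if_ctx_congr hiff (fun _ => ?_) fun _ => rfl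
    rw [Pi.sub_apply, Pi.single_eq_of_ne hij', sub_zero]
    congr 1
    rw [← Finset.mul_prod_erase _ _ (Finset.mem_erase.2 ⟨hij'.symm, Finset.mem_univ j.1⟩),
      Pi.sub_apply, Pi.single_eq_same]
    congr 1
    refine Finset.prod_congr rfl fun k hk => ?_
    rw [Pi.sub_apply, Pi.single_eq_of_ne (Finset.ne_of_mem_erase hk), sub_zero]

theorem bddBy_gF (i j : Inn n d) : BddBy (gF p n d i j) 1 := fun l => by
  rw [gF_apply]
  exact (norm_Fser_le i (neg_avec_mem_MMinus j) _).trans (norm_factorial_le_one _)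

theorem bddBy_gG (hγ : IsGamma γ) (i j : Inn n d) : BddBy (gG n d γ i j) 1 := fun l => by
  rw [gG_apply hγ]
  exact (norm_Gser_le hγ i (neg_avec_mem_MMinus j) _).trans (norm_factorial_le_one _)

theorem gF_zero (i j : Inn n d) : gF p n d i j 0 = if i = j then 1 else 0 := by
  have h := congrFun (congrFun (congrFun (toS_gF (p := p) (n := n) (d := d)) i) j) 0
  rw [toS] at h
  rw [h, Fmat]
  have h0 : (0 : Expo n d) ∈ LSet i := ⟨deg_zero, le_rfl, fun _ _ => le_rfl⟩
  by_cases hij : i = j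
  · rw [if_pos hij, if_pos hij, if_pos h0]; simp
  · rw [if_neg hij, if_neg hij, if_neg]; simp

theorem prodPoly_zero {g : ℤ → ℂ_[p]} (hg : g 0 = 1) : (prodPoly g 0 : LPoly ℂ_[p] n d) = 1 := by
  classical
  refine AddMonoidAlgebra.coeff_injective (Finsupp.ext fun l => ?_)
  rw [coeff_prodPoly, AddMonoidAlgebra.one_def, AddMonoidAlgebra.coeff_single, Finsupp.single_apply]
  by_cases hl : 0 = l
  · subst hl
    rw [if_pos rfl, if_pos ⟨fun _ => le_rfl, deg_zero⟩]
    simp [hg]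
  · rw [if_neg hl, if_neg]
    rintro ⟨h1, h2⟩
    refine hl (funext fun k => ?_)
    have h3 := congrArg Prod.snd h2
    rw [deg_snd] at h3
    exact ((Finset.sum_eq_zero_iff_of_nonneg fun k _ => h1 k).1 h3 k (Finset.mem_univ k)).symm

theorem zcoeff_thetaOne_zero (γ : ℂ_[p]) : zcoeff (thetaOne γ) 0 = 1 := by
  have := zcoeff_natCast (thetaOne γ) 0
  rw [Nat.cast_zero] at this
  rw [this, PowerSeries.coeff_zero_eq_constantCoeff_apply, constantCoeff_thetaOne]

theorem bddBy_gG_sub_gF (hγ : IsGamma γ) (i j : Inn n d) :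
    BddBy (gG n d γ i j - gF p n d i j) (invSqrt p) := by
  have h := bddBy_G_sub_sum hγ i (neg_avec_mem_MMinus j) 0
  have h0 : finNA n d 0 = {0} := by
    ext v
    rw [mem_finNA, Finset.mem_singleton]
    exact ⟨fun h => eq_zero_of_snd_le_zero h.1 h.2, fun h => by
      subst h; exact ⟨zero_mem _, le_rfl⟩⟩
  rw [h0, Finset.sum_singleton, prodPoly_zero (zcoeff_thetaOne_zero γ), map_one, mul_one, sub_zero,
    len_neg_avec] at h
  simp only [Nat.sub_self, Nat.factorial_zero, Nat.cast_one, norm_one, one_mul, zero_add,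
    pow_one] at h
  rw [gG, gF, Matrix.of_apply, Matrix.of_apply, ← mul_sub]
  exact BddBy.unitBall_mul (bddBy_mono (by simp)) h

theorem norm_det_gF : ‖(gF p n d).det 0‖ = 1 := by
  rw [det_constTerm gF_mem_supportE]
  have h : (Matrix.of fun i j => gF p n d i j 0) = 1 := by
    ext i j
    rw [Matrix.of_apply, gF_zero, Matrix.one_apply]
  exact (congrArg (fun M => ‖Matrix.det M‖) h).trans (by rw [Matrix.det_one, norm_one])

theorem norm_eq_one_of_sub {x y : ℂ_[p]} {r : ℝ} (hr : r < 1) (h : ‖x - y‖ ≤ r) (hy : ‖y‖ = 1) :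
    ‖x‖ = 1 := by
  have h1 := IsUltrametricDist.norm_add_eq_max_of_norm_ne_norm (x := x - y) (y := y)
    (by rw [hy]; exact (h.trans_lt hr).ne)
  rw [sub_add_cancel, hy] at h1
  rw [h1]
  exact max_eq_right (h.trans hr.le)

theorem norm_det_gG (hγ : IsGamma γ) : ‖(gG n d γ).det 0‖ = 1 :=
  norm_eq_one_of_sub invSqrt_lt_one
    (bddBy_det_sub (bddBy_gG hγ) bddBy_gF invSqrt_pos.le (bddBy_gG_sub_gF hγ) 0) norm_det_gF

end Matrices

/-! ### The determinant `D(Λ)` and localization -/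

section Denominator

variable {p : ℕ} [hp : Fact p.Prime] {n d : ℕ}

theorem Hmat_eq (i j : Inn n d) :
    Hmat ℂ_[p] p n d i j = prodPoly (zcoeff (artinHasseC p)) (p • avec i.1 - avec j.1) := by
  classical
  refine AddMonoidAlgebra.coeff_injective (Finsupp.ext fun l => ?_)
  have hcast : ∀ ν : Mon n d → ℕ, deg (fun k => (ν k : ℤ)) = ∑ k, ν k • avec k := fun ν =>
    Finset.sum_congr rfl fun k _ => natCast_zsmul _ _
  rw [coeff_prodPoly, Hmat, Matrix.of_apply, AddMonoidAlgebra.coeff_sum, Finsupp.finsetSum_apply]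
  simp only [AddMonoidAlgebra.coeff_single, Finsupp.single_apply]
  split_ifs with h
  · obtain ⟨h1, h2⟩ := h
    choose c hc using fun k => Int.eq_ofNat_of_zero_le (h1 k)
    obtain rfl : l = fun k => (c k : ℤ) := funext hc
    have hlt : ∀ k, c k < p := fun k => by
      have h3 := congrArg Prod.snd h2
      rw [deg_snd] at h3
      have h4 := Finset.single_le_sum (f := fun k => (c k : ℤ)) (fun k _ => h1 k) (Finset.mem_univ k)
      have h5 : (p • avec i.1 - avec j.1 : Lat n).2 = (p : ℤ) - 1 := by
        change p • (1 : ℤ) - 1 = _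
        simp
      rw [h3, h5] at h4
      have h6 : (c k : ℤ) ≤ (p : ℤ) - 1 := h4
      omega
    rw [Finset.sum_eq_single c]
    · rw [if_pos rfl, ← Finset.prod_inv_distrib]
      exact Finset.prod_congr rfl fun k _ => (artinHasseC_of_lt (hlt k)).symm
    · intro ν _ hν
      exact if_neg fun h => hν (funext fun k => by exact_mod_cast congrFun h k)
    · intro hc
      refine absurd ?_ hc
      rw [Finset.mem_filter, Fintype.mem_piFinset]
      exact ⟨fun k => Finset.mem_range.2 (hlt k), by rw [← hcast, h2]⟩
  · refine Finset.sum_eq_zero fun ν hν => if_neg ?_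
    rintro rfl
    rw [Finset.mem_filter] at hν
    exact h ⟨fun k => Int.natCast_nonneg _, by rw [hcast, hν.2]⟩

variable (p n d) in
/-- `B(Λ)` as a matrix of series. -/
def gB : Matrix (Inn n d) (Inn n d) (GSer p n d) := (polyHom p n d).mapMatrix (Bmat ℂ_[p] p n d)

variable (p n d) in
/-- `D(Λ)` as a series. -/
def gD : GSer p n d := polyHom p n d (Dpoly ℂ_[p] p n d)

theorem det_gB : (gB p n d).det = gD p n d := by
  rw [gB, gD, Dpoly, RingHom.map_det]

theorem gB_apply (i j : Inn n d) : gB p n d i j =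
    mono (wt n d) (Pi.single j.1 1 - Pi.single i.1 (p : ℤ)) 1 *
      polyHom p n d (prodPoly (zcoeff (artinHasseC p)) (p • avec i.1 - avec j.1)) := by
  rw [gB, RingHom.mapMatrix_apply, Matrix.map_apply, Bmat, Matrix.of_apply, map_mul, polyHom_single,
    Hmat_eq]

theorem norm_coeff_prodPoly_le (s : Lat n) (l : Expo n d) :
    ‖(prodPoly (zcoeff (artinHasseC p)) s).coeff l‖ ≤ 1 := by
  classical
  rw [coeff_prodPoly]
  split_ifs
  · rw [norm_prod]
    exact Finset.prod_le_one (fun k _ => norm_nonneg _) fun k _ => norm_artinHasseC_le _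
  · simp

theorem bddBy_polyHom_prodPoly (s : Lat n) :
    BddBy (polyHom p n d (prodPoly (zcoeff (artinHasseC p)) s)) 1 := fun l => by
  rw [polyHom_coe]
  exact norm_coeff_prodPoly_le s l

theorem bddBy_gB (i j : Inn n d) : BddBy (gB p n d i j) 1 := by
  rw [gB_apply]
  exact (bddBy_mono (by simp)).mul_one_one (bddBy_polyHom_prodPoly _)

theorem gB_support {i j : Inn n d} {l : Expo n d} (hl : gB p n d i j l ≠ 0) :
    (∀ k, 0 ≤ (l - (Pi.single j.1 1 - Pi.single i.1 (p : ℤ)) : Expo n d) k) ∧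
      deg (l - (Pi.single j.1 1 - Pi.single i.1 (p : ℤ))) = p • avec i.1 - avec j.1 := by
  classical
  rw [gB_apply, mono_mul_apply, one_mul, polyHom_coe, ofPoly, coeff_prodPoly] at hl
  by_contra h
  exact hl (if_neg h)

theorem gB_mem_supportE (i j : Inn n d) : gB p n d i j ∈ supportE p n d := fun l hl => by
  obtain ⟨h1, h2⟩ := gB_support hl
  have hd : deg l = 0 := by
    rw [deg_sub, deg_sub, deg_single, deg_single, one_smul, natCast_zsmul] at h2
    have : deg l = p • avec i.1 - avec j.1 + (avec j.1 - p • avec i.1) := by rw [← h2]; abel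
    rw [this]; abel
  have h3 : ∀ k, k ≠ i.1 → 0 ≤ l k := fun k hk => by
    have := h1 k
    rw [Pi.sub_apply, Pi.sub_apply, Pi.single_eq_of_ne hk, sub_zero] at this
    have h4 := single_nonneg j.1 k
    linarith
  refine LSet_subset_ESet i ⟨hd, ?_, h3⟩
  have h5 := congrArg Prod.snd hd
  rw [deg_snd, ← Finset.add_sum_erase _ _ (Finset.mem_univ i.1)] at h5
  have h6 : 0 ≤ ∑ k ∈ Finset.univ.erase i.1, l k :=
    Finset.sum_nonneg fun k hk => h3 k (Finset.ne_of_mem_erase hk)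
  rw [Prod.snd_zero] at h5
  linarith

theorem gB_zero (i j : Inn n d) :
    gB p n d i j 0 = if i = j then ((p - 1).factorial : ℂ_[p])⁻¹ else 0 := by
  classical
  by_cases hij : i = j
  · subst hij
    have h1 : ((p : ℤ) - 1) = ((p - 1 : ℕ) : ℤ) := by
      have := hp.out.pos
      omega
    have h2 : (0 - (Pi.single i.1 1 - Pi.single i.1 (p : ℤ)) : Expo n d) =
        Pi.single i.1 ((p - 1 : ℕ) : ℤ) := by
      rw [← h1, zero_sub, neg_sub, ← Pi.single_sub]
    rw [if_pos rfl, gB_apply, mono_mul_apply, one_mul, polyHom_coe, ofPoly, coeff_prodPoly, h2,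
      if_pos]
    · rw [Finset.prod_eq_single i.1]
      · rw [Pi.single_eq_same, artinHasseC_of_lt (by have := hp.out.pos; omega)]
      · intro k _ hk
        rw [Pi.single_eq_of_ne hk]
        have := artinHasseC_of_lt (p := p) (m := 0) hp.out.pos
        simpa using this
      · exact fun h => absurd (Finset.mem_univ _) h
    · refine ⟨fun k => ?_, ?_⟩
      · rw [Pi.single_apply]; split_ifs <;> simp
      · rw [deg_single, ← h1, sub_smul, one_smul, natCast_zsmul]
  · rw [if_neg hij]
    by_contra hne
    have h := (gB_support hne).1 j.1
    have hij' : j.1 ≠ i.1 := fun h => hij (Subtype.ext h).symm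
    rw [Pi.sub_apply, Pi.sub_apply, Pi.single_eq_same, Pi.single_eq_of_ne hij', Pi.zero_apply] at h
    linarith

theorem norm_det_gB : ‖(gB p n d).det 0‖ = 1 := by
  rw [det_constTerm gB_mem_supportE]
  have h : (Matrix.of fun i j => gB p n d i j 0) =
      Matrix.diagonal fun _ => ((p - 1).factorial : ℂ_[p])⁻¹ := by
    ext i j
    rw [Matrix.of_apply, gB_zero, Matrix.diagonal_apply]
  refine (congrArg (fun M => ‖Matrix.det M‖) h).trans ?_
  rw [Matrix.det_diagonal, norm_prod]
  refine Finset.prod_eq_one fun _ _ => ?_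
  rw [norm_inv, norm_factorial_eq_one norm_prime (by have := hp.out.pos; omega), inv_one]

theorem gD_mem_supportE : gD p n d ∈ supportE p n d := by
  rw [← det_gB]; exact (adjugate_mem _ gB_mem_supportE).1

theorem bddBy_gD : BddBy (gD p n d) 1 := by
  rw [← det_gB]; exact (adjugate_mem (unitBall ℂ_[p] (wt n d)) bddBy_gB).1

theorem exists_inverse_gD : ∃ g ∈ supportE p n d, BddBy g 1 ∧ gD p n d * g = 1 :=
  exists_inverse_supportE gD_mem_supportE bddBy_gD (by rw [← det_gB]; exact norm_det_gB)

variable (p n d) in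
/-- `D(Λ)⁻¹`. -/
def gDinv : GSer p n d := exists_inverse_gD.choose

theorem gDinv_mem_supportE : gDinv p n d ∈ supportE p n d := exists_inverse_gD.choose_spec.1
theorem bddBy_gDinv : BddBy (gDinv p n d) 1 := exists_inverse_gD.choose_spec.2.1
theorem gD_mul_gDinv : gD p n d * gDinv p n d = 1 := exists_inverse_gD.choose_spec.2.2

theorem gD_pow_mul_gDinv_pow (k : ℕ) : gD p n d ^ k * gDinv p n d ^ k = 1 := by
  rw [← mul_pow, gD_mul_gDinv, one_pow]

/-- The Laurent polynomials whose exponents are nonnegative outside `U`. -/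
def polyNN (K : Type*) [Field K] (n d : ℕ) : Subring (LPoly K n d) where
  carrier := {h | ∀ l, h.coeff l ≠ 0 → NonnegOff l}
  mul_mem' := by
    classical
    intro a b ha hb l hl
    have h1 : l ∈ (a * b).coeff.support := Finsupp.mem_support_iff.2 hl
    have h2 := AddMonoidAlgebra.support_coeff_mul_subset _ _ h1
    obtain ⟨x, hx, y, hy, rfl⟩ := Finset.mem_add.1 h2
    exact fun k hk => add_nonneg (ha x (Finsupp.mem_support_iff.1 hx) k hk)
      (hb y (Finsupp.mem_support_iff.1 hy) k hk)
  one_mem' := by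
    classical
    intro l hl
    rw [AddMonoidAlgebra.one_def, AddMonoidAlgebra.coeff_single, Finsupp.single_apply] at hl
    by_cases h : 0 = l
    · subst h; exact fun _ _ => le_rfl
    · rw [if_neg h] at hl; exact absurd rfl hl
  add_mem' := by
    intro a b ha hb l hl
    rw [AddMonoidAlgebra.coeff_add, Finsupp.add_apply] at hl
    by_cases h : a.coeff l = 0
    · rw [h, zero_add] at hl; exact hb l hl
    · exact ha l h
  zero_mem' := fun l hl => absurd rfl hl
  neg_mem' := by
    intro a ha l hl
    rw [AddMonoidAlgebra.coeff_neg, Finsupp.neg_apply] at hl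
    exact ha l (neg_ne_zero.1 hl)

theorem single_mem_polyNN {K : Type*} [Field K] {m : Expo n d} (hm : NonnegOff m) (c : K) :
    AddMonoidAlgebra.single m c ∈ polyNN K n d := fun l hl => by
  classical
  rw [AddMonoidAlgebra.coeff_single, Finsupp.single_apply] at hl
  by_cases h : m = l
  · subst h; exact hm
  · rw [if_neg h] at hl; exact absurd rfl hl

theorem prodPoly_mem_polyNN {K : Type*} [Field K] (g : ℤ → K) (s : Lat n) :
    (prodPoly g s : LPoly K n d) ∈ polyNN K n d := fun l hl => by
  classical
  rw [coeff_prodPoly] at hl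
  by_contra h
  exact hl (if_neg fun h' => h fun k _ => h'.1 k)

theorem nonnegOff_single (j : Inn n d) (c : ℤ) : NonnegOff (Pi.single j.1 c : Expo n d) :=
  fun k hk => by
  rw [Pi.single_eq_of_ne]
  rintro rfl
  exact hk j.2

theorem NonnegOff.add {l m : Expo n d} (hl : NonnegOff l) (hm : NonnegOff m) : NonnegOff (l + m) :=
  fun k hk => add_nonneg (hl k hk) (hm k hk)

theorem Bmat_mem_polyNN (K : Type*) [Field K] (i j : Inn n d) : Bmat K p n d i j ∈ polyNN K n d := by
  rw [Bmat, Matrix.of_apply]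
  refine mul_mem (single_mem_polyNN ?_ _) ?_
  · rw [sub_eq_add_neg, ← Pi.single_neg]
    exact (nonnegOff_single j 1).add (nonnegOff_single i _)
  · rw [Hmat, Matrix.of_apply]
    exact sum_mem fun ν _ => single_mem_polyNN (fun k _ => Int.natCast_nonneg _) _

theorem Dpoly_mem_polyNN (K : Type*) [Field K] : Dpoly K p n d ∈ polyNN K n d :=
  (adjugate_mem (polyNN K n d) (Bmat_mem_polyNN K)).1

variable (p n d) in
/-- The ring of the quotients `h / D^k`. -/
def fracRing : Subring (GSer p n d) where
  carrier := {a | ∃ h ∈ polyNN ℂ_[p] n d, ∃ k : ℕ, a = polyHom p n d h * gDinv p n d ^ k}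
  mul_mem' := by
    rintro _ _ ⟨h, hh, k, rfl⟩ ⟨h', hh', k', rfl⟩
    exact ⟨h * h', mul_mem hh hh', k + k', by rw [map_mul, pow_add]; ring⟩
  one_mem' := ⟨1, one_mem _, 0, by rw [map_one, pow_zero, one_mul]⟩
  add_mem' := by
    rintro _ _ ⟨h, hh, k, rfl⟩ ⟨h', hh', k', rfl⟩
    refine ⟨h * Dpoly ℂ_[p] p n d ^ k' + h' * Dpoly ℂ_[p] p n d ^ k,
      add_mem (mul_mem hh (pow_mem (Dpoly_mem_polyNN _) _))
        (mul_mem hh' (pow_mem (Dpoly_mem_polyNN _) _)), k + k', ?_⟩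
    have h1 := gD_pow_mul_gDinv_pow (p := p) (n := n) (d := d) k
    have h2 := gD_pow_mul_gDinv_pow (p := p) (n := n) (d := d) k'
    rw [map_add, map_mul, map_mul, map_pow, map_pow, pow_add]
    change _ = (polyHom p n d h * gD p n d ^ k' + polyHom p n d h' * gD p n d ^ k) * _
    linear_combination (-(polyHom p n d h * gDinv p n d ^ k)) * h2 -
      (polyHom p n d h' * gDinv p n d ^ k') * h1
  zero_mem' := ⟨0, zero_mem _, 0, by rw [map_zero, zero_mul]⟩
  neg_mem' := by
    rintro _ ⟨h, hh, k, rfl⟩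
    exact ⟨-h, neg_mem hh, k, by rw [map_neg, neg_mul]⟩

theorem polyHom_mem_fracRing {h : LPoly ℂ_[p] n d} (hh : h ∈ polyNN ℂ_[p] n d) :
    polyHom p n d h ∈ fracRing p n d := ⟨h, hh, 0, by rw [pow_zero, mul_one]⟩

theorem gDinv_mem_fracRing : gDinv p n d ∈ fracRing p n d :=
  ⟨1, one_mem _, 1, by rw [map_one, one_mul, pow_one]⟩

theorem mono_mem_fracRing {m : Expo n d} (hm : NonnegOff m) (c : ℂ_[p]) :
    mono (wt n d) m c ∈ fracRing p n d := by
  rw [← polyHom_single]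
  exact polyHom_mem_fracRing (single_mem_polyNN hm c)

theorem const_mem_fracRing (c : ℂ_[p]) : const ℂ_[p] (wt n d) c ∈ fracRing p n d :=
  mono_mem_fracRing (fun _ _ => le_rfl) c

/-! ### The Frobenius on localizations -/

variable (p n d) in
/-- The series `f` of norm at most one with `f(Λ^p) ≡ f(Λ)^p` modulo `p`. -/
def frobCongr : Subring (GSer p n d) where
  carrier := {f | BddBy f 1 ∧ BddBy (frobHom p n d f - f ^ p) (p : ℝ)⁻¹}
  mul_mem' := by
    rintro a b ⟨ha, ha'⟩ ⟨hb, hb'⟩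
    refine ⟨ha.mul_one_one hb, ?_⟩
    have : frobHom p n d (a * b) - (a * b) ^ p = frobHom p n d a * (frobHom p n d b - b ^ p) +
        (frobHom p n d a - a ^ p) * b ^ p := by rw [map_mul, mul_pow]; ring
    rw [this]
    exact (BddBy.unitBall_mul (bddBy_frobHom ha) hb').add
      (ha'.mul_unitBall (pow_mem (show b ∈ unitBall ℂ_[p] (wt n d) from hb) p))
  one_mem' := ⟨bddBy_one, by
    rw [map_one, one_pow, sub_self]; exact bddBy_zero (by positivity)⟩
  add_mem' := by
    rintro a b ⟨ha, ha'⟩ ⟨hb, hb'⟩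
    refine ⟨ha.add hb, ?_⟩
    obtain ⟨r, hr⟩ := exists_add_pow_prime_eq hp.out (⟨a, ha⟩ : unitBall ℂ_[p] (wt n d)) ⟨b, hb⟩
    have hr' : (a + b) ^ p = a ^ p + b ^ p + p * a * b * r.1 := congrArg Subtype.val hr
    have hpc : (p : GSer p n d) = const ℂ_[p] (wt n d) (p : ℂ_[p]) := (map_natCast _ _).symm
    have : frobHom p n d (a + b) - (a + b) ^ p = (frobHom p n d a - a ^ p) +
        (frobHom p n d b - b ^ p) - const ℂ_[p] (wt n d) (p : ℂ_[p]) * (a * b * r.1) := by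
      rw [map_add, hr', ← hpc]; ring
    rw [this]
    exact (ha'.add hb').sub (BddBy.mul_unitBall (bddBy_const norm_prime.le)
      ((ha.mul_one_one hb).mul_one_one r.2))
  zero_mem' := ⟨bddBy_zero zero_le_one, by
    rw [map_zero, zero_pow hp.out.ne_zero, sub_zero]; exact bddBy_zero (by positivity)⟩
  neg_mem' := by
    rintro a ⟨ha, ha'⟩
    refine ⟨ha.neg, ?_⟩
    rcases hp.out.eq_two_or_odd' with h2 | hodd
    · have h2' : (-a) ^ p = a ^ p := Even.neg_pow (by rw [h2]; exact even_two) a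
      have hpc : (2 : GSer p n d) = const ℂ_[p] (wt n d) (p : ℂ_[p]) := by
        rw [map_natCast, show ((p : ℕ) : GSer p n d) = ((2 : ℕ) : GSer p n d) from
          congrArg Nat.cast h2, Nat.cast_ofNat]
      have : frobHom p n d (-a) - (-a) ^ p = -(frobHom p n d a - a ^ p) -
          const ℂ_[p] (wt n d) (p : ℂ_[p]) * a ^ p := by
        rw [map_neg, h2', ← hpc]; ring
      rw [this]
      exact ha'.neg.sub (BddBy.mul_unitBall (bddBy_const norm_prime.le)
        (pow_mem (show a ∈ unitBall ℂ_[p] (wt n d) from ha) p))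
    · have : frobHom p n d (-a) - (-a) ^ p = -(frobHom p n d a - a ^ p) := by
        rw [map_neg, hodd.neg_pow]; ring
      rw [this]
      exact ha'.neg

theorem norm_natCast_sub_pow_le (N : ℕ) : ‖((N : ℂ_[p]) - (N : ℂ_[p]) ^ p)‖ ≤ (p : ℝ)⁻¹ := by
  have h1 : ((p : ℤ)) ∣ (N : ℤ) - (N : ℤ) ^ p := by
    rw [← ZMod.intCast_zmod_eq_zero_iff_dvd]
    push_cast
    rw [ZMod.pow_card, sub_self]
  obtain ⟨c, hc⟩ := h1
  have h2 : (N : ℂ_[p]) - (N : ℂ_[p]) ^ p = (p : ℂ_[p]) * (c : ℂ_[p]) := by exact_mod_cast congrArg (Int.cast (R := ℂ_[p])) hc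
  rw [h2, norm_mul, norm_prime]
  refine mul_le_of_le_one_right (by positivity) ?_
  exact IsUltrametricDist.norm_intCast_le_one _ c

theorem norm_inv_sub_pow_le {N : ℕ} (hN : ‖(N : ℂ_[p])‖ = 1) :
    ‖((N : ℂ_[p])⁻¹ - (N : ℂ_[p])⁻¹ ^ p)‖ ≤ (p : ℝ)⁻¹ := by
  have h0 : (N : ℂ_[p]) ≠ 0 := norm_ne_zero_iff.1 (by rw [hN]; exact one_ne_zero)
  have : (N : ℂ_[p])⁻¹ - (N : ℂ_[p])⁻¹ ^ p = -(((N : ℂ_[p]) - (N : ℂ_[p]) ^ p) * ((N : ℂ_[p])⁻¹ ^ (p + 1))) := by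
    have h1 : ((N : ℂ_[p]) - (N : ℂ_[p]) ^ p) * ((N : ℂ_[p])⁻¹ ^ (p + 1)) =
        (N : ℂ_[p]) * (N : ℂ_[p])⁻¹ * (N : ℂ_[p])⁻¹ ^ p -
          ((N : ℂ_[p]) * (N : ℂ_[p])⁻¹) ^ p * (N : ℂ_[p])⁻¹ := by
      rw [mul_pow, pow_succ]; ring
    rw [h1, mul_inv_cancel₀ h0, one_pow]; ring
  rw [this, norm_neg, norm_mul, norm_pow, norm_inv, hN, inv_one, one_pow, mul_one]
  exact norm_natCast_sub_pow_le N

theorem mono_mem_frobCongr (m : Expo n d) {c : ℂ_[p]} (hc : ‖c‖ ≤ 1) (hc' : ‖c - c ^ p‖ ≤ (p : ℝ)⁻¹) :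
    mono (wt n d) m c ∈ frobCongr p n d := by
  have hpow : ∀ k : ℕ, mono (wt n d) m c ^ k = mono (wt n d) (k • m) (c ^ k) := fun k => by
    induction k with
    | zero => rw [pow_zero, zero_smul, pow_zero, mono_zero_one]
    | succ k ih => rw [pow_succ, ih, mono_mul_mono, succ_nsmul, pow_succ]
  refine ⟨bddBy_mono hc, ?_⟩
  rw [frobHom_mono, hpow, sub_eq_iff_eq_add.2 (show mono (wt n d) (p • m) c =
    mono (wt n d) (p • m) (c - c ^ p) + mono (wt n d) (p • m) (c ^ p) by
      rw [← mono_add, sub_add_cancel])]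
  exact bddBy_mono hc'

theorem gD_mem_frobCongr : gD p n d ∈ frobCongr p n d := by
  rw [← det_gB]
  refine (adjugate_mem _ fun i j => ?_).1
  rw [gB, RingHom.mapMatrix_apply, Matrix.map_apply, Bmat, Matrix.of_apply, map_mul, polyHom_single,
    Hmat, Matrix.of_apply, map_sum]
  refine mul_mem (mono_mem_frobCongr _ (by simp) (by simp)) (sum_mem fun ν hν => ?_)
  rw [Finset.mem_filter, Fintype.mem_piFinset] at hν
  have hN : ‖((∏ k, (ν k).factorial : ℕ) : ℂ_[p])‖ = 1 := by
    rw [Nat.cast_prod, norm_prod]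
    exact Finset.prod_eq_one fun k _ =>
      norm_factorial_eq_one norm_prime (Finset.mem_range.1 (hν.1 k))
  rw [polyHom_single]
  have h := norm_inv_sub_pow_le hN
  rw [Nat.cast_prod] at h hN
  exact mono_mem_frobCongr _ (by rw [norm_inv, hN, inv_one]) h

theorem bddBy_frob_gD_sub : BddBy (frobHom p n d (gD p n d) - gD p n d ^ p) (p : ℝ)⁻¹ :=
  gD_mem_frobCongr.2

theorem NonnegOff.nsmul {l : Expo n d} (hl : NonnegOff l) (c : ℕ) : NonnegOff (c • l) :=
  fun k hk => nsmul_nonneg (hl k hk) c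

theorem eq_sum_single {K : Type*} [Field K] (h : LPoly K n d) :
    h = ∑ l ∈ h.coeff.support, AddMonoidAlgebra.single l (h.coeff l) := by
  classical
  refine AddMonoidAlgebra.coeff_injective (Finsupp.ext fun l => ?_)
  rw [AddMonoidAlgebra.coeff_sum, Finsupp.finsetSum_apply]
  simp only [AddMonoidAlgebra.coeff_single, Finsupp.single_apply]
  rw [Finset.sum_ite_eq']
  split_ifs with h1
  · rfl
  · exact Finsupp.notMem_support_iff.1 h1

/-- `h(Λ^p)` for a Laurent polynomial `h`. -/
def polyFrob (p : ℕ) {K : Type*} [Field K] (h : LPoly K n d) : LPoly K n d :=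
  ∑ l ∈ h.coeff.support, AddMonoidAlgebra.single (p • l) (h.coeff l)

theorem polyFrob_mem_polyNN {K : Type*} [Field K] {h : LPoly K n d} (hh : h ∈ polyNN K n d) :
    polyFrob p h ∈ polyNN K n d :=
  sum_mem fun l hl => single_mem_polyNN ((hh l (Finsupp.mem_support_iff.1 hl)).nsmul p) _

theorem frobHom_polyHom (h : LPoly ℂ_[p] n d) :
    frobHom p n d (polyHom p n d h) = polyHom p n d (polyFrob p h) := by
  conv_lhs => rw [eq_sum_single h]
  rw [polyFrob, map_sum, map_sum, map_sum]
  refine Finset.sum_congr rfl fun l _ => ?_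
  rw [polyHom_single, polyHom_single, frobHom_mono]

variable {ε : ℝ} {hε : 0 ≤ ε} {hε1 : ε ≤ 1}

theorem frobHom_gDinv_mem (hε0 : 0 < ε) :
    frobHom p n d (gDinv p n d) ∈ nearRing ℂ_[p] (wt n d) (fracRing p n d) ε hε hε1 := by
  have hp1 : (1 : ℝ) < p := by exact_mod_cast hp.out.one_lt
  refine inv_mem_nearRing hε0 (inv_lt_one_of_one_lt₀ hp1) (δ := frobHom p n d (gD p n d))
    (δ₀ := gD p n d ^ p) (e := gDinv p n d ^ p) ?_ ?_ (gD_pow_mul_gDinv_pow p)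
    (bddBy_frobHom bddBy_gDinv) (by rw [← map_mul, gD_mul_gDinv, map_one]) bddBy_frob_gD_sub
  · refine mem_nearRing_of_mem ?_ (bddBy_frobHom bddBy_gD)
    rw [gD, frobHom_polyHom]
    exact polyHom_mem_fracRing (polyFrob_mem_polyNN (Dpoly_mem_polyNN _))
  · exact mem_nearRing_of_mem (pow_mem gDinv_mem_fracRing p)
      (pow_mem (show gDinv p n d ∈ unitBall ℂ_[p] (wt n d) from bddBy_gDinv) p)

end Denominator

section Closure

variable {K : Type*} [NormedField K] [IsUltrametricDist K] [CompleteSpace K]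
  {Γ : Type*} [AddCommGroup Γ] {φ : Γ → ℤ} [PointedWeight φ]

/-- The closure of a subring. -/
def closRing (S : Subring (ConvRing K φ)) : Subring (ConvRing K φ) where
  carrier := {a | ∀ ε > 0, ∃ s ∈ S, BddBy (a - s) ε}
  mul_mem' := by
    intro a b ha hb ε hε
    obtain ⟨C, hC, haC⟩ := exists_bddBy a
    obtain ⟨D, hD, hbD⟩ := exists_bddBy b
    obtain ⟨t, ht, hbt⟩ := hb (min (ε / C) D) (by positivity)
    obtain ⟨s, hs, has⟩ := ha (ε / D) (by positivity)
    refine ⟨s * t, mul_mem hs ht, ?_⟩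
    have htD : BddBy t D := by
      have := hbD.sub (hbt.mono_right (min_le_right _ _))
      rwa [sub_sub_cancel] at this
    have h1 : a * b - s * t = a * (b - t) + (a - s) * t := by ring
    rw [h1]
    refine BddBy.add ((haC.mul (hbt.mono_right (min_le_left _ _))).mono_right ?_)
      ((has.mul htD).mono_right ?_)
    · rw [mul_div_cancel₀ _ hC.ne']
    · rw [div_mul_cancel₀ _ hD.ne']
  one_mem' := fun ε hε => ⟨1, one_mem _, by rw [sub_self]; exact bddBy_zero hε.le⟩
  add_mem' := by
    intro a b ha hb ε hε
    obtain ⟨t, ht, hbt⟩ := hb ε hε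
    obtain ⟨s, hs, has⟩ := ha ε hε
    refine ⟨s + t, add_mem hs ht, ?_⟩
    rw [add_sub_add_comm]
    exact has.add hbt
  zero_mem' := fun ε hε => ⟨0, zero_mem _, by rw [sub_self]; exact bddBy_zero hε.le⟩
  neg_mem' := by
    intro a ha ε hε
    obtain ⟨s, hs, has⟩ := ha ε hε
    refine ⟨-s, neg_mem hs, ?_⟩
    rw [← neg_sub']
    exact has.neg

variable {S : Subring (ConvRing K φ)}

theorem le_closRing : S ≤ closRing S := fun a ha ε hε =>
  ⟨a, ha, by rw [sub_self]; exact bddBy_zero hε.le⟩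

variable {ε : ℝ} {hε : 0 ≤ ε} {hε1 : ε ≤ 1}

theorem mem_nearRing_of_closRing {a : ConvRing K φ} (ha : a ∈ closRing S) (h1 : BddBy a 1)
    (hε0 : 0 < ε) : a ∈ nearRing K φ S ε hε hε1 := ⟨h1, ha ε hε0⟩

/-- An element which lies within `η^k` of the subring for all `k` lies in the closure. -/
theorem mem_closRing_of_near {a : ConvRing K φ} {η : ℝ} (hη0 : 0 ≤ η) (hη : η < 1)
    (h : ∀ k : ℕ, a ∈ nearRing K φ S (η ^ k) (pow_nonneg hη0 k) (pow_le_one₀ hη0 hη.le)) :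
    a ∈ closRing S := fun ε hε => by
  obtain ⟨k, hk⟩ := exists_pow_lt_of_lt_one hε hη
  obtain ⟨-, s, hs, has⟩ := h k
  exact ⟨s, hs, has.mono_right hk.le⟩

theorem mul_mem_nearRing {a b : ConvRing K φ} {η δ : ℝ} {hη : 0 ≤ η} {hη1 : η ≤ 1} (hb : b ∈ S)
    (hbδ : BddBy b δ) (hδ : δ ≤ 1) (hδε : δ * η ≤ ε) (ha : a ∈ nearRing K φ S η hη hη1) :
    b * a ∈ nearRing K φ S ε hε hε1 := by
  obtain ⟨h1, s, hs, h2⟩ := ha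
  refine ⟨(hbδ.mono_right hδ).mul_one_one h1, b * s, mul_mem hb hs, ?_⟩
  rw [← mul_sub]
  exact (hbδ.mul h2).mono_right hδε

end Closure

section Contraction

variable {p : ℕ} [hp : Fact p.Prime] {n d : ℕ} {γ : ℂ_[p]}

theorem frobHom_mem_nearRing {ε : ℝ} {hε : 0 ≤ ε} {hε1 : ε ≤ 1} (hε0 : 0 < ε) {a : GSer p n d}
    (ha : a ∈ nearRing ℂ_[p] (wt n d) (fracRing p n d) ε hε hε1) :
    frobHom p n d a ∈ nearRing ℂ_[p] (wt n d) (fracRing p n d) ε hε hε1 := by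
  obtain ⟨h1, s, ⟨h, hh, k, rfl⟩, h2⟩ := ha
  have hs1 : BddBy (polyHom p n d h * gDinv p n d ^ k) 1 := by
    have := h1.sub (h2.mono_right hε1)
    rwa [sub_sub_cancel] at this
  have hh1 : BddBy (polyHom p n d h) 1 := by
    have h3 := hs1.mul_unitBall (pow_mem (show gD p n d ∈ unitBall ℂ_[p] (wt n d) from bddBy_gD) k)
    rwa [mul_assoc, mul_comm (_ ^ k), gD_pow_mul_gDinv_pow, mul_one] at h3
  refine mem_nearRing_of_sub (a := frobHom p n d (polyHom p n d h * gDinv p n d ^ k)) ?_ ?_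
  · rw [map_mul, map_pow]
    refine mul_mem (mem_nearRing_of_mem ?_ (bddBy_frobHom hh1)) (pow_mem (frobHom_gDinv_mem hε0) k)
    rw [frobHom_polyHom]
    exact polyHom_mem_fracRing (polyFrob_mem_polyNN hh)
  · rw [← map_sub]
    exact bddBy_frobHom h2

theorem exists_inverse_gG (hγ : IsGamma γ) : ∃ Y : Matrix (Inn n d) (Inn n d) (GSer p n d),
    (∀ i j, Y i j ∈ supportE p n d) ∧ (∀ i j, BddBy (Y i j) 1) ∧ gG n d γ * Y = 1 :=
  exists_matrix_inverse (gG_mem_supportE hγ) (bddBy_gG hγ) (norm_det_gG hγ)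

theorem exists_inverse_gF : ∃ Y : Matrix (Inn n d) (Inn n d) (GSer p n d),
    (∀ i j, Y i j ∈ supportE p n d) ∧ (∀ i j, BddBy (Y i j) 1) ∧ gF p n d * Y = 1 :=
  exists_matrix_inverse gF_mem_supportE bddBy_gF norm_det_gF

variable (n d) in
/-- `G(Λ)⁻¹`. -/
def gGinv (hγ : IsGamma γ) : Matrix (Inn n d) (Inn n d) (GSer p n d) := (exists_inverse_gG hγ).choose

variable (p n d) in
/-- `F(Λ)⁻¹`. -/
def gFinv : Matrix (Inn n d) (Inn n d) (GSer p n d) := exists_inverse_gF.choose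

theorem gGinv_mem_supportE (hγ : IsGamma γ) (i j : Inn n d) : gGinv n d hγ i j ∈ supportE p n d :=
  (exists_inverse_gG hγ).choose_spec.1 i j
theorem bddBy_gGinv (hγ : IsGamma γ) (i j : Inn n d) : BddBy (gGinv n d hγ i j) 1 :=
  (exists_inverse_gG hγ).choose_spec.2.1 i j
theorem gG_mul_gGinv (hγ : IsGamma γ) : gG n d γ * gGinv n d hγ = 1 :=
  (exists_inverse_gG hγ).choose_spec.2.2
theorem gGinv_mul_gG (hγ : IsGamma γ) : gGinv n d hγ * gG n d γ = 1 :=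
  mul_eq_one_comm.1 (gG_mul_gGinv hγ)

theorem gFinv_mem_supportE (i j : Inn n d) : gFinv p n d i j ∈ supportE p n d :=
  exists_inverse_gF.choose_spec.1 i j
theorem bddBy_gFinv (i j : Inn n d) : BddBy (gFinv p n d i j) 1 :=
  exists_inverse_gF.choose_spec.2.1 i j
theorem gF_mul_gFinv : gF p n d * gFinv p n d = 1 := exists_inverse_gF.choose_spec.2.2

/-- The vector of the `G^{(i)}_u`. -/
def vG (γ : ℂ_[p]) (u : Lat n) : Inn n d → GSer p n d := fun i => liftSer (Gser γ i u)

variable (p) in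
/-- The vector of the `F^{(i)}_u`. -/
def vF (u : Lat n) : Inn n d → GSer p n d := fun i => liftSer (Fser p i u)

theorem bddBy_mulVec {X : Matrix (Inn n d) (Inn n d) (GSer p n d)} {v : Inn n d → GSer p n d}
    {C : ℝ} (hC : 0 ≤ C) (hX : ∀ i j, BddBy (X i j) 1) (hv : ∀ i, BddBy (v i) C) (i : Inn n d) :
    BddBy (X.mulVec v i) C :=
  bddBy_sum hC fun k _ => BddBy.unitBall_mul (hX i k) (hv k)

theorem bddBy_matrix_mul {X Y : Matrix (Inn n d) (Inn n d) (GSer p n d)}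
    {C : ℝ} (hC : 0 ≤ C) (hX : ∀ i j, BddBy (X i j) 1) (hY : ∀ i j, BddBy (Y i j) C) (i j : Inn n d) :
    BddBy ((X * Y) i j) C := by
  rw [Matrix.mul_apply]
  exact bddBy_sum hC fun k _ => BddBy.unitBall_mul (hX i k) (hY k j)

theorem mulVec_mem {R : Type*} [CommRing R] {ι : Type*} [Fintype ι] (T : Subring R)
    {X : Matrix ι ι R} {v : ι → R} (hX : ∀ i j, X i j ∈ T) (hv : ∀ i, v i ∈ T) (i : ι) :
    X.mulVec v i ∈ T :=
  sum_mem fun k _ => mul_mem (hX i k) (hv k)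

theorem matrix_mul_mem {R : Type*} [CommRing R] {ι : Type*} [Fintype ι] (T : Subring R)
    {X Y : Matrix ι ι R} (hX : ∀ i j, X i j ∈ T) (hY : ∀ i j, Y i j ∈ T) (i j : ι) :
    (X * Y) i j ∈ T := by
  rw [Matrix.mul_apply]
  exact sum_mem fun k _ => mul_mem (hX i k) (hY k j)

theorem bddBy_vG (hγ : IsGamma γ) {u : Lat n} (hu : u ∈ MMinus n d) (i : Inn n d) :
    BddBy (vG γ u i) ‖((len u - 1).factorial : ℂ_[p])‖ := fun l => by
  rw [vG, coe_liftSer_G hγ i hu]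
  exact norm_Gser_le hγ i hu l

theorem bddBy_vF {u : Lat n} (hu : u ∈ MMinus n d) (i : Inn n d) :
    BddBy (vF p u i) ‖((len u - 1).factorial : ℂ_[p])‖ := fun l => by
  rw [vF, coe_liftSer_F i hu]
  exact norm_Fser_le i hu l

/-- The vector `G(Λ)⁻¹ G_u(Λ)`. -/
def vY (hγ : IsGamma γ) (u : Lat n) : Inn n d → GSer p n d := (gGinv n d hγ).mulVec (vG γ u)

theorem gG_mulVec_vY (hγ : IsGamma γ) (u : Lat n) : (gG n d γ).mulVec (vY hγ u) = vG γ u := by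
  rw [vY, Matrix.mulVec_mulVec, gG_mul_gGinv, Matrix.one_mulVec]

theorem bddBy_vY (hγ : IsGamma γ) {u : Lat n} (hu : u ∈ MMinus n d) (i : Inn n d) :
    BddBy (vY hγ u i) 1 :=
  bddBy_mulVec zero_le_one (bddBy_gGinv hγ)
    (fun j => (bddBy_vG hγ hu j).mono_right (norm_factorial_le_one _)) i

theorem mono_mul_neg (m : Expo n d) : mono (wt n d) (-m) (1 : ℂ_[p]) * mono (wt n d) m 1 = 1 := by
  rw [mono_mul_mono, neg_add_cancel, one_mul, mono_zero_one]

theorem mulVec_mono_mul (X : Matrix (Inn n d) (Inn n d) (GSer p n d)) (a : GSer p n d)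
    (w : Inn n d → GSer p n d) : X.mulVec (fun i => a * w i) = fun i => a * X.mulVec w i := by
  funext i
  simp only [Matrix.mulVec, dotProduct, Finset.mul_sum]
  exact Finset.sum_congr rfl fun k _ => by ring

theorem vG_neg_avec (γ : ℂ_[p]) (j : Inn n d) : vG γ (-avec j.1) =
    fun i => mono (wt n d) (-Pi.single j.1 1) 1 * gG n d γ i j := by
  funext i
  rw [gG, Matrix.of_apply, ← mul_assoc, mono_mul_neg, one_mul]
  rfl

theorem vF_neg_avec (j : Inn n d) : vF p (-avec j.1) =
    fun i => mono (wt n d) (-Pi.single j.1 1) 1 * gF p n d i j := by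
  funext i
  rw [gF, Matrix.of_apply, ← mul_assoc, mono_mul_neg, one_mul]
  rfl

theorem vY_neg_avec (hγ : IsGamma γ) (i j : Inn n d) : vY hγ (-avec j.1) i =
    if i = j then mono (wt n d) (-Pi.single j.1 1) 1 else 0 := by
  have h1 : (gGinv n d hγ * gG n d γ) i j = if i = j then 1 else 0 := by
    rw [gGinv_mul_gG, Matrix.one_apply]
  rw [vY, vG_neg_avec, mulVec_mono_mul]
  change mono (wt n d) (-Pi.single j.1 1) 1 * (gGinv n d hγ * gG n d γ) i j = _
  rw [h1]
  split_ifs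
  · rw [mul_one]
  · rw [mul_zero]

/-- A Frobenius matrix of `G`, up to a constant. -/
def frobMat (hγ : IsGamma γ) (κ : ℂ_[p]) : Matrix (Inn n d) (Inn n d) (GSer p n d) :=
  const ℂ_[p] (wt n d) (κ * (γ ^ (p - 1))⁻¹) • ((frobHom p n d).mapMatrix (gGinv n d hγ) * gG n d γ)

/-- The relation satisfied by the constant `κ`. -/
def IsEigen (γ κ : ℂ_[p]) : Prop := ‖κ‖ = (p : ℝ)⁻¹ ∧ ∀ l < 0, HasSum (fun a : ℤ =>
      lamb γ ^ a * negPart (thetaOne γ) a * zcoeff (artinHasseC p) (l - p * a))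
      (κ * negPart (thetaOne γ) l)

variable {κ : ℂ_[p]}

theorem IsEigen.norm_rho (hγ : IsGamma γ) (hκ : IsEigen γ κ) : ‖κ * (γ ^ (p - 1))⁻¹‖ = 1 := by
  have hp0 : (p : ℝ) ≠ 0 := by exact_mod_cast hp.out.ne_zero
  have h := hγ.norm_lamb
  rw [lamb] at h
  rw [norm_mul, h, hκ.1, inv_mul_cancel₀ hp0]

theorem frobMat_mulVec_vY (hγ : IsGamma γ) (u : Lat n) (i : Inn n d) :
    (frobMat hγ κ).mulVec (vY hγ u) i = const ℂ_[p] (wt n d) (γ ^ (p - 1))⁻¹ *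
      ∑ j, frobHom p n d (gGinv n d hγ i j) * (const ℂ_[p] (wt n d) κ * vG γ u j) := by
  rw [frobMat, Matrix.smul_mulVec, ← Matrix.mulVec_mulVec, gG_mulVec_vY, Pi.smul_apply,
    smul_eq_mul, map_mul, Matrix.mulVec, dotProduct, Finset.mul_sum, Finset.mul_sum]
  refine Finset.sum_congr rfl fun k _ => ?_
  rw [RingHom.mapMatrix_apply, Matrix.map_apply]
  ring

theorem frobHom_vY (hγ : IsGamma γ) (u : Lat n) (i : Inn n d) : frobHom p n d (vY hγ u i) =
    ∑ j, frobHom p n d (gGinv n d hγ i j) * frobHom p n d (vG γ u j) := by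
  rw [vY, Matrix.mulVec, dotProduct, map_sum]
  exact Finset.sum_congr rfl fun k _ => map_mul _ _ _

/-- The Frobenius relation for the vectors `G⁻¹ G_u`. -/
theorem bddBy_frobMat_sub (hγ : IsGamma γ) (hκ : IsEigen γ κ) {u : Lat n} (hu : u ∈ MMinus n d)
    (i : Inn n d) (K : ℕ) :
    BddBy ((frobMat hγ κ).mulVec (vY hγ u) i - ∑ v ∈ finMM n d K,
      const ℂ_[p] (wt n d) ((γ ^ (p - 1)) ^ (len v - 1)) * (frobHom p n d (vY hγ v i) *
        polyHom p n d (prodPoly (zcoeff (artinHasseC p)) (u - p • v)))) ((p : ℝ)⁻¹ ^ K) := by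
  have hp0 : (p : ℝ) ≠ 0 := by exact_mod_cast hp.out.ne_zero
  have hw : γ ^ (p - 1) ≠ 0 := pow_ne_zero _ hγ.ne_zero
  have h1 : ∀ j : Inn n d, BddBy _ _ := fun j => bddBy_frobenius hγ hκ.2 j hu K
  have h2 : (frobMat hγ κ).mulVec (vY hγ u) i - ∑ v ∈ finMM n d K,
      const ℂ_[p] (wt n d) ((γ ^ (p - 1)) ^ (len v - 1)) * (frobHom p n d (vY hγ v i) *
        polyHom p n d (prodPoly (zcoeff (artinHasseC p)) (u - p • v))) =
      const ℂ_[p] (wt n d) (γ ^ (p - 1))⁻¹ * ∑ j, frobHom p n d (gGinv n d hγ i j) *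
        (const ℂ_[p] (wt n d) κ * liftSer (Gser γ j u) -
      ∑ v ∈ finMM n d K, const ℂ_[p] (wt n d) ((γ ^ (p - 1)) ^ len v) *
        (frobHom p n d (liftSer (Gser γ j v)) *
          polyHom p n d (prodPoly (zcoeff (artinHasseC p)) (u - p • v)))) := by
    simp only [mul_sub, Finset.sum_sub_distrib]
    rw [frobMat_mulVec_vY]
    congr 1
    simp only [Finset.mul_sum]
    rw [Finset.sum_comm]
    refine Finset.sum_congr rfl fun v hv => ?_
    rw [frobHom_vY, Finset.sum_mul, Finset.mul_sum]
    refine Finset.sum_congr rfl fun j _ => ?_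
    have h3 : (γ ^ (p - 1)) ^ (len v - 1) = (γ ^ (p - 1))⁻¹ * (γ ^ (p - 1)) ^ len v := by
      have h4 := len_pos (mem_finMM.1 hv).1
      obtain ⟨m, hm⟩ : ∃ m, len v = m + 1 := ⟨len v - 1, by omega⟩
      rw [hm, Nat.add_sub_cancel, pow_succ', inv_mul_cancel_left₀ hw]
    rw [h3, map_mul, vG]
    ring
  rw [h2]
  refine (BddBy.mul (C := (p : ℝ)) (bddBy_const ?_) (bddBy_sum (C := (p : ℝ)⁻¹ ^ (K + 1))
    (by positivity) fun j _ => BddBy.unitBall_mul (bddBy_frobHom (bddBy_gGinv hγ i j)) (h1 j))).mono_right ?_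
  · have h := hγ.norm_lamb
    rw [lamb] at h
    exact h.le
  · rw [pow_succ', mul_inv_cancel_left₀ hp0]

theorem frobMat_apply (hγ : IsGamma γ) (i j : Inn n d) : frobMat hγ κ i j =
    mono (wt n d) (Pi.single j.1 1) 1 * (frobMat hγ κ).mulVec (vY hγ (-avec j.1)) i := by
  rw [Matrix.mulVec, dotProduct, Finset.sum_eq_single j]
  · rw [vY_neg_avec, if_pos rfl, mul_comm (frobMat hγ κ i j), ← mul_assoc, mono_mul_mono,
      add_neg_cancel, one_mul, mono_zero_one, one_mul]
  · intro k _ hk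
    rw [vY_neg_avec, if_neg hk, mul_zero]
  · exact fun h => absurd (Finset.mem_univ _) h

theorem avec_injective : Function.Injective (avec (n := n) (d := d)) := fun a b h =>
  Subtype.ext (funext fun i => by
    have := congrFun (congrArg Prod.fst h) i
    simp only [avec] at this
    exact_mod_cast this)

theorem finMM_one : finMM n d 1 = Finset.univ.image fun j : Inn n d => -avec j.1 := by
  ext v
  rw [mem_finMM, Finset.mem_image]
  constructor
  · rintro ⟨h1, h2⟩
    obtain ⟨j, rfl⟩ := eq_neg_avec_of_len h1 (by have := len_pos h1; omega)
    exact ⟨j, Finset.mem_univ _, rfl⟩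
  · rintro ⟨j, -, rfl⟩
    exact ⟨neg_avec_mem_MMinus j, (len_neg_avec j.1).le⟩

theorem bddBy_frobMat_sub_gB (hγ : IsGamma γ) (hκ : IsEigen γ κ) (i j : Inn n d) :
    BddBy (frobMat hγ κ i j - gB p n d i j) (p : ℝ)⁻¹ := by
  have h := bddBy_frobMat_sub hγ hκ (neg_avec_mem_MMinus j) i 1
  rw [pow_one] at h
  have h1 : gB p n d i j = mono (wt n d) (Pi.single j.1 1) 1 * ∑ v ∈ finMM n d 1,
      const ℂ_[p] (wt n d) ((γ ^ (p - 1)) ^ (len v - 1)) * (frobHom p n d (vY hγ v i) *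
        polyHom p n d (prodPoly (zcoeff (artinHasseC p)) (-avec j.1 - p • v))) := by
    rw [finMM_one, Finset.sum_image fun _ _ _ _ h => Subtype.ext (avec_injective (neg_injective h)),
      Finset.sum_eq_single i]
    · have h2 : (-avec j.1 - p • -avec i.1 : Lat n) = p • avec i.1 - avec j.1 := by
        rw [smul_neg]; abel
      rw [len_neg_avec, Nat.sub_self, pow_zero, map_one, one_mul, vY_neg_avec, if_pos rfl,
        frobHom_mono, ← mul_assoc, mono_mul_mono, one_mul, gB_apply, h2]
      congr 2
      rw [smul_neg, sub_eq_add_neg]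
      congr 2
      funext k
      rw [Pi.smul_apply, Pi.single_apply, Pi.single_apply]
      split_ifs <;> simp
    · intro m _ hm
      rw [vY_neg_avec, if_neg (Ne.symm hm), map_zero, zero_mul, mul_zero]
    · exact fun h => absurd (Finset.mem_univ _) h
  rw [h1, frobMat_apply, ← mul_sub]
  exact BddBy.unitBall_mul (bddBy_mono (by simp)) h

theorem norm_gamma_pow_sub_one (hγ : IsGamma γ) : ‖γ ^ (p - 1)‖ = (p : ℝ)⁻¹ := by
  rw [norm_pow, hγ.1]

theorem frobMat_mul_inv (hγ : IsGamma γ) (hκ : IsEigen γ κ) :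
    ∃ Z : Matrix (Inn n d) (Inn n d) (GSer p n d), (∀ i j, BddBy (Z i j) 1) ∧
      frobMat hγ κ * Z = 1 := by
  have hne : κ * (γ ^ (p - 1))⁻¹ ≠ 0 := norm_ne_zero_iff.1 (by rw [hκ.norm_rho hγ]; exact one_ne_zero)
  refine ⟨const ℂ_[p] (wt n d) (κ * (γ ^ (p - 1))⁻¹)⁻¹ •
    (gGinv n d hγ * (frobHom p n d).mapMatrix (gG n d γ)), fun i j => ?_, ?_⟩
  · refine (bddBy_const ?_).mul_one_one
      (bddBy_matrix_mul zero_le_one (bddBy_gGinv hγ) (fun i j => bddBy_frobHom (bddBy_gG hγ i j)) i j)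
    rw [norm_inv, hκ.norm_rho hγ, inv_one]
  · rw [frobMat, Matrix.smul_mul, Matrix.mul_smul, smul_smul, ← map_mul, mul_inv_cancel₀ hne, map_one,
      one_smul, mul_assoc, ← mul_assoc (gG n d γ), gG_mul_gGinv, one_mul, ← map_mul,
      gGinv_mul_gG, map_one]

variable (p) in
theorem inv_prime_lt_one : (p : ℝ)⁻¹ < 1 :=
  inv_lt_one_of_one_lt₀ (by exact_mod_cast hp.out.one_lt)

variable (p n d) in
/-- The elements of norm at most one within `p^{-k}` of the quotients `h / D^m`. -/
def nearPow (k : ℕ) : Subring (GSer p n d) :=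
  nearRing ℂ_[p] (wt n d) (fracRing p n d) ((p : ℝ)⁻¹ ^ k) (by positivity)
    (pow_le_one₀ (by positivity) (inv_prime_lt_one p).le)

theorem frobHom_vY_neg_avec_mem (hγ : IsGamma γ) (i j : Inn n d) (k : ℕ) :
    frobHom p n d (vY hγ (-avec j.1) i) ∈ nearPow p n d k := by
  rw [vY_neg_avec]
  by_cases hij : i = j
  · subst hij
    rw [if_pos rfl, frobHom_mono]
    refine mem_nearRing_of_mem (mono_mem_fracRing (NonnegOff.nsmul ?_ p) 1) (bddBy_mono (by simp))
    rw [← Pi.single_neg]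
    exact nonnegOff_single i _
  · rw [if_neg hij, map_zero]
    exact zero_mem _

theorem mono_single_mem_nearPow (j : Inn n d) (c : ℤ) (k : ℕ) :
    mono (wt n d) (Pi.single j.1 c) 1 ∈ nearPow p n d k :=
  mem_nearRing_of_mem (mono_mem_fracRing (nonnegOff_single j c) 1) (bddBy_mono (by simp))

theorem frobMat_mulVec_mem_succ (hγ : IsGamma γ) (hκ : IsEigen γ κ) {k : ℕ}
    (ih : ∀ u ∈ MMinus n d, ∀ i : Inn n d, vY hγ u i ∈ nearPow p n d k) {u : Lat n}
    (hu : u ∈ MMinus n d) (i : Inn n d) :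
    (frobMat hγ κ).mulVec (vY hγ u) i ∈ nearPow p n d (k + 1) := by
  refine mem_nearRing_of_sub ?_ (bddBy_frobMat_sub hγ hκ hu i (k + 1))
  have hpos : 0 < (p : ℝ)⁻¹ := inv_pos.2 (by exact_mod_cast hp.out.pos)
  refine sum_mem fun v hv => ?_
  have hM := (mem_finMM.1 hv).1
  rw [← mul_assoc]
  refine mul_mem ?_ (mem_nearRing_of_mem (polyHom_mem_fracRing (prodPoly_mem_polyNN _ _))
    (bddBy_polyHom_prodPoly _))
  by_cases h1 : len v = 1
  · obtain ⟨j, rfl⟩ := eq_neg_avec_of_len hM h1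
    rw [h1, Nat.sub_self, pow_zero, map_one, one_mul]
    exact frobHom_vY_neg_avec_mem hγ i j (k + 1)
  · have h2 := len_pos hM
    refine mul_mem_nearRing (δ := (p : ℝ)⁻¹) (const_mem_fracRing _) (bddBy_const ?_)
      (inv_prime_lt_one p).le (pow_succ' _ _).ge (frobHom_mem_nearRing (by positivity) (ih v hM i))
    rw [norm_pow, norm_gamma_pow_sub_one hγ]
    exact pow_le_of_le_one hpos.le (inv_prime_lt_one p).le (by omega)

theorem frobMat_mem_of_mulVec (hγ : IsGamma γ) {k : ℕ}
    (h : ∀ u ∈ MMinus n d, ∀ i : Inn n d, (frobMat hγ κ).mulVec (vY hγ u) i ∈ nearPow p n d k)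
    (i j : Inn n d) : frobMat hγ κ i j ∈ nearPow p n d k := by
  rw [frobMat_apply]
  exact mul_mem (mono_single_mem_nearPow j 1 k) (h _ (neg_avec_mem_MMinus j) i)

theorem vY_mem_nearPow (hγ : IsGamma γ) (hκ : IsEigen γ κ) (k : ℕ) :
    ∀ u ∈ MMinus n d, ∀ i : Inn n d, vY hγ u i ∈ nearPow p n d k := by
  have hpos : 0 < (p : ℝ)⁻¹ := inv_pos.2 (by exact_mod_cast hp.out.pos)
  induction k with
  | zero =>
    intro u hu i
    refine ⟨bddBy_vY hγ hu i, 0, zero_mem _, ?_⟩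
    rw [sub_zero, pow_zero]
    exact bddBy_vY hγ hu i
  | succ k ih =>
    intro u hu i
    have h1 : ∀ u ∈ MMinus n d, ∀ i : Inn n d, _ := fun u hu i =>
      frobMat_mulVec_mem_succ hγ hκ ih hu i
    obtain ⟨Z, hZ1, hZ⟩ := frobMat_mul_inv (n := n) (d := d) hγ hκ
    have hZmem : ∀ i j, Z i j ∈ nearPow p n d (k + 1) :=
      matrix_inv_mem_nearRing (e := gDinv p n d) (pow_pos hpos _) (inv_prime_lt_one p)
        (frobMat_mem_of_mulVec hγ h1) bddBy_gB (bddBy_frobMat_sub_gB hγ hκ) hpos.le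
        (mem_nearRing_of_mem gDinv_mem_fracRing bddBy_gDinv)
        (by rw [det_gB]; exact gD_mul_gDinv) hZ1 hZ
    have h2 : vY hγ u = Z.mulVec ((frobMat hγ κ).mulVec (vY hγ u)) := by
      rw [Matrix.mulVec_mulVec, mul_eq_one_comm.1 hZ, Matrix.one_mulVec]
    rw [h2]
    exact mulVec_mem _ hZmem (h1 u hu) i

end Contraction

section Descent

variable {p : ℕ} [hp : Fact p.Prime] {n d : ℕ} {γ : ℂ_[p]} {κ : ℂ_[p]}

theorem vY_mem_closRing (hγ : IsGamma γ) (hκ : IsEigen γ κ) {u : Lat n} (hu : u ∈ MMinus n d)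
    (i : Inn n d) : vY hγ u i ∈ closRing (fracRing p n d) :=
  mem_closRing_of_near (η := (p : ℝ)⁻¹) (by positivity) (inv_prime_lt_one p) fun k =>
    vY_mem_nearPow hγ hκ k u hu i

theorem frobMat_mem_closRing (hγ : IsGamma γ) (hκ : IsEigen γ κ) (i j : Inn n d) :
    frobMat hγ κ i j ∈ closRing (fracRing p n d) :=
  mem_closRing_of_near (η := (p : ℝ)⁻¹) (by positivity) (inv_prime_lt_one p) fun k => by
    have h : nearPow p n d (k + 1) ≤ nearPow p n d k := fun a ⟨h1, s, hs, h2⟩ =>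
      ⟨h1, s, hs, h2.mono_right
        (pow_le_pow_of_le_one (by positivity) (inv_prime_lt_one p).le k.le_succ)⟩
    exact h (frobMat_mem_of_mulVec hγ (fun u hu i =>
      frobMat_mulVec_mem_succ hγ hκ (vY_mem_nearPow hγ hκ k) hu i) i j)

/-- The vector `G(Λ)⁻¹ F_u(Λ)`. -/
def vZ (hγ : IsGamma γ) (u : Lat n) : Inn n d → GSer p n d := (gGinv n d hγ).mulVec (vF p u)

/-- The vector `G(Λ)⁻¹ F_u(Λ) / (|u| - 1)!`. -/
def vW (hγ : IsGamma γ) (u : Lat n) (i : Inn n d) : GSer p n d :=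
  const ℂ_[p] (wt n d) ((len u - 1).factorial : ℂ_[p])⁻¹ * vZ hγ u i

theorem factorial_ne_zero (m : ℕ) : (m.factorial : ℂ_[p]) ≠ 0 := by
  exact_mod_cast m.factorial_ne_zero

theorem bddBy_const_inv_mul {m : ℕ} {a : GSer p n d} {C : ℝ}
    (h : BddBy a (‖(m.factorial : ℂ_[p])‖ * C)) :
    BddBy (const ℂ_[p] (wt n d) (m.factorial : ℂ_[p])⁻¹ * a) C := by
  refine (BddBy.mul (bddBy_const (norm_inv _).le) h).mono_right (le_of_eq ?_)
  rw [inv_mul_cancel_left₀ (norm_ne_zero_iff.2 (factorial_ne_zero m))]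

theorem bddBy_vZ (hγ : IsGamma γ) {u : Lat n} (hu : u ∈ MMinus n d) (i : Inn n d) :
    BddBy (vZ hγ u i) ‖((len u - 1).factorial : ℂ_[p])‖ :=
  bddBy_mulVec (norm_nonneg _) (bddBy_gGinv hγ) (bddBy_vF hu) i

theorem bddBy_vW (hγ : IsGamma γ) {u : Lat n} (hu : u ∈ MMinus n d) (i : Inn n d) :
    BddBy (vW hγ u i) 1 :=
  bddBy_const_inv_mul (by rw [mul_one]; exact bddBy_vZ hγ hu i)

theorem vZ_eq (hγ : IsGamma γ) (u : Lat n) (i : Inn n d) :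
    vZ hγ u i = const ℂ_[p] (wt n d) ((len u - 1).factorial : ℂ_[p]) * vW hγ u i := by
  rw [vW, ← mul_assoc, ← map_mul, mul_inv_cancel₀ (factorial_ne_zero _), map_one, one_mul]

/-- `G⁻¹ G_u = ∑_v G⁻¹ F_{u-v} θ̂_{1,v}`, truncated. -/
theorem bddBy_vY_sub_sum (hγ : IsGamma γ) {u : Lat n} (hu : u ∈ MMinus n d) (i : Inn n d) (K : ℕ) :
    BddBy (vY hγ u i - ∑ v ∈ finNA n d K, vZ hγ (u - v) i *
      polyHom p n d (prodPoly (zcoeff (thetaOne γ)) v))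
      (‖((len u - 1).factorial : ℂ_[p])‖ * invSqrt p ^ (K + 1)) := by
  have h0 : 0 ≤ invSqrt p := invSqrt_pos.le
  have h1 : vY hγ u i - ∑ v ∈ finNA n d K, vZ hγ (u - v) i *
      polyHom p n d (prodPoly (zcoeff (thetaOne γ)) v) = ∑ j, gGinv n d hγ i j *
      (liftSer (Gser γ j u) - ∑ v ∈ finNA n d K, liftSer (Fser p j (u - v)) *
        polyHom p n d (prodPoly (zcoeff (thetaOne γ)) v)) := by
    simp only [mul_sub, Finset.sum_sub_distrib, Finset.mul_sum]
    rw [Finset.sum_comm]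
    congr 1
    refine Finset.sum_congr rfl fun v _ => ?_
    rw [vZ, Matrix.mulVec, dotProduct, Finset.sum_mul]
    exact Finset.sum_congr rfl fun j _ => mul_assoc _ _ _
  rw [h1]
  exact bddBy_sum (by positivity) fun j _ =>
    BddBy.unitBall_mul (bddBy_gGinv hγ i j) (bddBy_G_sub_sum hγ j hu K)

theorem bddBy_factorial_mul_theta (hγ : IsGamma γ) (s t : ℕ) {v : Lat n} (hv : v.2 = t) :
    BddBy (const ℂ_[p] (wt n d) ((s + t).factorial : ℂ_[p]) *
      polyHom p n d (prodPoly (zcoeff (thetaOne γ)) v))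
      (‖(s.factorial : ℂ_[p])‖ * invSqrt p ^ t) := fun l => by
  classical
  have h0 : 0 ≤ invSqrt p := invSqrt_pos.le
  rw [const_mul_apply, polyHom_coe, ofPoly, coeff_prodPoly]
  split_ifs with h
  · exact norm_factorial_mul_prod_theta_le hγ s t h.1 (by rw [← deg_snd, h.2, hv])
  · rw [mul_zero, norm_zero]; positivity

variable (p n d) in
/-- The elements of norm at most one within `p^{-k/2}` of the quotients `h / D^m`. -/
def nearSqrt (k : ℕ) : Subring (GSer p n d) :=
  nearRing ℂ_[p] (wt n d) (fracRing p n d) (invSqrt p ^ k) (pow_nonneg invSqrt_pos.le k)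
    (pow_le_one₀ invSqrt_pos.le invSqrt_lt_one.le)

theorem vW_mem_nearSqrt (hγ : IsGamma γ) (hκ : IsEigen γ κ) (k : ℕ) :
    ∀ u ∈ MMinus n d, ∀ i : Inn n d, vW hγ u i ∈ nearSqrt p n d k := by
  classical
  induction k with
  | zero =>
    intro u hu i
    refine ⟨bddBy_vW hγ hu i, 0, zero_mem _, ?_⟩
    rw [sub_zero, pow_zero]
    exact bddBy_vW hγ hu i
  | succ k ih =>
    intro u hu i
    set f : ℂ_[p] := ((len u - 1).factorial : ℂ_[p]) with hf
    set s := (finNA n d k).erase 0 with hs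
    have h0 : (0 : Lat n) ∈ finNA n d k := mem_finNA.2 ⟨zero_mem _, by simp⟩
    have h1 := bddBy_const_inv_mul (bddBy_vY_sub_sum hγ hu i k)
    have h2 : const ℂ_[p] (wt n d) f⁻¹ * (vY hγ u i - ∑ v ∈ finNA n d k, vZ hγ (u - v) i *
        polyHom p n d (prodPoly (zcoeff (thetaOne γ)) v)) =
        (const ℂ_[p] (wt n d) f⁻¹ * vY hγ u i - ∑ v ∈ s, const ℂ_[p] (wt n d) f⁻¹ *
          (vZ hγ (u - v) i * polyHom p n d (prodPoly (zcoeff (thetaOne γ)) v))) - vW hγ u i := by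
      rw [← Finset.add_sum_erase _ _ h0, sub_zero, prodPoly_zero (zcoeff_thetaOne_zero γ), map_one,
        mul_one, mul_sub, mul_add, Finset.mul_sum, vW]
      ring
    rw [h2] at h1
    have h3 := h1.neg
    rw [neg_sub] at h3
    refine mem_nearRing_of_sub (sub_mem ?_ (sum_mem fun v hv => ?_)) h3
    · refine mem_nearRing_of_closRing (mul_mem (le_closRing (const_mem_fracRing _))
        (vY_mem_closRing hγ hκ hu i)) ?_ (pow_pos invSqrt_pos _)
      refine bddBy_const_inv_mul ?_
      rw [mul_one]
      exact bddBy_mulVec (norm_nonneg _) (bddBy_gGinv hγ) (bddBy_vG hγ hu) i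
    · rw [hs, Finset.mem_erase, mem_finNA] at hv
      have hM := sub_mem_MMinus hu hv.2.1
      have h5 := (NA_nonneg hv.2.1).2
      have h6 : v.2 ≠ 0 := fun h => hv.1 (eq_zero_of_snd_le_zero hv.2.1 h.le)
      have h7 := len_eq hu
      have h8 := len_eq hM
      have h9 := len_pos hu
      rw [Prod.snd_sub] at h8
      have h10 : len (u - v) - 1 = len u - 1 + v.2.toNat := by omega
      have h11 := bddBy_const_inv_mul (bddBy_factorial_mul_theta (d := d) hγ (len u - 1) v.2.toNat
        (v := v) (by omega))
      have h12 : const ℂ_[p] (wt n d) f⁻¹ *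
          (vZ hγ (u - v) i * polyHom p n d (prodPoly (zcoeff (thetaOne γ)) v)) =
          (const ℂ_[p] (wt n d) f⁻¹ * (const ℂ_[p] (wt n d)
            ((len u - 1 + v.2.toNat).factorial : ℂ_[p]) *
            polyHom p n d (prodPoly (zcoeff (thetaOne γ)) v))) * vW hγ (u - v) i := by
        rw [vZ_eq, h10]; ring
      rw [h12]
      refine mul_mem_nearRing (δ := invSqrt p) (mul_mem (const_mem_fracRing _) (mul_mem
        (const_mem_fracRing _) (polyHom_mem_fracRing (prodPoly_mem_polyNN _ _))))
        (h11.mono_right (pow_le_of_le_one invSqrt_pos.le invSqrt_lt_one.le (by omega)))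
        invSqrt_lt_one.le (pow_succ' _ _).ge (ih _ hM i)

theorem vZ_mem_closRing (hγ : IsGamma γ) (hκ : IsEigen γ κ) {u : Lat n} (hu : u ∈ MMinus n d)
    (i : Inn n d) : vZ hγ u i ∈ closRing (fracRing p n d) := by
  rw [vZ_eq]
  exact mul_mem (le_closRing (const_mem_fracRing _)) (mem_closRing_of_near invSqrt_pos.le
    invSqrt_lt_one fun k => vW_mem_nearSqrt hγ hκ k u hu i)

variable (n d) in
/-- `𝓗(Λ) = F(Λ)⁻¹ G(Λ)`. -/
def gH (γ : ℂ_[p]) : Matrix (Inn n d) (Inn n d) (GSer p n d) := gFinv p n d * gG n d γ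

variable (n d) in
/-- `𝓗(Λ)⁻¹ = G(Λ)⁻¹ F(Λ)`. -/
def gHinv (hγ : IsGamma γ) : Matrix (Inn n d) (Inn n d) (GSer p n d) := gGinv n d hγ * gF p n d

theorem gHinv_mul_gH (hγ : IsGamma γ) : gHinv n d hγ * gH n d γ = 1 := by
  rw [gHinv, gH, mul_assoc, ← mul_assoc (gF p n d), gF_mul_gFinv, one_mul, gGinv_mul_gG]

theorem gH_mul_gHinv (hγ : IsGamma γ) : gH n d γ * gHinv n d hγ = 1 :=
  mul_eq_one_comm.1 (gHinv_mul_gH hγ)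

theorem bddBy_gH (hγ : IsGamma γ) (i j : Inn n d) : BddBy (gH n d γ i j) 1 :=
  bddBy_matrix_mul zero_le_one bddBy_gFinv (bddBy_gG hγ) i j

theorem bddBy_gHinv (hγ : IsGamma γ) (i j : Inn n d) : BddBy (gHinv n d hγ i j) 1 :=
  bddBy_matrix_mul zero_le_one (bddBy_gGinv hγ) bddBy_gF i j

theorem gHinv_apply (hγ : IsGamma γ) (i j : Inn n d) :
    gHinv n d hγ i j = mono (wt n d) (Pi.single j.1 1) 1 * vZ hγ (-avec j.1) i := by
  rw [vZ, vF_neg_avec, mulVec_mono_mul, ← mul_assoc, mono_mul_mono, add_neg_cancel, one_mul,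
    mono_zero_one, one_mul]
  rfl

theorem gHinv_mem_closRing (hγ : IsGamma γ) (hκ : IsEigen γ κ) (i j : Inn n d) :
    gHinv n d hγ i j ∈ closRing (fracRing p n d) := by
  rw [gHinv_apply]
  exact mul_mem (le_closRing (mono_mem_fracRing (nonnegOff_single j 1) 1))
    (vZ_mem_closRing hγ hκ (neg_avec_mem_MMinus j) i)

theorem gH_mem_closRing (hγ : IsGamma γ) (hκ : IsEigen γ κ) (i j : Inn n d) :
    gH n d γ i j ∈ closRing (fracRing p n d) := by
  have hr := invSqrt_pos (p := p)
  have hr1 := invSqrt_lt_one (p := p)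
  refine mem_closRing_of_near hr.le hr1 fun k => ?_
  refine matrix_inv_mem_nearRing (X := gHinv n d hγ) (B := 1) (e := 1) (pow_pos hr k) hr1
    (fun i j => mem_nearRing_of_closRing (gHinv_mem_closRing hγ hκ i j) (bddBy_gHinv hγ i j)
      (pow_pos hr k)) (fun i j => by
      rw [Matrix.one_apply]
      split_ifs
      · exact bddBy_one
      · exact bddBy_zero zero_le_one) (fun i j => ?_) hr.le (one_mem _)
    (by rw [Matrix.det_one, one_mul]) (bddBy_gH hγ) (gHinv_mul_gH hγ) i j
  have h1 : gHinv n d hγ - 1 = gGinv n d hγ * (gF p n d - gG n d γ) := by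
    rw [mul_sub, gGinv_mul_gG, gHinv]
  have h2 : gHinv n d hγ i j - (1 : Matrix (Inn n d) (Inn n d) (GSer p n d)) i j =
      (gGinv n d hγ * (gF p n d - gG n d γ)) i j := by rw [← h1, Matrix.sub_apply]
  rw [h2]
  refine bddBy_matrix_mul hr.le (bddBy_gGinv hγ) (fun i j => ?_) i j
  have := (bddBy_gG_sub_gF hγ i j).neg
  rwa [neg_sub] at this

theorem frobHom_mem_closRing {a : GSer p n d} (ha : a ∈ closRing (fracRing p n d))
    (h1 : BddBy a 1) : frobHom p n d a ∈ closRing (fracRing p n d) := by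
  have hr := invSqrt_pos (p := p)
  exact mem_closRing_of_near hr.le invSqrt_lt_one fun k => frobHom_mem_nearRing (pow_pos hr k)
    (mem_nearRing_of_closRing ha h1 (pow_pos hr k))

variable (n d) in
/-- `𝓖(Λ)`. -/
def gCalG (hγ : IsGamma γ) : Matrix (Inn n d) (Inn n d) (GSer p n d) :=
  (frobHom p n d).mapMatrix (gGinv n d hγ) * gG n d γ

variable (p n d) in
/-- `𝓕(Λ)`. -/
def gCalF : Matrix (Inn n d) (Inn n d) (GSer p n d) :=
  (frobHom p n d).mapMatrix (gFinv p n d) * gF p n d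

theorem gCalG_mem_closRing (hγ : IsGamma γ) (hκ : IsEigen γ κ) (i j : Inn n d) :
    gCalG n d hγ i j ∈ closRing (fracRing p n d) := by
  have hne : κ * (γ ^ (p - 1))⁻¹ ≠ 0 := norm_ne_zero_iff.1 (by rw [hκ.norm_rho hγ]; exact one_ne_zero)
  have h : gCalG n d hγ = const ℂ_[p] (wt n d) (κ * (γ ^ (p - 1))⁻¹)⁻¹ • frobMat hγ κ := by
    rw [frobMat, smul_smul, ← map_mul, inv_mul_cancel₀ hne, map_one, one_smul, gCalG]
  rw [h, Matrix.smul_apply, smul_eq_mul]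
  exact mul_mem (le_closRing (const_mem_fracRing _)) (frobMat_mem_closRing hγ hκ i j)

theorem gCalF_eq (hγ : IsGamma γ) :
    gCalF p n d = (frobHom p n d).mapMatrix (gH n d γ) * gCalG n d hγ * gHinv n d hγ := by
  rw [gH, gCalG, gHinv, map_mul, gCalF]
  have h1 : (frobHom p n d).mapMatrix (gG n d γ) * (frobHom p n d).mapMatrix (gGinv n d hγ) = 1 := by
    rw [← map_mul, gG_mul_gGinv, map_one]
  calc _ = (frobHom p n d).mapMatrix (gFinv p n d) * 1 * (1 * gF p n d) := by
        rw [mul_one, one_mul]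
    _ = (frobHom p n d).mapMatrix (gFinv p n d) *
        ((frobHom p n d).mapMatrix (gG n d γ) * (frobHom p n d).mapMatrix (gGinv n d hγ)) *
        (gG n d γ * gGinv n d hγ * gF p n d) := by rw [h1, gG_mul_gGinv]
    _ = _ := by simp only [mul_assoc]

theorem gCalF_mem_closRing (hγ : IsGamma γ) (hκ : IsEigen γ κ) (i j : Inn n d) :
    gCalF p n d i j ∈ closRing (fracRing p n d) := by
  rw [gCalF_eq hγ]
  exact matrix_mul_mem _ (matrix_mul_mem _ (fun i j => frobHom_mem_closRing
    (gH_mem_closRing hγ hκ i j) (bddBy_gH hγ i j)) (gCalG_mem_closRing hγ hκ))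
    (gHinv_mem_closRing hγ hκ) i j

/-! ### Membership in `R'` -/

theorem const_mul_gDinv_pow_isFrac (c : ℂ_[p]) (k : ℕ) :
    IsFrac (const ℂ_[p] (wt n d) c * gDinv p n d ^ k).1 (AddMonoidAlgebra.single 0 c) k := by
  have hc : const ℂ_[p] (wt n d) c ∈ supportE p n d := fun l hl => by
    classical
    change mono (wt n d) 0 c l ≠ 0 at hl
    rw [mono_apply] at hl
    by_cases h : l = 0
    · rw [h]; exact zero_mem_ESet
    · rw [if_neg h] at hl; exact absurd rfl hl
  refine ⟨mem_RE_iff.2 (mul_mem hc (pow_mem gDinv_mem_supportE k)), ?_, ?_⟩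
  · rw [← polyHom_coe, polyHom_single]
    exact mem_RE_iff.2 hc
  · rw [← polyHom_coe, ← polyHom_coe, serMul_eq, map_pow, polyHom_single]
    change (_ * gD p n d ^ k).1 = _
    rw [mul_assoc, mul_comm (gDinv p n d ^ k), gD_pow_mul_gDinv_pow, mul_one]
    rfl

theorem LED_subset_RE' : LED p n d ⊆ RE' p n d := fun ξ hξ => by
  obtain ⟨h, k, hf⟩ := hξ
  exact ⟨hf.1.1, fun ε hε => ⟨ξ, ⟨h, k, hf⟩, fun l => by simpa using hε.le⟩⟩

theorem polyHom_mul_gDinv_pow_isExpansion {h : LPoly ℂ_[p] n d} (hh : h ∈ polyNN ℂ_[p] n d) (k : ℕ) :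
    IsExpansion (polyHom p n d h * gDinv p n d ^ k).1 h.coeff.support
      fun m => (const ℂ_[p] (wt n d) (h.coeff m) * gDinv p n d ^ k).1 := by
  refine ⟨fun m hm => ⟨hh m (Finsupp.mem_support_iff.1 hm),
    LED_subset_RE' ⟨_, _, const_mul_gDinv_pow_isFrac _ k⟩⟩, ?_⟩
  conv_lhs => rw [eq_sum_single h, map_sum, Finset.sum_mul, coe_sum]
  refine Finset.sum_congr rfl fun m _ => ?_
  rw [shift_eq, polyHom_single, ← mul_assoc]
  congr 2
  change _ = mono (wt n d) m 1 * mono (wt n d) 0 _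
  rw [mono_mul_mono, add_zero, one_mul]

theorem mem_RR'_of_closRing {a : GSer p n d} (ha : a ∈ closRing (fracRing p n d)) :
    a.1 ∈ RR' p n d := by
  refine ⟨a.2.1, fun ε hε => ?_⟩
  obtain ⟨s, ⟨h, hh, k, rfl⟩, hle⟩ := ha ε hε
  exact ⟨_, ⟨_, _, polyHom_mul_gDinv_pow_isExpansion hh k⟩, hle⟩

theorem hasDeg_mulVec {X : Matrix (Inn n d) (Inn n d) (GSer p n d)} {v : Inn n d → GSer p n d}
    {u : Lat n} (hX : ∀ i j, X i j ∈ supportE p n d) (hv : ∀ i, HasDeg (v i).1 u) (i : Inn n d) :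
    HasDeg (X.mulVec v i).1 u :=
  hasDeg_sum fun k _ => by
    have := hasDeg_mul (hasDeg_of_supportE (hX i k)) (hv k)
    rwa [zero_add] at this

theorem mvec_toS (X : Matrix (Inn n d) (Inn n d) (GSer p n d)) (v : Inn n d → GSer p n d)
    {ξ : Inn n d → Lat n → Ser p n d} {u : Lat n} (h : ∀ k, (v k).1 = ξ k u) (i : Inn n d) :
    mvec (toS X) ξ i u = (X.mulVec v i).1 := by
  rw [mvec, Matrix.mulVec, dotProduct, coe_sum]
  refine Finset.sum_congr rfl fun k _ => ?_
  rw [← h k, toS, serMul_eq]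

theorem inSprime_of {X : Matrix (Inn n d) (Inn n d) (GSer p n d)} {ξ : Inn n d → Lat n → Ser p n d}
    (v : Lat n → Inn n d → GSer p n d) (hv : ∀ u ∈ MMinus n d, ∀ k, (v u k).1 = ξ k u)
    (hdeg : ∀ u ∈ MMinus n d, ∀ k, HasDeg (ξ k u) u)
    (hX : ∀ i j, X i j ∈ supportE p n d)
    (hX1 : ∀ i j, BddBy (X i j) 1) (hv1 : ∀ u ∈ MMinus n d, ∀ k, BddBy (v u k) 1)
    (hmem : ∀ u ∈ MMinus n d, ∀ i, X.mulVec (v u) i ∈ closRing (fracRing p n d)) :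
    InSprime (mvec (toS X) ξ) := by
  refine fun i => ⟨fun u hu => ?_, 1, fun u hu => ?_⟩
  · rw [mvec_toS X (v u) (hv u hu)]
    exact ⟨mem_RR'_of_closRing (hmem u hu i),
      hasDeg_mulVec hX (fun k => by rw [hv u hu k]; exact hdeg u hu k) i⟩
  · rw [mvec_toS X (v u) (hv u hu)]
    exact bddBy_mulVec zero_le_one hX1 (hv1 u hu) i

end Descent

/-! ### Evaluation of Laurent polynomials -/

section PolyEval

variable {K : Type*} [Field K] {n d : ℕ}

/-- The value of a monomial. -/
def monoEval (lam : Mon n d → K) (l : Expo n d) : K := ∏ k, lam k ^ l k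

variable {lam : Mon n d → K}

theorem monoEval_add (hlam : ∀ k : Inn n d, lam k.1 ≠ 0) {l m : Expo n d} (hl : NonnegOff l)
    (hm : NonnegOff m) : monoEval lam (l + m) = monoEval lam l * monoEval lam m := by
  rw [monoEval, monoEval, monoEval, ← Finset.prod_mul_distrib]
  refine Finset.prod_congr rfl fun k _ => zpow_add' ?_
  by_cases hk : ∀ i, 0 < k.1 i
  · exact Or.inl (hlam ⟨k, hk⟩)
  · have h1 := hl k hk
    have h2 := hm k hk
    by_cases h : l k + m k = 0
    · exact Or.inr (Or.inr ⟨by linarith, by linarith⟩)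
    · exact Or.inr (Or.inl h)

/-- Evaluation as an additive map. -/
def evalAdd (lam : Mon n d → K) : LPoly K n d →+ K where
  toFun h := lpEval h lam
  map_zero' := Finsupp.sum_zero_index
  map_add' _ _ := Finsupp.sum_add_index' (fun _ => zero_mul _) fun _ _ _ => add_mul _ _ _

theorem evalAdd_single (lam : Mon n d → K) (l : Expo n d) (c : K) :
    evalAdd lam (AddMonoidAlgebra.single l c) = c * monoEval lam l := by
  change lpEval _ _ = _
  rw [lpEval, AddMonoidAlgebra.coeff_single, Finsupp.sum_single_index (zero_mul _)]
  rfl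

theorem evalAdd_mul (hlam : ∀ k : Inn n d, lam k.1 ≠ 0) {a b : LPoly K n d} (ha : a ∈ polyNN K n d)
    (hb : b ∈ polyNN K n d) : evalAdd lam (a * b) = evalAdd lam a * evalAdd lam b := by
  conv_lhs => rw [eq_sum_single a, eq_sum_single b, Finset.sum_mul_sum]
  conv_rhs => rw [eq_sum_single a, eq_sum_single b]
  simp only [map_sum, AddMonoidAlgebra.single_mul_single, evalAdd_single, Finset.sum_mul_sum]
  refine Finset.sum_congr rfl fun l hl => Finset.sum_congr rfl fun m hm => ?_
  rw [monoEval_add hlam (ha l (Finsupp.mem_support_iff.1 hl)) (hb m (Finsupp.mem_support_iff.1 hm))]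
  ring

/-- Evaluation as a ring homomorphism. -/
def evalNN (lam : Mon n d → K) (hlam : ∀ k : Inn n d, lam k.1 ≠ 0) : polyNN K n d →+* K where
  toFun h := lpEval h.1 lam
  map_zero' := map_zero (evalAdd lam)
  map_add' a b := map_add (evalAdd lam) a.1 b.1
  map_one' := by
    refine (evalAdd_single lam 0 1).trans ?_
    simp [monoEval]
  map_mul' a b := evalAdd_mul hlam a.2 b.2

theorem evalAdd_polyFrob {p : ℕ} (lam : Mon n d → K) (h : LPoly K n d) :
    lpEval (polyFrob p h) lam = lpEval h (lam ^ p) := by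
  change evalAdd lam (polyFrob p h) = evalAdd (lam ^ p) h
  conv_rhs => rw [eq_sum_single h]
  rw [polyFrob, map_sum, map_sum]
  refine Finset.sum_congr rfl fun l _ => ?_
  rw [evalAdd_single, evalAdd_single]
  congr 1
  refine Finset.prod_congr rfl fun k _ => ?_
  rw [Pi.smul_apply, Pi.pow_apply, nsmul_eq_mul, zpow_mul, zpow_natCast]

open Classical in
/-- The value of `D(Λ)`. -/
theorem lpEval_Dpoly {p : ℕ} [Fact p.Prime] (hlam : ∀ k : Inn n d, lam k.1 ≠ 0) :
    lpEval (Dpoly K p n d) lam = Matrix.det (Matrix.of fun i j : Inn n d =>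
      ((lam i.1)⁻¹ ^ p * lam j.1) *
        ∑ ν ∈ (Fintype.piFinset fun _ : Mon n d => Finset.range p).filter
          (fun ν => ∑ k, ν k • avec k = p • avec i.1 - avec j.1),
          (∏ k, (Nat.factorial (ν k) : K))⁻¹ * ∏ k, lam k ^ ν k) := by
  let B : Matrix (Inn n d) (Inn n d) (polyNN K n d) := fun i j => ⟨Bmat K p n d i j, Bmat_mem_polyNN K i j⟩
  have h1 : Dpoly K p n d = (polyNN K n d).subtype B.det := by rw [RingHom.map_det]; rfl
  have h2 : lpEval (Dpoly K p n d) lam = evalNN lam hlam B.det := by rw [h1]; rfl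
  rw [h2, RingHom.map_det]
  congr 1
  ext i j
  rw [Matrix.of_apply]
  change evalAdd lam (Bmat K p n d i j) = _
  have hs : NonnegOff (Pi.single j.1 1 - Pi.single i.1 (p : ℤ) : Expo n d) := by
    rw [sub_eq_add_neg, ← Pi.single_neg]
    exact (nonnegOff_single j 1).add (nonnegOff_single i _)
  have hH : Hmat K p n d i j ∈ polyNN K n d := by
    rw [Hmat, Matrix.of_apply]
    exact sum_mem fun ν _ => single_mem_polyNN (fun k _ => Int.natCast_nonneg _) _
  have hmono : ∀ (a : Inn n d) (c : ℤ), monoEval lam (Pi.single a.1 c) = lam a.1 ^ c := fun a c => by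
    rw [monoEval, Finset.prod_eq_single a.1]
    · rw [Pi.single_eq_same]
    · intro k _ hk; rw [Pi.single_eq_of_ne hk, zpow_zero]
    · exact fun h => absurd (Finset.mem_univ _) h
  rw [Bmat, Matrix.of_apply, evalAdd_mul hlam (single_mem_polyNN hs 1) hH, evalAdd_single, one_mul,
    sub_eq_add_neg, ← Pi.single_neg, monoEval_add hlam (nonnegOff_single j 1) (nonnegOff_single i _),
    hmono, hmono, zpow_one, zpow_neg, zpow_natCast, mul_comm (lam j.1), inv_pow, Hmat,
    Matrix.of_apply, map_sum]
  congr 1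
  refine Finset.sum_congr rfl fun ν _ => ?_
  rw [evalAdd_single]
  congr 1
  exact Finset.prod_congr rfl fun k _ => zpow_natCast _ _

end PolyEval

/-! ### Evaluation on `R'` -/

section Evaluation

variable {p : ℕ} [hp : Fact p.Prime] {n d : ℕ} {lam : Mon n d → ℂ_[p]}

theorem DD.ne_zero (hlam : lam ∈ DD p n d) (k : Inn n d) : lam k.1 ≠ 0 :=
  norm_ne_zero_iff.1 (by rw [hlam.1 k]; exact one_ne_zero)

theorem DD.D_ne_zero (hlam : lam ∈ DD p n d) : lpEval (Dpoly ℂ_[p] p n d) lam ≠ 0 :=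
  norm_ne_zero_iff.1 (by rw [hlam.2.2]; exact one_ne_zero)

theorem norm_monoEval_le (hlam : lam ∈ DD p n d) {l : Expo n d} (hl : NonnegOff l) :
    ‖monoEval lam l‖ ≤ 1 := by
  rw [monoEval, norm_prod]
  refine Finset.prod_le_one (fun _ _ => norm_nonneg _) fun k _ => ?_
  rw [norm_zpow]
  by_cases hk : ∀ i, 0 < k.1 i
  · rw [hlam.1 ⟨k, hk⟩, one_zpow]
  · obtain ⟨c, hc⟩ := Int.eq_ofNat_of_zero_le (hl k hk)
    rw [hc, zpow_natCast]
    exact pow_le_one₀ (norm_nonneg _) (hlam.2.1 k)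

theorem norm_lpEval_le (hlam : lam ∈ DD p n d) {h : LPoly ℂ_[p] n d} (hh : h ∈ polyNN ℂ_[p] n d)
    {C : ℝ} (hC : BddBy (polyHom p n d h) C) : ‖lpEval h lam‖ ≤ C := by
  change ‖evalAdd lam h‖ ≤ C
  rw [eq_sum_single h, map_sum]
  refine IsUltrametricDist.norm_sum_le_of_forall_le_of_nonneg hC.nonneg fun l hl => ?_
  rw [evalAdd_single, norm_mul]
  have h1 := hC l
  rw [polyHom_coe, ofPoly] at h1
  exact (mul_le_of_le_one_right (norm_nonneg _)
    (norm_monoEval_le hlam (hh l (Finsupp.mem_support_iff.1 hl)))).trans h1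

theorem bddBy_of_mul_gDinv_pow {a : GSer p n d} {k : ℕ} {C : ℝ} (h : BddBy (a * gDinv p n d ^ k) C) :
    BddBy a C := by
  have h3 := h.mul_unitBall (pow_mem (show gD p n d ∈ unitBall ℂ_[p] (wt n d) from bddBy_gD) k)
  rwa [mul_assoc, mul_comm (_ ^ k), gD_pow_mul_gDinv_pow, mul_one] at h3

/-- `z` is the value of the quotient `a = h / D^k`. -/
def IsFracVal (lam : Mon n d → ℂ_[p]) (a : GSer p n d) (z : ℂ_[p]) : Prop :=
  ∃ h ∈ polyNN ℂ_[p] n d, ∃ k : ℕ, a = polyHom p n d h * gDinv p n d ^ k ∧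
    z = lpEval h lam / lpEval (Dpoly ℂ_[p] p n d) lam ^ k

theorem IsFracVal.norm_le (hlam : lam ∈ DD p n d) {a : GSer p n d} {z : ℂ_[p]}
    (h : IsFracVal lam a z) {C : ℝ} (hC : BddBy a C) : ‖z‖ ≤ C := by
  obtain ⟨h, hh, k, rfl, rfl⟩ := h
  rw [norm_div, norm_pow, hlam.2.2, one_pow, div_one]
  exact norm_lpEval_le hlam hh (bddBy_of_mul_gDinv_pow hC)

theorem IsFracVal.mul (hlam : lam ∈ DD p n d) {a b : GSer p n d} {z w : ℂ_[p]}
    (ha : IsFracVal lam a z) (hb : IsFracVal lam b w) : IsFracVal lam (a * b) (z * w) := by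
  obtain ⟨h, hh, k, rfl, rfl⟩ := ha
  obtain ⟨h', hh', k', rfl, rfl⟩ := hb
  refine ⟨h * h', mul_mem hh hh', k + k', by rw [map_mul, pow_add]; ring, ?_⟩
  have h1 : lpEval (h * h') lam = lpEval h lam * lpEval h' lam := evalAdd_mul (DD.ne_zero hlam) hh hh'
  rw [h1, pow_add, div_mul_div_comm]

theorem IsFracVal.add (hlam : lam ∈ DD p n d) {a b : GSer p n d} {z w : ℂ_[p]}
    (ha : IsFracVal lam a z) (hb : IsFracVal lam b w) : IsFracVal lam (a + b) (z + w) := by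
  obtain ⟨h, hh, k, rfl, rfl⟩ := ha
  obtain ⟨h', hh', k', rfl, rfl⟩ := hb
  have hD := Dpoly_mem_polyNN (p := p) (n := n) (d := d) ℂ_[p]
  refine ⟨h * Dpoly ℂ_[p] p n d ^ k' + h' * Dpoly ℂ_[p] p n d ^ k,
      add_mem (mul_mem hh (pow_mem hD _)) (mul_mem hh' (pow_mem hD _)), k + k', ?_, ?_⟩
  · have h1 := gD_pow_mul_gDinv_pow (p := p) (n := n) (d := d) k
    have h2 := gD_pow_mul_gDinv_pow (p := p) (n := n) (d := d) k'
    rw [map_add, map_mul, map_mul, map_pow, map_pow, pow_add]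
    change _ = (polyHom p n d h * gD p n d ^ k' + polyHom p n d h' * gD p n d ^ k) * _
    linear_combination (-(polyHom p n d h * gDinv p n d ^ k)) * h2 -
      (polyHom p n d h' * gDinv p n d ^ k') * h1
  · have h0 := DD.D_ne_zero hlam
    let e := evalNN lam (DD.ne_zero hlam)
    let D' : polyNN ℂ_[p] n d := ⟨Dpoly ℂ_[p] p n d, hD⟩
    have h1 : lpEval (h * Dpoly ℂ_[p] p n d ^ k' + h' * Dpoly ℂ_[p] p n d ^ k) lam =
        e (⟨h, hh⟩ * D' ^ k' + ⟨h', hh'⟩ * D' ^ k) := rfl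
    rw [h1, map_add, map_mul, map_mul, map_pow, map_pow]
    change lpEval h lam / _ + lpEval h' lam / _ = (lpEval h lam * lpEval (Dpoly ℂ_[p] p n d) lam ^ k' +
      lpEval h' lam * lpEval (Dpoly ℂ_[p] p n d) lam ^ k) / _
    rw [pow_add]
    field_simp

theorem IsFracVal.poly {h : LPoly ℂ_[p] n d} (hh : h ∈ polyNN ℂ_[p] n d) :
    IsFracVal lam (polyHom p n d h) (lpEval h lam) :=
  ⟨h, hh, 0, by rw [pow_zero, mul_one], by rw [pow_zero, div_one]⟩

theorem IsFracVal.mono {m : Expo n d} (hm : NonnegOff m) (c : ℂ_[p]) :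
    IsFracVal lam (mono (wt n d) m c) (c * monoEval lam m) := by
  have h := IsFracVal.poly (lam := lam) (single_mem_polyNN hm c)
  rw [polyHom_single] at h
  exact (evalAdd_single lam m c) ▸ h

theorem IsFracVal.neg (hlam : lam ∈ DD p n d) {a : GSer p n d} {z : ℂ_[p]}
    (ha : IsFracVal lam a z) : IsFracVal lam (-a) (-z) := by
  have h0 : (-1 : ℂ_[p]) * monoEval lam 0 = -1 := by simp [monoEval]
  have h1 := IsFracVal.mono (lam := lam) (m := 0) (fun _ _ => le_rfl) (-1)
  rw [h0] at h1
  have h2 : (ConvRing.mono (wt n d) 0 (-1) : GSer p n d) = -1 :=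
    (map_neg (const ℂ_[p] (wt n d)) 1).trans (by rw [map_one])
  have := h1.mul hlam ha
  rwa [h2, neg_one_mul, neg_one_mul] at this

theorem exists_isFracVal {a : GSer p n d} (ha : a ∈ fracRing p n d) : ∃ z, IsFracVal lam a z := by
  obtain ⟨h, hh, k, rfl⟩ := ha
  exact ⟨_, h, hh, k, rfl, rfl⟩

/-- `z` is the value of a limit of quotients `h / D^k`. -/
def IsClosVal (lam : Mon n d → ℂ_[p]) (a : GSer p n d) (z : ℂ_[p]) : Prop :=
  ∀ ε > 0, ∃ s w, IsFracVal lam s w ∧ BddBy (a - s) ε ∧ ‖z - w‖ ≤ ε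

theorem IsFracVal.isClosVal {a : GSer p n d} {z : ℂ_[p]} (h : IsFracVal lam a z) :
    IsClosVal lam a z := fun ε hε =>
  ⟨a, z, h, by rw [sub_self]; exact bddBy_zero hε.le, by rw [sub_self, norm_zero]; exact hε.le⟩

theorem IsClosVal.norm_le (hlam : lam ∈ DD p n d) {a : GSer p n d} {z : ℂ_[p]}
    (h : IsClosVal lam a z) {C : ℝ} (hC : BddBy a C) : ‖z‖ ≤ C := by
  refine le_of_forall_pos_le_add fun ε hε => ?_
  obtain ⟨s, w, hs, h1, h2⟩ := h ε hε
  have h3 : BddBy s (max C ε) := by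
    have := (hC.mono_right (le_max_left C ε)).sub (h1.mono_right (le_max_right C ε))
    rwa [sub_sub_cancel] at this
  have h4 := IsUltrametricDist.norm_add_le_max (z - w) w
  rw [sub_add_cancel] at h4
  refine h4.trans (max_le (h2.trans ?_) ((hs.norm_le hlam h3).trans ?_))
  · linarith [hC.nonneg]
  · exact max_le (by linarith) (by linarith [hC.nonneg])

theorem IsClosVal.add (hlam : lam ∈ DD p n d) {a b : GSer p n d} {z w : ℂ_[p]}
    (ha : IsClosVal lam a z) (hb : IsClosVal lam b w) : IsClosVal lam (a + b) (z + w) :=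
  fun ε hε => by
  obtain ⟨s, x, hs, h1, h2⟩ := ha ε hε
  obtain ⟨t, y, ht, h3, h4⟩ := hb ε hε
  refine ⟨s + t, x + y, hs.add hlam ht, ?_, ?_⟩
  · rw [add_sub_add_comm]; exact h1.add h3
  · rw [add_sub_add_comm]
    exact (IsUltrametricDist.norm_add_le_max _ _).trans (max_le h2 h4)

theorem IsClosVal.neg (hlam : lam ∈ DD p n d) {a : GSer p n d} {z : ℂ_[p]}
    (ha : IsClosVal lam a z) : IsClosVal lam (-a) (-z) := fun ε hε => by
  obtain ⟨s, x, hs, h1, h2⟩ := ha ε hε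
  refine ⟨-s, -x, hs.neg hlam, ?_, ?_⟩
  · rw [← neg_sub']; exact h1.neg
  · rw [← neg_sub', norm_neg]; exact h2

theorem IsClosVal.unique (hlam : lam ∈ DD p n d) {a : GSer p n d} {z w : ℂ_[p]}
    (hz : IsClosVal lam a z) (hw : IsClosVal lam a w) : z = w := by
  have h := (hz.add hlam (hw.neg hlam)).norm_le hlam (C := 0)
    (by rw [add_neg_cancel]; exact bddBy_zero le_rfl)
  rw [← sub_eq_add_neg] at h
  exact sub_eq_zero.1 (norm_le_zero_iff.1 h)

theorem IsClosVal.mul (hlam : lam ∈ DD p n d) {a b : GSer p n d} {z w : ℂ_[p]}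
    (ha : IsClosVal lam a z) (hb : IsClosVal lam b w) : IsClosVal lam (a * b) (z * w) := by
  intro ε hε
  obtain ⟨C, hC, haC⟩ := exists_bddBy a
  obtain ⟨D, hD, hbD⟩ := exists_bddBy b
  obtain ⟨t, y, ht, hbt, hwy⟩ := hb (min (ε / C) D) (by positivity)
  obtain ⟨s, x, hs, has, hzx⟩ := ha (ε / D) (by positivity)
  have htD : BddBy t D := by
    have := hbD.sub (hbt.mono_right (min_le_right _ _))
    rwa [sub_sub_cancel] at this
  have hy : ‖y‖ ≤ D := ht.norm_le hlam htD
  have hz : ‖z‖ ≤ C := ha.norm_le hlam haC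
  refine ⟨s * t, x * y, hs.mul hlam ht, ?_, ?_⟩
  · have h1 : a * b - s * t = a * (b - t) + (a - s) * t := by ring
    rw [h1]
    refine BddBy.add ((haC.mul (hbt.mono_right (min_le_left _ _))).mono_right ?_)
      ((has.mul htD).mono_right ?_)
    · rw [mul_div_cancel₀ _ hC.ne']
    · rw [div_mul_cancel₀ _ hD.ne']
  · have h1 : z * w - x * y = z * (w - y) + (z - x) * y := by ring
    rw [h1]
    refine (IsUltrametricDist.norm_add_le_max _ _).trans (max_le ?_ ?_)
    · rw [norm_mul]
      calc ‖z‖ * ‖w - y‖ ≤ C * (ε / C) :=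
            mul_le_mul hz (hwy.trans (min_le_left _ _)) (norm_nonneg _) hC.le
        _ = ε := mul_div_cancel₀ _ hC.ne'
    · rw [norm_mul]
      calc ‖z - x‖ * ‖y‖ ≤ ε / D * D := mul_le_mul hzx hy (norm_nonneg _) (by positivity)
        _ = ε := div_mul_cancel₀ _ hD.ne'

theorem exists_isClosVal (hlam : lam ∈ DD p n d) {a : GSer p n d}
    (ha : a ∈ closRing (fracRing p n d)) : ∃ z, IsClosVal lam a z := by
  have h1 : ∀ m : ℕ, ∃ s z, IsFracVal lam s z ∧ BddBy (a - s) ((1 / 2 : ℝ) ^ m) := fun m => by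
    obtain ⟨s, hs, h⟩ := ha ((1 / 2 : ℝ) ^ m) (by positivity)
    obtain ⟨z, hz⟩ := exists_isFracVal (lam := lam) hs
    exact ⟨s, z, hz, h⟩
  choose s z hz hs using h1
  have h2 : ∀ m k, m ≤ k → ‖z k - z m‖ ≤ (1 / 2 : ℝ) ^ m := fun m k hmk => by
    rw [sub_eq_add_neg]
    refine ((hz k).add hlam ((hz m).neg hlam)).norm_le hlam ?_
    have h3 := (hs m).sub ((hs k).mono_right (pow_le_pow_of_le_one (by norm_num) (by norm_num) hmk))
    rwa [sub_sub_sub_cancel_left, sub_eq_add_neg] at h3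
  have hlim : Tendsto (fun m : ℕ => (1 / 2 : ℝ) ^ m) atTop (𝓝 0) :=
    tendsto_pow_atTop_nhds_zero_of_lt_one (by norm_num) (by norm_num)
  have hc : CauchySeq z := by
    refine cauchySeq_of_le_tendsto_0' (fun m => (1 / 2 : ℝ) ^ m) (fun m k hmk => ?_) hlim
    rw [dist_comm, dist_eq_norm]
    exact h2 m k hmk
  obtain ⟨w, hw⟩ := cauchySeq_tendsto_of_complete hc
  refine ⟨w, fun ε hε => ?_⟩
  obtain ⟨m, hm⟩ := exists_pow_lt_of_lt_one hε (by norm_num : (1 / 2 : ℝ) < 1)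
  refine ⟨s m, z m, hz m, (hs m).mono_right hm.le, ?_⟩
  have h4 : Tendsto (fun k => ‖z k - z m‖) atTop (𝓝 ‖w - z m‖) := (hw.sub_const _).norm
  refine (le_of_tendsto h4 ?_).trans hm.le
  filter_upwards [eventually_ge_atTop m] with k hk using h2 m k hk

/-- Evaluation of the limits of quotients `h / D^k` at a point of `𝓓`. -/
def closEval (hlam : lam ∈ DD p n d) : closRing (fracRing p n d) →+* ℂ_[p] where
  toFun a := (exists_isClosVal hlam a.2).choose
  map_one' := (exists_isClosVal hlam (one_mem _)).choose_spec.unique hlam (by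
    have := IsFracVal.mono (lam := lam) (m := 0) (fun _ _ => le_rfl) 1
    rw [mono_zero_one] at this
    simpa [monoEval] using this.isClosVal)
  map_mul' a b := (exists_isClosVal hlam (a * b).2).choose_spec.unique hlam
    ((exists_isClosVal hlam a.2).choose_spec.mul hlam (exists_isClosVal hlam b.2).choose_spec)
  map_zero' := (exists_isClosVal hlam (zero_mem _)).choose_spec.unique hlam (by
    have := IsFracVal.mono (lam := lam) (m := 0) (fun _ _ => le_rfl) 0
    rw [mono_zero] at this
    simpa [monoEval] using this.isClosVal)
  map_add' a b := (exists_isClosVal hlam (a + b).2).choose_spec.unique hlam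
    ((exists_isClosVal hlam a.2).choose_spec.add hlam (exists_isClosVal hlam b.2).choose_spec)

theorem isClosVal_closEval (hlam : lam ∈ DD p n d) (a : closRing (fracRing p n d)) :
    IsClosVal lam a.1 (closEval hlam a) := (exists_isClosVal hlam a.2).choose_spec

/-! ### Comparison with the definition of values -/

theorem IsFrac.exists_eq {η : Ser p n d} {h : LPoly ℂ_[p] n d} {k : ℕ} (hf : IsFrac η h k) :
    ∃ a : GSer p n d, a.1 = η ∧ h ∈ polyNN ℂ_[p] n d ∧ a = polyHom p n d h * gDinv p n d ^ k := by
  obtain ⟨h1, h2, h3⟩ := hf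
  refine ⟨⟨η, tame_of_bdd_supportE h1⟩, rfl, fun l hl => nonnegOff_of_mem_ESet (h2.2 l hl), ?_⟩
  set a : GSer p n d := ⟨η, tame_of_bdd_supportE h1⟩ with ha
  have h4 : a * gD p n d ^ k = polyHom p n d h := by
    refine Subtype.ext ?_
    rw [polyHom_coe, ← h3, ← polyHom_coe, map_pow]
    rfl
  rw [← h4, mul_assoc, gD_pow_mul_gDinv_pow, mul_one]

theorem IsValE.exists_isClosVal {ξ : Ser p n d} (hξ : ξ ∈ RE' p n d) {z : ℂ_[p]}
    (h : IsValE ξ lam z) : ∃ a : GSer p n d, a.1 = ξ ∧ IsClosVal lam a z := by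
  have ht : Tame (wt n d) ξ := tame_of_approx hξ.1 fun ε hε => by
    obtain ⟨η, h, k, hf, h1, -⟩ := h ε hε
    exact ⟨η, tame_of_bdd_supportE hf.1, h1⟩
  refine ⟨⟨ξ, ht⟩, rfl, fun ε hε => ?_⟩
  obtain ⟨η, h, k, hf, h1, h2⟩ := h ε hε
  obtain ⟨a, rfl, hh, rfl⟩ := hf.exists_eq
  exact ⟨_, _, ⟨h, hh, k, rfl, rfl⟩, h1, h2⟩

theorem IsValTilde.exists_isClosVal (hlam : lam ∈ DD p n d) {η : Ser p n d} {z : ℂ_[p]}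
    (h : IsValTilde η lam z) : ∃ a : GSer p n d, a.1 = η ∧ IsClosVal lam a z := by
  obtain ⟨s, ξ, w, ⟨h1, rfl⟩, h2, rfl⟩ := h
  have h3 : ∀ m ∈ s, ∃ a : GSer p n d, a.1 = ξ m ∧ IsClosVal lam a (w m) := fun m hm =>
    (h2 m hm).exists_isClosVal (h1 m hm).2
  choose! a ha ha' using h3
  refine ⟨∑ m ∈ s, mono (wt n d) m 1 * a m, ?_, ?_⟩
  · rw [coe_sum]
    exact Finset.sum_congr rfl fun m hm => by rw [← shift_eq, ha m hm]
  · have h4 : ∀ t ⊆ s, IsClosVal lam (∑ m ∈ t, mono (wt n d) m 1 * a m)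
        (∑ m ∈ t, (∏ k, lam k ^ m k) * w m) := by
      classical
      intro t
      induction t using Finset.induction_on with
      | empty =>
        intro _
        have := IsFracVal.mono (lam := lam) (m := 0) (fun _ _ => le_rfl) 0
        rw [mono_zero] at this
        simpa [monoEval] using this.isClosVal
      | insert m t hm ih =>
        intro hsub
        have hms := hsub (Finset.mem_insert_self m t)
        rw [Finset.sum_insert hm, Finset.sum_insert hm]
        refine IsClosVal.add hlam (IsClosVal.mul hlam ?_ (ha' m hms))
          (ih ((Finset.subset_insert m t).trans hsub))
        have := (IsFracVal.mono (lam := lam) (h1 m hms).1 1).isClosVal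
        rwa [one_mul] at this
    exact h4 s subset_rfl

theorem isVal_iff (hlam : lam ∈ DD p n d) (a : closRing (fracRing p n d)) (z : ℂ_[p]) :
    IsVal a.1.1 lam z ↔ z = closEval hlam a := by
  constructor
  · intro h
    refine sub_eq_zero.1 (norm_le_zero_iff.1 (le_of_forall_pos_le_add fun ε hε => ?_))
    rw [zero_add]
    obtain ⟨η, w, h1, h2, h3⟩ := h ε hε
    obtain ⟨b, rfl, hb⟩ := h1.exists_isClosVal hlam
    have h4 := ((isClosVal_closEval hlam a).add hlam (hb.neg hlam)).norm_le hlam (C := ε)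
      (by rw [← sub_eq_add_neg]; exact h2)
    have h5 := IsUltrametricDist.norm_add_le_max (z - w) (-(closEval hlam a + -w))
    rw [norm_neg] at h5
    have h6 : z - w + -(closEval hlam a + -w) = z - closEval hlam a := by ring
    rw [h6] at h5
    exact h5.trans (max_le h3 h4)
  · rintro rfl ε hε
    obtain ⟨s, w, ⟨h, hh, k, rfl, rfl⟩, h1, h2⟩ := isClosVal_closEval hlam a ε hε
    refine ⟨_, _, ⟨_, _, fun m => h.coeff m / lpEval (Dpoly ℂ_[p] p n d) lam ^ k,
      polyHom_mul_gDinv_pow_isExpansion hh k, fun m _ ε hε => ?_, rfl⟩, h1, ?_⟩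
    · refine ⟨_, _, k, const_mul_gDinv_pow_isFrac (h.coeff m) k, fun l => ?_, ?_⟩
      · rw [sub_self, Pi.zero_apply, norm_zero]; exact hε.le
      · have h3 : lpEval (AddMonoidAlgebra.single (0 : Expo n d) (h.coeff m)) lam = h.coeff m := by
          refine (evalAdd_single lam 0 _).trans ?_
          simp [monoEval]
        rw [h3, sub_self, norm_zero]; exact hε.le
    · convert h2 using 3
      have h3 : lpEval h lam = ∑ m ∈ h.coeff.support, h.coeff m * ∏ k, lam k ^ m k := rfl
      rw [h3, Finset.sum_div]
      exact Finset.sum_congr rfl fun m _ => by ring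

theorem existsUnique_isVal (hlam : lam ∈ DD p n d) {a : GSer p n d}
    (ha : a ∈ closRing (fracRing p n d)) : ∃! z, IsVal a.1 lam z :=
  ⟨closEval hlam ⟨a, ha⟩, (isVal_iff hlam ⟨a, ha⟩ _).2 rfl, fun _ h => (isVal_iff hlam ⟨a, ha⟩ _).1 h⟩

theorem value_eq (hlam : lam ∈ DD p n d) (a : closRing (fracRing p n d)) :
    value a.1.1 lam = closEval hlam a :=
  (isVal_iff hlam a _).1 (Classical.epsilon_spec (existsUnique_isVal hlam a.2).exists)

theorem mvalue_toS (hlam : lam ∈ DD p n d) (X : Matrix (Inn n d) (Inn n d) (closRing (fracRing p n d))) :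
    mvalue (toS ((closRing (fracRing p n d)).subtype.mapMatrix X)) lam =
      (closEval hlam).mapMatrix X := by
  ext i j
  exact value_eq hlam (X i j)

/-! ### Values and the Frobenius -/

theorem pow_mem_DD (hlam : lam ∈ DD p n d) : lam ^ p ∈ DD p n d := by
  refine ⟨fun k => ?_, fun k => ?_, ?_⟩
  · rw [Pi.pow_apply, norm_pow, hlam.1 k, one_pow]
  · rw [Pi.pow_apply, norm_pow]
    exact pow_le_one₀ (norm_nonneg _) (hlam.2.1 k)
  · have hD := Dpoly_mem_polyNN (p := p) (n := n) (d := d) ℂ_[p]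
    have h1 := norm_lpEval_le hlam (h := polyFrob p (Dpoly ℂ_[p] p n d) - Dpoly ℂ_[p] p n d ^ p)
      (sub_mem (polyFrob_mem_polyNN hD) (pow_mem hD p)) (C := (p : ℝ)⁻¹) (by
        rw [map_sub, map_pow, ← frobHom_polyHom]
        exact bddBy_frob_gD_sub)
    have h2 : lpEval (polyFrob p (Dpoly ℂ_[p] p n d) - Dpoly ℂ_[p] p n d ^ p) lam =
        lpEval (Dpoly ℂ_[p] p n d) (lam ^ p) - lpEval (Dpoly ℂ_[p] p n d) lam ^ p := by
      have h3 := map_sub (evalNN lam (DD.ne_zero hlam)) ⟨_, polyFrob_mem_polyNN (p := p) hD⟩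
        (⟨_, hD⟩ ^ p)
      rw [map_pow] at h3
      rw [← evalAdd_polyFrob]
      exact h3
    rw [h2] at h1
    refine norm_eq_one_of_sub (inv_prime_lt_one p) h1 ?_
    rw [norm_pow, hlam.2.2, one_pow]

theorem IsFracVal.frob (hlam : lam ∈ DD p n d) {s : GSer p n d} {w : ℂ_[p]}
    (h : IsFracVal (lam ^ p) s w) : IsClosVal lam (frobHom p n d s) w := by
  obtain ⟨h, hh, k, rfl, rfl⟩ := h
  have hD := Dpoly_mem_polyNN (p := p) (n := n) (d := d) ℂ_[p]
  have hDi : frobHom p n d (gDinv p n d) ∈ closRing (fracRing p n d) :=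
    frobHom_mem_closRing (le_closRing gDinv_mem_fracRing) bddBy_gDinv
  have hpoly : ∀ h ∈ polyNN ℂ_[p] n d, IsClosVal lam (frobHom p n d (polyHom p n d h))
      (lpEval h (lam ^ p)) := fun h hh => by
    rw [frobHom_polyHom, ← evalAdd_polyFrob]
    exact (IsFracVal.poly (polyFrob_mem_polyNN hh)).isClosVal
  have h0 := DD.D_ne_zero (pow_mem_DD hlam)
  have h1 : closEval hlam ⟨_, hDi⟩ = (lpEval (Dpoly ℂ_[p] p n d) (lam ^ p))⁻¹ := by
    have h2 := (hpoly _ hD).mul hlam (isClosVal_closEval hlam ⟨_, hDi⟩)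
    have h3 : frobHom p n d (polyHom p n d (Dpoly ℂ_[p] p n d)) * frobHom p n d (gDinv p n d) = 1 := by
      rw [← map_mul]
      exact (congrArg _ gD_mul_gDinv).trans (map_one _)
    simp only at h2
    rw [h3] at h2
    have h4 := isClosVal_closEval hlam 1
    rw [map_one] at h4
    exact eq_inv_of_mul_eq_one_right (h2.unique hlam h4)
  have h5 := (hpoly h hh).mul hlam (isClosVal_closEval hlam (⟨_, hDi⟩ ^ k))
  rw [map_pow, h1, inv_pow, ← div_eq_mul_inv] at h5
  rw [map_mul, map_pow]
  exact h5

theorem closEval_frob (hlam : lam ∈ DD p n d) {a : GSer p n d} (ha : a ∈ closRing (fracRing p n d))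
    (ha' : frobHom p n d a ∈ closRing (fracRing p n d)) :
    closEval hlam ⟨_, ha'⟩ = closEval (pow_mem_DD hlam) ⟨a, ha⟩ := by
  refine sub_eq_zero.1 (norm_le_zero_iff.1 (le_of_forall_pos_le_add fun ε hε => ?_))
  rw [zero_add]
  obtain ⟨s, w, hs, h1, h2⟩ := isClosVal_closEval (pow_mem_DD hlam) ⟨a, ha⟩ ε hε
  have h4 := ((isClosVal_closEval hlam ⟨_, ha'⟩).add hlam ((hs.frob hlam).neg hlam)).norm_le hlam
    (C := ε) (by
      rw [← sub_eq_add_neg, ← map_sub]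
      exact bddBy_frobHom h1)
  have h5 := IsUltrametricDist.norm_add_le_max (closEval hlam ⟨_, ha'⟩ + -w)
    (-(closEval (pow_mem_DD hlam) ⟨a, ha⟩ - w))
  rw [norm_neg] at h5
  have h6 : closEval hlam ⟨_, ha'⟩ + -w + -(closEval (pow_mem_DD hlam) ⟨a, ha⟩ - w) =
      closEval hlam ⟨_, ha'⟩ - closEval (pow_mem_DD hlam) ⟨a, ha⟩ := by ring
  rw [h6] at h5
  exact h5.trans (max_le h4 h2)

end Evaluation

/-! ### The value of `D(Λ)` over a ring -/

section DValue

variable {O : Type*} [CommRing O] {n d : ℕ}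

open Classical in
/-- The value of `D(Λ)` at a point with coordinates in a ring. -/
def dValue (p : ℕ) (lam : Mon n d → O) : O :=
  Matrix.det (Matrix.of fun i j : Inn n d =>
    (Ring.inverse (lam i.1) ^ p * lam j.1) *
      ∑ ν ∈ (Fintype.piFinset fun _ : Mon n d => Finset.range p).filter
        (fun ν => ∑ k, ν k • avec k = p • avec i.1 - avec j.1),
        (∏ k, Ring.inverse (Nat.factorial (ν k) : O)) * ∏ k, lam k ^ ν k)

theorem map_inverse_of_isUnit {K : Type*} [Field K] (f : O →+* K) {x : O} (hx : IsUnit x) :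
    f (Ring.inverse x) = (f x)⁻¹ :=
  eq_inv_of_mul_eq_one_left (by rw [← map_mul, Ring.inverse_mul_cancel x hx, map_one])

theorem map_dValue {K : Type*} [Field K] (f : O →+* K) {p : ℕ} [Fact p.Prime] {lam : Mon n d → O}
    (hlam : ∀ k : Inn n d, IsUnit (lam k.1)) (hfact : ∀ m < p, IsUnit (Nat.factorial m : O)) :
    f (dValue p lam) = lpEval (Dpoly K p n d) fun k => f (lam k) := by
  classical
  rw [lpEval_Dpoly fun k => ((hlam k).map f).ne_zero, dValue, RingHom.map_det]
  congr 1
  ext i j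
  simp only [RingHom.mapMatrix_apply, Matrix.map_apply, Matrix.of_apply, map_mul, map_pow, map_sum,
    map_prod, map_inverse_of_isUnit f (hlam i)]
  congr 1
  refine Finset.sum_congr (by congr) fun ν hν => ?_
  rw [← Finset.prod_inv_distrib]
  congr 1
  refine Finset.prod_congr rfl fun k _ => ?_
  have hk := Finset.mem_range.1 (Fintype.mem_piFinset.1 (Finset.mem_filter.1 hν).1 k)
  rw [map_inverse_of_isUnit f (hfact _ hk), map_natCast]

end DValue

/-! ### Teichmüller points -/

section Teichmueller

variable {p : ℕ} [hp : Fact p.Prime] {n d : ℕ}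

open MonoidWithZeroHom.ValueGroup₀ in
theorem norm_eq_valuation (x : ℂ_[p]) : ‖x‖ = ((Valued.v x : NNReal) : ℝ) := by
  rw [PadicComplex.norm_eq_norm, Valued.v.norm_def, PadicComplex.RankOne.hom_eq_embedding,
    Valuation.embedding_restrict]

theorem norm_coe_le_one (x : 𝓞_ℂ_[p]) : ‖(x : ℂ_[p])‖ ≤ 1 := by
  rw [norm_eq_valuation]
  exact_mod_cast x.2

theorem norm_coe_eq_one {x : 𝓞_ℂ_[p]} (hx : IsUnit x) : ‖(x : ℂ_[p])‖ = 1 := by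
  obtain ⟨y, hy⟩ := hx.exists_right_inv
  have h1 : ‖(x : ℂ_[p])‖ * ‖(y : ℂ_[p])‖ = 1 := by
    rw [← norm_mul, ← MulMemClass.coe_mul, hy, OneMemClass.coe_one, norm_one]
  exact le_antisymm (norm_coe_le_one x) (by
    rw [← h1]
    exact mul_le_of_le_one_right (norm_nonneg _) (norm_coe_le_one y))

theorem isUnit_of_norm_eq_one {x : 𝓞_ℂ_[p]} (hx : ‖(x : ℂ_[p])‖ = 1) : IsUnit x := by
  have hy : (x : ℂ_[p])⁻¹ ∈ 𝓞_ℂ_[p] := by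
    change Valued.v (x : ℂ_[p])⁻¹ ≤ (1 : NNReal)
    rw [← NNReal.coe_le_coe, ← norm_eq_valuation, norm_inv, hx, inv_one, NNReal.coe_one]
  refine IsUnit.of_mul_eq_one ⟨_, hy⟩ (Subtype.ext ?_)
  exact mul_inv_cancel₀ (norm_ne_zero_iff.1 (by rw [hx]; exact one_ne_zero))

theorem isUnit_factorial {m : ℕ} (hm : m < p) : IsUnit (m.factorial : 𝓞_ℂ_[p]) :=
  isUnit_of_norm_eq_one (by
    have h : ((m.factorial : 𝓞_ℂ_[p]) : ℂ_[p]) = m.factorial := map_natCast (𝓞_ℂ_[p]).subtype _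
    rw [h]
    exact norm_factorial_eq_one norm_prime hm)

theorem teich_mem_DD {k : Type*} [Field k] [Fintype k]
    {ι : k →+* IsLocalRing.ResidueField 𝓞_ℂ_[p]} {lam : Mon n d → k}
    (hlam : ∀ m : Inn n d, lam m.1 ≠ 0) (hD : lpEval (Dpoly k p n d) lam ≠ 0)
    {lamHat : Mon n d → 𝓞_ℂ_[p]} (h : IsTeich ι lam lamHat) :
    (fun m => (lamHat m : ℂ_[p])) ∈ DD p n d := by
  have hu : ∀ m : Inn n d, IsUnit (lamHat m.1) := fun m =>
    (IsLocalRing.residue_ne_zero_iff_isUnit _).1 (by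
      rw [(h m.1).2]
      exact (map_ne_zero ι).2 (hlam m))
  have hfk : ∀ m < p, IsUnit (m.factorial : k) := fun m hm => by
    refine isUnit_iff_ne_zero.2 ((map_ne_zero ι).1 ?_)
    rw [map_natCast, ← map_natCast (IsLocalRing.residue 𝓞_ℂ_[p])]
    exact (IsLocalRing.residue_ne_zero_iff_isUnit _).2 (isUnit_factorial hm)
  have hk : ∀ m : Inn n d, IsUnit (lam m.1) := fun m => isUnit_iff_ne_zero.2 (hlam m)
  have h1 : IsUnit (dValue p lamHat) := by
    refine (IsLocalRing.residue_ne_zero_iff_isUnit _).1 ?_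
    rw [map_dValue (IsLocalRing.residue 𝓞_ℂ_[p]) hu fun m hm => isUnit_factorial hm]
    simp only [(h _).2]
    rw [← map_dValue ι hk hfk]
    refine (map_ne_zero ι).2 ?_
    have h2 := map_dValue (RingHom.id k) hk hfk
    rw [RingHom.id_apply] at h2
    rw [h2]
    exact hD
  refine ⟨fun m => norm_coe_eq_one (hu m), fun m => norm_coe_le_one _, ?_⟩
  rw [← norm_coe_eq_one h1]
  exact congrArg norm (map_dValue (𝓞_ℂ_[p]).subtype hu fun m hm => isUnit_factorial hm).symm

theorem pow_pow_mem_DD {lam : Mon n d → ℂ_[p]} (hlam : lam ∈ DD p n d) (s : ℕ) :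
    lam ^ p ^ s ∈ DD p n d := by
  induction s with
  | zero => rwa [pow_zero, pow_one]
  | succ s ih =>
    rw [pow_succ, pow_mul]
    exact pow_mem_DD ih

end Teichmueller

/-! ### Products along an orbit of the Frobenius -/

section Telescope

theorem prod_conj {A : Type*} [Monoid A] {X Y H Hi : ℕ → A} (h1 : ∀ s, Hi s * H s = 1)
    (h0 : H 0 * Hi 0 = 1) (h : ∀ s, X s = H (s + 1) * Y s * Hi s) (a : ℕ) :
    ((List.range a).map fun s => X (a - 1 - s)).prod =
      H a * ((List.range a).map fun s => Y (a - 1 - s)).prod * Hi 0 := by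
  have hsucc : ∀ (Z : ℕ → A) (b : ℕ), ((List.range (b + 1)).map fun s => Z (b + 1 - 1 - s)).prod =
      Z b * ((List.range b).map fun s => Z (b - 1 - s)).prod := fun Z b => by
    rw [List.range_succ_eq_map, List.map_cons, List.prod_cons, List.map_map]
    congr 3
    funext s
    change Z _ = Z _
    congr 1
    omega
  induction a with
  | zero => simp [h0]
  | succ a ih =>
    rw [hsucc, hsucc, ih, h]
    calc _ = H (a + 1) * Y a * (Hi a * H a) *
          ((List.range a).map fun s => Y (a - 1 - s)).prod * Hi 0 := by simp only [mul_assoc]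
      _ = _ := by rw [h1, mul_one]; simp only [mul_assoc]

theorem det_one_sub_conj {K ι : Type*} [Field K] [Fintype ι] [DecidableEq ι] (P Q Qi : Matrix ι ι K)
    (hQ : Q * Qi = 1) :
    Matrix.det (1 - (Polynomial.X : Polynomial K) • (Q * P * Qi).map Polynomial.C) =
      Matrix.det (1 - (Polynomial.X : Polynomial K) • P.map Polynomial.C) := by
  have h1 : Q.map Polynomial.C * Qi.map Polynomial.C = 1 := by
    have := congrArg (Polynomial.C (R := K)).mapMatrix hQ
    rwa [map_mul, map_one] at this
  have h2 : (1 - (Polynomial.X : Polynomial K) • (Q * P * Qi).map Polynomial.C) =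
      Q.map Polynomial.C * (1 - (Polynomial.X : Polynomial K) • P.map Polynomial.C) *
        Qi.map Polynomial.C := by
    rw [Matrix.map_mul, Matrix.map_mul, mul_sub, sub_mul, mul_one, h1, Matrix.mul_smul,
      Matrix.smul_mul]
  rw [h2, Matrix.det_mul, Matrix.det_mul, mul_right_comm, ← Matrix.det_mul, h1, Matrix.det_one,
    one_mul]

variable {p : ℕ} [hp : Fact p.Prime] {n d : ℕ} {γ κ : ℂ_[p]} {lam : Mon n d → ℂ_[p]}

theorem mvalue_mul (hlam : lam ∈ DD p n d) {X Y : Matrix (Inn n d) (Inn n d) (GSer p n d)}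
    (hX : ∀ i j, X i j ∈ closRing (fracRing p n d)) (hY : ∀ i j, Y i j ∈ closRing (fracRing p n d)) :
    mvalue (toS (X * Y)) lam = mvalue (toS X) lam * mvalue (toS Y) lam := by
  let X' : Matrix (Inn n d) (Inn n d) (closRing (fracRing p n d)) := fun i j => ⟨X i j, hX i j⟩
  let Y' : Matrix (Inn n d) (Inn n d) (closRing (fracRing p n d)) := fun i j => ⟨Y i j, hY i j⟩
  have h := mvalue_toS hlam (X' * Y')
  rw [map_mul, map_mul, ← mvalue_toS, ← mvalue_toS] at h
  exact h

theorem mvalue_one (hlam : lam ∈ DD p n d) :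
    mvalue (toS (1 : Matrix (Inn n d) (Inn n d) (GSer p n d))) lam = 1 := by
  have h := mvalue_toS hlam (1 : Matrix (Inn n d) (Inn n d) (closRing (fracRing p n d)))
  rwa [map_one, map_one] at h

theorem mvalue_frob (hlam : lam ∈ DD p n d) {X : Matrix (Inn n d) (Inn n d) (GSer p n d)}
    (hX : ∀ i j, X i j ∈ closRing (fracRing p n d)) (h1 : ∀ i j, BddBy (X i j) 1) :
    mvalue (toS ((frobHom p n d).mapMatrix X)) lam = mvalue (toS X) (lam ^ p) := by
  ext i j
  have h2 := frobHom_mem_closRing (hX i j) (h1 i j)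
  exact (value_eq hlam ⟨_, h2⟩).trans ((closEval_frob hlam (hX i j) h2).trans
    (value_eq (pow_mem_DD hlam) ⟨_, hX i j⟩).symm)

theorem frobDet_eq (hγ : IsGamma γ) (hκ : IsEigen γ κ) (hlam : lam ∈ DD p n d) {a : ℕ}
    (ha : lam ^ p ^ a = lam) :
    frobDet (toS (gCalF p n d)) a lam = frobDet (toS (gCalG n d hγ)) a lam := by
  have hH := gH_mem_closRing (n := n) (d := d) hγ hκ
  have hHi := gHinv_mem_closRing (n := n) (d := d) hγ hκ
  have hG := gCalG_mem_closRing (n := n) (d := d) hγ hκ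
  have hfH : ∀ i j, (frobHom p n d).mapMatrix (gH n d γ) i j ∈ closRing (fracRing p n d) :=
    fun i j => frobHom_mem_closRing (hH i j) (bddBy_gH hγ i j)
  have hs := pow_pow_mem_DD hlam
  have hinv : ∀ s, mvalue (toS (gH n d γ)) (lam ^ p ^ s) *
      mvalue (toS (gHinv n d hγ)) (lam ^ p ^ s) = 1 := fun s => by
    rw [← mvalue_mul (hs s) hH hHi, gH_mul_gHinv, mvalue_one (hs s)]
  have hprod := prod_conj (X := fun s => mvalue (toS (gCalF p n d)) (lam ^ p ^ s))
    (Y := fun s => mvalue (toS (gCalG n d hγ)) (lam ^ p ^ s))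
    (H := fun s => mvalue (toS (gH n d γ)) (lam ^ p ^ s))
    (Hi := fun s => mvalue (toS (gHinv n d hγ)) (lam ^ p ^ s))
    (fun s => mul_eq_one_comm.1 (hinv s)) (hinv 0) (fun s => by
      rw [gCalF_eq hγ, mvalue_mul (hs s) (matrix_mul_mem _ hfH hG) hHi, mvalue_mul (hs s) hfH hG,
        mvalue_frob (hs s) hH (bddBy_gH hγ), ← pow_mul, ← pow_succ]) a
  rw [frobDet, hprod]
  have h0 : lam ^ p ^ 0 = lam := by rw [pow_zero, pow_one]
  simp only [ha, h0]
  refine det_one_sub_conj _ _ _ ?_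
  have := hinv 0
  rwa [h0] at this

end Telescope

section Vectors

variable {p : ℕ} [hp : Fact p.Prime] {n d : ℕ} {γ κ : ℂ_[p]}

theorem gFinv_eq (hγ : IsGamma γ) : gFinv p n d = gH n d γ * gGinv n d hγ := by
  rw [gH, mul_assoc, gG_mul_gGinv, mul_one]

theorem inSprime_gGinv_F (hγ : IsGamma γ) (hκ : IsEigen γ κ) :
    InSprime (mvec (toS (gGinv n d hγ)) (Fser p)) :=
  inSprime_of (vF p) (fun _ hu k => coe_liftSer_F k hu) (fun _ hu k => (Fser_mem_RRdeg k hu).2)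
    (gGinv_mem_supportE hγ) (bddBy_gGinv hγ)
    (fun _ hu k => (bddBy_vF hu k).mono_right (norm_factorial_le_one _))
    fun _ hu i => vZ_mem_closRing hγ hκ hu i

theorem inSprime_gFinv_F (hγ : IsGamma γ) (hκ : IsEigen γ κ) :
    InSprime (mvec (toS (gFinv p n d)) (Fser p)) :=
  inSprime_of (vF p) (fun _ hu k => coe_liftSer_F k hu) (fun _ hu k => (Fser_mem_RRdeg k hu).2)
    gFinv_mem_supportE bddBy_gFinv
    (fun _ hu k => (bddBy_vF hu k).mono_right (norm_factorial_le_one _))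
    fun u hu i => by
      rw [gFinv_eq hγ, ← Matrix.mulVec_mulVec]
      exact mulVec_mem _ (gH_mem_closRing hγ hκ) (vZ_mem_closRing hγ hκ hu) i

theorem inSprime_gFinv_G (hγ : IsGamma γ) (hκ : IsEigen γ κ) :
    InSprime (mvec (toS (gFinv p n d)) (Gser γ)) :=
  inSprime_of (vG γ) (fun _ hu k => coe_liftSer_G hγ k hu)
    (fun _ hu k => (Gser_mem_RRdeg hγ k hu).2) gFinv_mem_supportE bddBy_gFinv
    (fun _ hu k => (bddBy_vG hγ hu k).mono_right (norm_factorial_le_one _))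
    fun u hu i => by
      rw [gFinv_eq hγ, ← Matrix.mulVec_mulVec]
      exact mulVec_mem _ (gH_mem_closRing hγ hκ) (vY_mem_closRing hγ hκ hu) i

section Inverses

variable {X Y : Matrix (Inn n d) (Inn n d) (GSer p n d)}

theorem mapMatrix_frobHom_mem_supportE (hX : ∀ i j, X i j ∈ supportE p n d) (i j : Inn n d) :
    (frobHom p n d).mapMatrix X i j ∈ supportE p n d := frobHom_mem_supportE (hX i j)

theorem mapMatrix_frobHom_mul_eq_one (h : X * Y = 1) :
    (frobHom p n d).mapMatrix X * (frobHom p n d).mapMatrix Y = 1 := by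
  rw [← map_mul, h, map_one]

theorem isInverse_mfrob_toS (hX : ∀ i j, X i j ∈ supportE p n d) (hY : ∀ i j, Y i j ∈ supportE p n d)
    (h : X * Y = 1) : IsInverse (mfrob (toS X)) (toS ((frobHom p n d).mapMatrix Y)) :=
  isInverse_toS (mapMatrix_frobHom_mem_supportE hX) (mapMatrix_frobHom_mem_supportE hY)
    (mapMatrix_frobHom_mul_eq_one h)

theorem minv_mfrob_toS (hX : ∀ i j, X i j ∈ supportE p n d) (hY : ∀ i j, Y i j ∈ supportE p n d)
    (h : X * Y = 1) : minv (mfrob (toS X)) = toS ((frobHom p n d).mapMatrix Y) :=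
  minv_toS (mapMatrix_frobHom_mem_supportE hX) (mapMatrix_frobHom_mem_supportE hY)
    (mapMatrix_frobHom_mul_eq_one h)

end Inverses

theorem minv_Fmat : minv (Fmat p n d) = toS (gFinv p n d) := by
  rw [← toS_gF]
  exact minv_toS gF_mem_supportE gFinv_mem_supportE gF_mul_gFinv

theorem isInverse_Fmat : IsInverse (Fmat p n d) (minv (Fmat p n d)) := by
  rw [minv_Fmat, ← toS_gF]
  exact isInverse_toS gF_mem_supportE gFinv_mem_supportE gF_mul_gFinv

theorem minv_mfrob_Fmat :
    minv (mfrob (Fmat p n d)) = toS ((frobHom p n d).mapMatrix (gFinv p n d)) := by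
  rw [← toS_gF]
  exact minv_mfrob_toS gF_mem_supportE gFinv_mem_supportE gF_mul_gFinv

theorem isInverse_mfrob_Fmat : IsInverse (mfrob (Fmat p n d)) (minv (mfrob (Fmat p n d))) := by
  rw [minv_mfrob_Fmat, ← toS_gF]
  exact isInverse_mfrob_toS gF_mem_supportE gFinv_mem_supportE gF_mul_gFinv

theorem minv_Gmat (hγ : IsGamma γ) : minv (Gmat n d γ) = toS (gGinv n d hγ) := by
  rw [← toS_gG hγ]
  exact minv_toS (gG_mem_supportE hγ) (gGinv_mem_supportE hγ) (gG_mul_gGinv hγ)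

theorem isInverse_Gmat (hγ : IsGamma γ) : IsInverse (Gmat n d γ) (minv (Gmat n d γ)) := by
  rw [minv_Gmat hγ, ← toS_gG hγ]
  exact isInverse_toS (gG_mem_supportE hγ) (gGinv_mem_supportE hγ) (gG_mul_gGinv hγ)

theorem minv_mfrob_Gmat (hγ : IsGamma γ) :
    minv (mfrob (Gmat n d γ)) = toS ((frobHom p n d).mapMatrix (gGinv n d hγ)) := by
  rw [← toS_gG hγ]
  exact minv_mfrob_toS (gG_mem_supportE hγ) (gGinv_mem_supportE hγ) (gG_mul_gGinv hγ)

theorem isInverse_mfrob_Gmat (hγ : IsGamma γ) :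
    IsInverse (mfrob (Gmat n d γ)) (minv (mfrob (Gmat n d γ))) := by
  rw [minv_mfrob_Gmat hγ, ← toS_gG hγ]
  exact isInverse_mfrob_toS (gG_mem_supportE hγ) (gGinv_mem_supportE hγ) (gG_mul_gGinv hγ)

theorem gH_mem_supportE (hγ : IsGamma γ) (i j : Inn n d) : gH n d γ i j ∈ supportE p n d :=
  matrix_mul_mem _ gFinv_mem_supportE (gG_mem_supportE hγ) i j

theorem gHinv_mem_supportE (hγ : IsGamma γ) (i j : Inn n d) : gHinv n d hγ i j ∈ supportE p n d :=
  matrix_mul_mem _ (gGinv_mem_supportE hγ) gF_mem_supportE i j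

theorem gCalF_mem_supportE (i j : Inn n d) : gCalF p n d i j ∈ supportE p n d :=
  matrix_mul_mem _ (mapMatrix_frobHom_mem_supportE gFinv_mem_supportE) gF_mem_supportE i j

theorem gCalG_mem_supportE (hγ : IsGamma γ) (i j : Inn n d) : gCalG n d hγ i j ∈ supportE p n d :=
  matrix_mul_mem _ (mapMatrix_frobHom_mem_supportE (gGinv_mem_supportE hγ)) (gG_mem_supportE hγ) i j

theorem calH_eq (hγ : IsGamma γ) : calH n d γ = toS (gH n d γ) := by
  rw [calH, minv_Fmat, ← toS_gG hγ, mmul_toS, gH]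

theorem minv_calH (hγ : IsGamma γ) : minv (calH n d γ) = toS (gHinv n d hγ) := by
  rw [calH_eq hγ]
  exact minv_toS (gH_mem_supportE hγ) (gHinv_mem_supportE hγ) (gH_mul_gHinv hγ)

theorem isInverse_calH (hγ : IsGamma γ) : IsInverse (calH n d γ) (minv (calH n d γ)) := by
  rw [minv_calH hγ, calH_eq hγ]
  exact isInverse_toS (gH_mem_supportE hγ) (gHinv_mem_supportE hγ) (gH_mul_gHinv hγ)

theorem calF_eq : calF p n d = toS (gCalF p n d) := by
  rw [calF, minv_mfrob_Fmat, ← toS_gF, mmul_toS, gCalF]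

theorem calG_eq (hγ : IsGamma γ) : calG n d γ = toS (gCalG n d hγ) := by
  rw [calG, minv_mfrob_Gmat hγ, ← toS_gG hγ, mmul_toS, gCalG]

theorem calF_eq_mmul (hγ : IsGamma γ) :
    calF p n d = mmul (mmul (mfrob (calH n d γ)) (calG n d γ)) (minv (calH n d γ)) := by
  rw [minv_calH hγ, calH_eq hγ, calG_eq hγ, mfrob_toS, mmul_toS, mmul_toS, ← gCalF_eq hγ, calF_eq]

theorem frobDet_calF (hγ : IsGamma γ) (hκ : IsEigen γ κ) {lam : Mon n d → ℂ_[p]}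
    (hlam : lam ∈ DD p n d) {a : ℕ} (ha : lam ^ p ^ a = lam) :
    frobDet (calF p n d) a lam = frobDet (calG n d γ) a lam := by
  rw [calF_eq, calG_eq hγ]
  exact frobDet_eq hγ hκ hlam ha

theorem mem_RRdeg'_zero {a : GSer p n d} (h1 : a ∈ closRing (fracRing p n d))
    (h2 : a ∈ supportE p n d) : a.1 ∈ RRdeg' p n d 0 :=
  ⟨mem_RR'_of_closRing h1, hasDeg_of_supportE h2⟩

end Vectors

end HasseWitt

end

theorem proposition9p5 (p : ℕ) [Fact p.Prime] (n d : ℕ) (hd : n + 1 ≤ d)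
    (γ : ℂ_[p]) (hγ : IsGamma γ) :
    -- the series involved converge and lie in `R_u`
    (∀ (i : Inn n d), ∀ u ∈ MMinus n d,
      (∀ l, Summable fun w : Pairs n d u => Gterm γ i u w l) ∧
      Fser p i u ∈ RRdeg p n d u ∧ Gser γ i u ∈ RRdeg p n d u) ∧
    -- `F(Λ)`, `F(Λ^p)`, `G(Λ)`, `G(Λ^p)` are invertible, and `F(Λ)⁻¹` has entries in `R_E`
    IsInverse (Fmat p n d) (minv (Fmat p n d)) ∧
    (∀ i j, Fmat p n d i j ∈ RE p n d ∧ minv (Fmat p n d) i j ∈ RE p n d) ∧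
    IsInverse (mfrob (Fmat p n d)) (minv (mfrob (Fmat p n d))) ∧
    IsInverse (Gmat n d γ) (minv (Gmat n d γ)) ∧
    IsInverse (mfrob (Gmat n d γ)) (minv (mfrob (Gmat n d γ))) ∧
    -- `F(Λ)⁻¹ F(Λ, x)`, `G(Λ)⁻¹ F(Λ, x)`, `F(Λ)⁻¹ G(Λ, x)` lie in `(S')^M`
    InSprime (mvec (minv (Fmat p n d)) (Fser p)) ∧
    InSprime (mvec (minv (Gmat n d γ)) (Fser p)) ∧
    InSprime (mvec (minv (Fmat p n d)) (Gser γ)) ∧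
    -- `𝓗(Λ) = F(Λ)⁻¹ G(Λ)` is invertible over `R'_0`, with inverse `G(Λ)⁻¹ F(Λ)`
    (∀ i j, calH n d γ i j ∈ RRdeg' p n d 0) ∧
    (∀ i j, minv (calH n d γ) i j ∈ RRdeg' p n d 0) ∧
    IsInverse (calH n d γ) (minv (calH n d γ)) ∧
    minv (calH n d γ) = mmul (minv (Gmat n d γ)) (Fmat p n d) ∧
    -- `𝓕(Λ)` and `𝓖(Λ)` have entries in `R'_0` and `𝓕(Λ) = 𝓗(Λ^p) 𝓖(Λ) 𝓗(Λ)⁻¹`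
    (∀ i j, calF p n d i j ∈ RRdeg' p n d 0) ∧
    (∀ i j, calG n d γ i j ∈ RRdeg' p n d 0) ∧
    calF p n d = mmul (mmul (mfrob (calH n d γ)) (calG n d γ)) (minv (calH n d γ)) ∧
    -- the entries of `𝓕(Λ)` and `𝓖(Λ)` are functions on `𝓓`
    (∀ lam ∈ DD p n d, ∀ i j,
      (∃! z, IsVal (calF p n d i j) lam z) ∧ (∃! z, IsVal (calG n d γ i j) lam z)) ∧
    -- equality of determinants at Teichmüller points
    (∀ (k : Type*) [Field k] [Fintype k] (a : ℕ), Fintype.card k = p ^ a →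
      ∀ (ι : k →+* IsLocalRing.ResidueField 𝓞_ℂ_[p]) (lam : Mon n d → k),
      (∀ m : Inn n d, lam m.1 ≠ 0) → lpEval (Dpoly k p n d) lam ≠ 0 →
      ∀ lamHat : Mon n d → 𝓞_ℂ_[p], IsTeich ι lam lamHat →
        (∀ s < a, (fun m => (lamHat m : ℂ_[p])) ^ p ^ s ∈ DD p n d) ∧
        frobDet (calF p n d) a (fun m => (lamHat m : ℂ_[p])) =
          frobDet (calG n d γ) a (fun m => (lamHat m : ℂ_[p]))) := by
  obtain ⟨κ, hκ⟩ : ∃ κ, IsEigen γ κ := exists_frobenius_eigenvalue hγ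
  refine ⟨fun i u hu => ⟨fun l => (summable_Gterm_and_Gser_apply hγ i hu l).summable,
    Fser_mem_RRdeg i hu, Gser_mem_RRdeg hγ i hu⟩, isInverse_Fmat, fun i j => ?_,
    isInverse_mfrob_Fmat, isInverse_Gmat hγ, isInverse_mfrob_Gmat hγ, ?_, ?_, ?_,
    fun i j => ?_, fun i j => ?_, isInverse_calH hγ, ?_, fun i j => ?_, fun i j => ?_,
    calF_eq_mmul hγ, fun lam hlam i j => ?_, fun k _ _ a hcard ι lam hlam hD lamHat hT => ?_⟩
  · rw [minv_Fmat, ← toS_gF]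
    exact ⟨mem_RE_iff.2 (gF_mem_supportE i j), mem_RE_iff.2 (gFinv_mem_supportE i j)⟩
  · rw [minv_Fmat]
    exact inSprime_gFinv_F hγ hκ
  · rw [minv_Gmat hγ]
    exact inSprime_gGinv_F hγ hκ
  · rw [minv_Fmat]
    exact inSprime_gFinv_G hγ hκ
  · rw [calH_eq hγ]
    exact mem_RRdeg'_zero (gH_mem_closRing hγ hκ i j) (gH_mem_supportE hγ i j)
  · rw [minv_calH hγ]
    exact mem_RRdeg'_zero (gHinv_mem_closRing hγ hκ i j) (gHinv_mem_supportE hγ i j)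
  · rw [minv_calH hγ, minv_Gmat hγ, ← toS_gF, mmul_toS, gHinv]
  · rw [calF_eq]
    exact mem_RRdeg'_zero (gCalF_mem_closRing hγ hκ i j) (gCalF_mem_supportE i j)
  · rw [calG_eq hγ]
    exact mem_RRdeg'_zero (gCalG_mem_closRing hγ hκ i j) (gCalG_mem_supportE hγ i j)
  · rw [calF_eq, calG_eq hγ]
    exact ⟨existsUnique_isVal hlam (gCalF_mem_closRing hγ hκ i j),
      existsUnique_isVal hlam (gCalG_mem_closRing hγ hκ i j)⟩
  · have hmem := teich_mem_DD hlam hD hT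
    refine ⟨fun s _ => pow_pow_mem_DD hmem s, frobDet_calF hγ hκ hmem ?_⟩
    funext m
    have h := congrArg (fun x : 𝓞_ℂ_[p] => (x : ℂ_[p])) (hT m).1
    rw [hcard] at h
    exact h
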